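/- **Setting.** Fix $\ell>0$, $M>0$, $|a|<\ell$, and put $\Delta_\pm=(r^2+a^2)(1+\frac{r^2}{\ell^2})\pm 2Mr$, $\Sigma=r^2+a^2\cos^2\theta$, $\Delta_\theta=1-\frac{a^2}{\ell^2}\cos^2\theta$, $\Xi=1-\frac{a^2}{\ell^2}$. Assume that $\Delta_-$ has a largest real root $r_+$ (so the black hole is subextremal or extremal). On $\mathcal M=\mathbb R_{t^*}\times[r_+,\infty)\times S^2$ let $g$ be the Kerr–AdS metric $$\begin{aligned}g=&-\tfrac{\Delta_--\Delta_\theta a^2\sin^2\theta}{\Sigma}dt^{*2}+\tfrac{\Delta_+-a^2\sin^2\theta(1+\frac{r^2}{\ell^2}+\frac{\Sigma}{\ell^2})}{\Sigma(1+r^2/\ell^2)^2}dr^2+\tfrac{\Sigma}{\Delta_\theta}d\theta^2+\tfrac{\Delta_\theta(r^2+a^2)^2-\Delta_-a^2\sin^2\theta}{\Xi^2\Sigma}\sin^2\theta\,d\phi^2\\&-2\tfrac{\Delta_\theta(r^2+a^2)-\Delta_-}{\Xi\Sigma}a\sin^2\theta\,d\phi\,dt^*+\tfrac{2}{1+r^2/\ell^2}\big(\tfrac{2Mr}{\Sigma}-\tfrac{a^2}{\ell^2}\sin^2\theta\big)dt^*dr-\tfrac{2a\sin^2\theta}{1+r^2/\ell^2}\big(1+\tfrac{2Mr}{\Xi\Sigma}\big)d\phi\,dr.\end{aligned}$$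 Let $\Sigma_{t^*}$ be the slices of constant $t^*$, $n^\mu=-g^{t^*\mu}/\sqrt{-g^{t^*t^*}}$ their future unit normal, $\mathrm{vol}=\frac{\Sigma}{\Xi}\sin\theta\sqrt{-g^{t^*t^*}}\,dr\,d\theta\,d\phi$ their volume form, $d\omega=\sin\theta\,d\theta\,d\phi$, and $|\slashed\nabla\psi|^2=g_{\theta\theta}^{-1}(\partial_\theta\psi)^2+g_{\phi\phi}^{-1}(\partial_\phi\psi)^2$. Put $T=\partial_{t^*}$ and $N=T+\xi(r)n$. For $\alpha<\frac94$ put $$T_{\mu\nu}[\psi]=\partial_\mu\psi\,\partial_\nu\psi-\tfrac12 g_{\mu\nu}\big(g^{\rho\sigma}\partial_\rho\psi\,\partial_\sigma\psi-\tfrac{\alpha}{\ell^2}\psi^2\big),\qquad J^N_\mu[\psi]=T_{\mu\nu}[\psi]N^\nu,$$ $$\|\psi\|^2_{H^1_{KAdS}(\Sigma_{t^*})}=\int_{\Sigma_{t^*}}\Big[\tfrac1{r^2}(\partial_{t^*}\psi)^2+r^2(\partial_r\psi)^2+|\slashed\nabla\psi|^2+\psi^2\Big]r^2\,dr\,d\omega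 .$$ The space $CH^1_{KAdS}$ consists of the $\psi$ with $\psi\in C^0(\mathbb R_{t^*};H^1_{KAdS}(\Sigma_{t^*}))$ and $\frac1r\psi\in C^1(\mathbb R_{t^*};L^2(r^2dr\,d\omega))$. A $CH^1_{KAdS}$ solution with right-hand side $\mathcal F$ and horizon data $h$ is a $\psi\in CH^1_{KAdS}$ with $\Box_g\psi+\frac{\alpha}{\ell^2}\psi=\mathcal F(\cdot,\psi,D\psi)$ weakly on $\{r>r_+\}$, where $D\psi=(\frac1r\partial_{t^*}\psi,r\partial_r\psi,\frac1r\partial_\theta\psi,\frac1r\partial_\phi\psi)$ and the right-hand side is locally integrable, and such that for each $t^*$ and almost every direction, along radial lines and for a suitable a.e.-representative of $\psi(t^*,\cdot)$, $\psi\to h$ as $r\to r_+$ and $r^{3/2-s}\psi\to0$ as $r\to\infty$, with $s=\sqrt{\frac94-\alpha}$. **Proposition.** There is $R_1$, depending only on $(\ell,M,a)$, such that the following holds for all $\alpha<\frac94$, all $r_1\ge R_1$, all $r_+<r_0<r_1$ such that $T$ is uniformly timelike on $\{r\ge r_0\}$ (that is, $g(T,T)\le-\varepsilon$ there for some $\varepsilon>0$),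 all $\delta>0$, and all smooth $\xi\ge0$ with $\xi=1$ on $r\le r_0$ and $\xi=0$ on $r\ge r_1$ such that $N$ is uniformly timelike on $\{r\ge r_+\}$. There are constants $c>0$ and $\tilde C_\alpha>0$ (depending on $\ell,M,a,\alpha,r_0,r_1,\delta,\xi$ only) such that for every $\mathcal F$, every $h$, every $CH^1_{KAdS}$ solution $\psi$ and all $\tau\le\tau'$, the density $J^N_\mu[\psi]n^\mu\,\mathrm{vol}$ is integrable on $\Sigma_\tau$ and $$\int_{\Sigma_\tau}J^N_\mu[\psi]n^\mu\,\mathrm{vol}+\tilde C_\alpha\Big[\int_{\Sigma_{\tau'}\cap\{r<r_1+\delta\}}\psi^2\,\tfrac{\Sigma}{\Xi}\,dr\,d\omega+\int_\tau^{\tau'}\!\!\int_{\Sigma_{t^*}\cap\{r<r_1+\delta\}}\big(\psi^2+(\partial_{t^*}\psi)^2\big)\tfrac{\Sigma}{\Xi}\,dr\,d\omega\,dt^*\Big]\ \ge\ c\,\|\psi\|^2_{H^1_{KAdS}(\Sigma_\tau)} .$$ -/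

import Mathlib

open MeasureTheory Set Filter Topology
open scoped ContDiff

noncomputable section

/-- Parameters of a (sub)extremal Kerr--AdS exterior: AdS radius `ℓ`, mass `M`, rotation `a`, and
the horizon radius `rp`, the largest real root of
`Δ₋(r) = (r² + a²)(1 + r²/ℓ²) - 2 M r`. -/
structure KerrAdS where
  ℓ : ℝ
  M : ℝ
  a : ℝ
  rp : ℝ
  ℓ_pos : 0 < ℓ
  M_pos : 0 < M
  a_lt : |a| < ℓ
  horizon : IsGreatest {r : ℝ | (r ^ 2 + a ^ 2) * (1 + r ^ 2 / ℓ ^ 2) - 2 * M * r = 0} rp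

/-- Coordinates `(r, θ, φ)` on a slice `{t* = const}`. -/
abbrev Slice : Type := ℝ × ℝ × ℝ

/-- Coordinates `(t*, (r, θ, φ))` on the spacetime. -/
abbrev Spacetime : Type := ℝ × Slice

/-- The coordinate vectors `∂_r, ∂_θ, ∂_φ`. -/
def sliceVec : Fin 3 → Slice := ![(1, 0, 0), (0, 1, 0), (0, 0, 1)]

/-- The coordinate vectors `∂_{t*}, ∂_r, ∂_θ, ∂_φ`; this is the order of indices `0, 1, 2, 3`. -/
def spacetimeVec : Fin 4 → Spacetime :=
  ![(1, 0, 0, 0), (0, 1, 0, 0), (0, 0, 1, 0), (0, 0, 0, 1)]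

/-- `v` is the weak coordinate derivative of `u` in the `i`-th direction on the open set `Ω`. -/
def HasWeakPartial (Ω : Set Slice) (i : Fin 3) (u v : Slice → ℝ) : Prop :=
  LocallyIntegrableOn u Ω ∧ LocallyIntegrableOn v Ω ∧
    ∀ η : Slice → ℝ, ContDiff ℝ ∞ η → HasCompactSupport η → tsupport η ⊆ Ω →
      ∫ x in Ω, u x * fderiv ℝ η x (sliceVec i) = -∫ x in Ω, v x * η x

/-- `t ↦ w t` is a continuous curve in `L²(μ)`. -/
def ContinuousInL2 (μ : Measure Slice) (w : ℝ → Slice → ℝ) : Prop :=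
  ∃ u : ℝ → Lp ℝ 2 μ, Continuous u ∧ ∀ t, u t =ᵐ[μ] w t

/-- `t ↦ w t` is a continuously differentiable curve in `L²(μ)` with derivative `t ↦ w' t`. -/
def ContDiffInL2 (μ : Measure Slice) (w w' : ℝ → Slice → ℝ) : Prop :=
  ∃ u : ℝ → Lp ℝ 2 μ, ContDiff ℝ 1 u ∧ (∀ t, u t =ᵐ[μ] w t) ∧ ∀ t, ((deriv u t : Lp ℝ 2 μ) : Slice → ℝ) =ᵐ[μ] w' t

namespace KerrAdS

variable (K : KerrAdS)

/-! ### The metric -/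

/-- `1 + r²/ℓ²` -/
def warp (r : ℝ) : ℝ := 1 + r ^ 2 / K.ℓ ^ 2

/-- `Δ₋` -/
def deltaMinus (r : ℝ) : ℝ := (r ^ 2 + K.a ^ 2) * K.warp r - 2 * K.M * r

/-- `Δ₊` -/
def deltaPlus (r : ℝ) : ℝ := (r ^ 2 + K.a ^ 2) * K.warp r + 2 * K.M * r

/-- `Σ` -/
def sig (r θ : ℝ) : ℝ := r ^ 2 + K.a ^ 2 * Real.cos θ ^ 2

/-- `Δ_θ` -/
def deltaTheta (θ : ℝ) : ℝ := 1 - K.a ^ 2 / K.ℓ ^ 2 * Real.cos θ ^ 2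

/-- `Ξ` -/
def xi : ℝ := 1 - K.a ^ 2 / K.ℓ ^ 2

def gtt (r θ : ℝ) : ℝ :=
  -(K.deltaMinus r - K.deltaTheta θ * K.a ^ 2 * Real.sin θ ^ 2) / K.sig r θ

def grr (r θ : ℝ) : ℝ :=
  (K.deltaPlus r - K.a ^ 2 * Real.sin θ ^ 2 * (K.warp r + K.sig r θ / K.ℓ ^ 2))
    / (K.sig r θ * K.warp r ^ 2)

def gθθ (r θ : ℝ) : ℝ := K.sig r θ / K.deltaTheta θ

def gφφ (r θ : ℝ) : ℝ :=
  (K.deltaTheta θ * (r ^ 2 + K.a ^ 2) ^ 2 - K.deltaMinus r * K.a ^ 2 * Real.sin θ ^ 2)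
    / (K.xi ^ 2 * K.sig r θ) * Real.sin θ ^ 2

def gtφ (r θ : ℝ) : ℝ :=
  -(K.deltaTheta θ * (r ^ 2 + K.a ^ 2) - K.deltaMinus r) / (K.xi * K.sig r θ)
    * K.a * Real.sin θ ^ 2

def gtr (r θ : ℝ) : ℝ :=
  (2 * K.M * r / K.sig r θ - K.a ^ 2 / K.ℓ ^ 2 * Real.sin θ ^ 2) / K.warp r

def grφ (r θ : ℝ) : ℝ :=
  -(K.a * Real.sin θ ^ 2 / K.warp r) * (1 + 2 * K.M * r / (K.xi * K.sig r θ))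

/-- The Kerr--AdS metric in the horizon-regular coordinates `(t*, r, θ, φ)`. -/
def metric (x : Slice) : Matrix (Fin 4) (Fin 4) ℝ :=
  !![K.gtt x.1 x.2.1, K.gtr x.1 x.2.1, 0, K.gtφ x.1 x.2.1;
     K.gtr x.1 x.2.1, K.grr x.1 x.2.1, 0, K.grφ x.1 x.2.1;
     0, 0, K.gθθ x.1 x.2.1, 0;
     K.gtφ x.1 x.2.1, K.grφ x.1 x.2.1, 0, K.gφφ x.1 x.2.1]

/-- The inverse metric `g^{μν}`. -/
def invMetric (x : Slice) : Matrix (Fin 4) (Fin 4) ℝ := (K.metric x)⁻¹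

/-- `√|det g|` -/
def sqrtDet (x : Slice) : ℝ := √|(K.metric x).det|

/-- The weight `(Σ/Ξ) sin θ` of the measure `(Σ/Ξ) dr dω`. -/
def sigWeight (x : Slice) : ℝ := K.sig x.1 x.2.1 / K.xi * Real.sin x.2.1

/-- The open coordinate domain `r > r₊`, `0 < θ < π`, `φ ∈ ℝ`; functions on the slice are
`2π`-periodic in `φ`. -/
def coordDomain : Set Slice := Ioi K.rp ×ˢ Ioo 0 Real.pi ×ˢ univ

/-- One period of the coordinate domain; it parametrizes the slice up to a null set. -/
def fundDomain : Set Slice := Ioi K.rp ×ˢ Ioo 0 Real.pi ×ˢ Ioo 0 (2 * Real.pi)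

/-! ### Vector fields and timelike character -/

/-- The value `g(X, Y)`. -/
def pairing (x : Slice) (X Y : Fin 4 → ℝ) : ℝ := ∑ μ, ∑ ν, K.metric x μ ν * X μ * Y ν

/-- `T = ∂_{t*}` -/
def vecT : Slice → Fin 4 → ℝ := fun _ => Pi.single 0 1

/-- The future-directed unit normal `n^μ = -g^{t*μ} / √(-g^{t*t*})` of the slices. -/
def normal (x : Slice) : Fin 4 → ℝ := fun μ => -K.invMetric x 0 μ / √(-K.invMetric x 0 0)

/-- `N = T + ξ(r) Y` with `Y` the unit normal of the slices. -/
def vecN (ξ : ℝ → ℝ) (x : Slice) : Fin 4 → ℝ := vecT x + ξ x.1 • K.normal x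

/-- The (stationary) vector field `X` is uniformly timelike on `{r ≥ ρ}`. -/
def UniformlyTimelike (X : Slice → Fin 4 → ℝ) (ρ : ℝ) : Prop :=
  ∃ ε > 0, ∀ r θ φ : ℝ, ρ ≤ r → θ ∈ Ioo 0 Real.pi →
    K.pairing (r, θ, φ) (X (r, θ, φ)) (X (r, θ, φ)) ≤ -ε

/-! ### Energies -/

/-- The energy-momentum tensor
`T_{μν} = ∂_μψ ∂_νψ - ½ g_{μν} (g^{ρσ} ∂_ρψ ∂_σψ - (α/ℓ²) ψ²)` of a function with value `v` and
coordinate derivatives `dv` at `x`. -/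
def energyMomentum (α : ℝ) (x : Slice) (v : ℝ) (dv : Fin 4 → ℝ) (μ ν : Fin 4) : ℝ :=
  dv μ * dv ν - 1 / 2 * K.metric x μ ν *
    ((∑ ρ, ∑ σ, K.invMetric x ρ σ * dv ρ * dv σ) - α / K.ℓ ^ 2 * v ^ 2)

/-- The current `J^X_μ = T_{μν} X^ν`. -/
def current (α : ℝ) (X : Fin 4 → ℝ) (x : Slice) (v : ℝ) (dv : Fin 4 → ℝ) (μ : Fin 4) : ℝ :=
  ∑ ν, K.energyMomentum α x v dv μ ν * X ν

/-- The coordinate density `(Σ/Ξ) sin θ √(-g^{t*t*})` of the induced volume of the slices. -/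
def volSlice (x : Slice) : ℝ := K.sigWeight x * √(-K.invMetric x 0 0)

/-- The coordinate density of `J^N_μ[ψ] n^μ vol` on a slice. -/
def fluxDensity (α : ℝ) (ξ : ℝ → ℝ) (x : Slice) (v : ℝ) (dv : Fin 4 → ℝ) : ℝ :=
  (∑ μ, K.current α (K.vecN ξ x) x v dv μ * K.normal x μ) * K.volSlice x

/-- `|∇̸ψ|²`, the squared norm of the gradient for the induced metric on the spheres of constant
`(t*, r)`, in terms of `∂_θψ` and `∂_φψ`. -/
def angGradSq (x : Slice) (vθ vφ : ℝ) : ℝ :=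
  (K.gθθ x.1 x.2.1)⁻¹ * vθ ^ 2 + (K.gφφ x.1 x.2.1)⁻¹ * vφ ^ 2

/-- The squared norm
`∫ (r⁻² (∂_{t*}ψ)² + r² (∂_rψ)² + |∇̸ψ|² + ψ²) r² dr dω` of the data `(ψ, dψ)` on a slice. -/
def normH1Sq (v : Slice → ℝ) (dv : Fin 4 → Slice → ℝ) : ℝ :=
  ∫ x in K.fundDomain,
    ((1 / x.1 ^ 2) * dv 0 x ^ 2 + x.1 ^ 2 * dv 1 x ^ 2 + K.angGradSq x (dv 2 x) (dv 3 x)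
      + v x ^ 2) * (x.1 ^ 2 * Real.sin x.2.1)

/-! ### The function space and the problem -/

/-- The measure `r² dr dω` of `L²_KAdS`. -/
def measureL2 : Measure Slice :=
  (volume.restrict K.fundDomain).withDensity
    (fun x => ENNReal.ofReal (x.1 ^ 2 * Real.sin x.2.1))

/-- `ψ ∈ C⁰(ℝ; H¹_KAdS)` and `ψ/r ∈ C¹(ℝ; L²_KAdS)`, with derivatives
`dψ = (∂_{t*}ψ, ∂_rψ, ∂_θψ, ∂_φψ)`: the spatial ones are weak derivatives on every slice and
`∂_{t*}ψ` is the derivative of the curve in `L²`. The poles of the spheres are negligible: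
they have codimension two. -/
structure MemCH1 (ψ : ℝ → Slice → ℝ) (dψ : Fin 4 → ℝ → Slice → ℝ) : Prop where
  periodic : ∀ t r θ φ, ψ t (r, θ, φ + 2 * Real.pi) = ψ t (r, θ, φ)
  periodic_deriv : ∀ μ t r θ φ, dψ μ t (r, θ, φ + 2 * Real.pi) = dψ μ t (r, θ, φ)
  weak : ∀ (t : ℝ) (i : Fin 3), HasWeakPartial K.coordDomain i (ψ t) (dψ i.succ t)
  cont : ContinuousInL2 K.measureL2 ψ
  cont_r : ContinuousInL2 K.measureL2 (fun t x => x.1 * dψ 1 t x)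
  cont_θ : ContinuousInL2 K.measureL2 (fun t x => √((K.gθθ x.1 x.2.1)⁻¹) * dψ 2 t x)
  cont_φ : ContinuousInL2 K.measureL2 (fun t x => √((K.gφφ x.1 x.2.1)⁻¹) * dψ 3 t x)
  cont_t : ContDiffInL2 K.measureL2 (fun t x => (1 / x.1) * ψ t x)
    (fun t x => (1 / x.1) * dψ 0 t x)

/-- The normalised derivatives `(r⁻¹ ∂_{t*}, r ∂_r, r⁻¹ ∂_θ, r⁻¹ ∂_φ)`. -/
def normDeriv (r : ℝ) (dv : Fin 4 → ℝ) : Fin 4 → ℝ :=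
  ![1 / r * dv 0, r * dv 1, 1 / r * dv 2, 1 / r * dv 3]

/-- `□_g ψ + (α/ℓ²) ψ = F(t*, x, ψ, Dψ)` in the weak sense on the interior `r > r₊`. -/
structure IsWeakSolution (α : ℝ) (F : Spacetime → ℝ → (Fin 4 → ℝ) → ℝ)
    (ψ : ℝ → Slice → ℝ) (dψ : Fin 4 → ℝ → Slice → ℝ) : Prop where
  locInt : LocallyIntegrableOn (fun p : Spacetime => ψ p.1 p.2) (univ ×ˢ K.coordDomain)
  locInt_deriv : ∀ μ,
    LocallyIntegrableOn (fun p : Spacetime => dψ μ p.1 p.2) (univ ×ˢ K.coordDomain)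
  locInt_rhs : LocallyIntegrableOn
    (fun p : Spacetime => F p (ψ p.1 p.2) (normDeriv p.2.1 fun μ => dψ μ p.1 p.2))
    (univ ×ˢ K.coordDomain)
  eqn : ∀ η : Spacetime → ℝ, ContDiff ℝ ∞ η → HasCompactSupport η →
    tsupport η ⊆ univ ×ˢ K.coordDomain →
    ∫ p in univ ×ˢ K.coordDomain,
        (-(∑ μ, ∑ ν, K.invMetric p.2 μ ν * dψ μ p.1 p.2 * fderiv ℝ η p (spacetimeVec ν))
          + α / K.ℓ ^ 2 * ψ p.1 p.2 * η p) * K.sqrtDet p.2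
      = ∫ p in univ ×ˢ K.coordDomain,
        F p (ψ p.1 p.2) (normDeriv p.2.1 fun μ => dψ μ p.1 p.2) * η p * K.sqrtDet p.2

/-- `ψ` (with derivatives `dψ`) is a solution in `CH¹_KAdS` of the problem
`□_g ψ + (α/ℓ²) ψ = F`, `ψ = h` on the horizon `r = r₊`, and
`r^{3/2 - s} ψ → 0` as `r → ∞`, `s = √(9/4 - α)`. The boundary values are the limits along
almost every radial line of a representative of `ψ t`. -/
structure IsSolutionCH1 (α : ℝ) (F : Spacetime → ℝ → (Fin 4 → ℝ) → ℝ) (h : ℝ → ℝ × ℝ → ℝ)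
    (ψ : ℝ → Slice → ℝ) (dψ : Fin 4 → ℝ → Slice → ℝ) : Prop where
  memCH1 : K.MemCH1 ψ dψ
  weakSol : K.IsWeakSolution α F ψ dψ
  boundary : ∀ t, ∃ u : Slice → ℝ, u =ᵐ[volume.restrict K.fundDomain] ψ t ∧
    ∀ᵐ y : ℝ × ℝ ∂volume.restrict (Ioo 0 Real.pi ×ˢ Ioo 0 (2 * Real.pi)),
      Tendsto (fun r => u (r, y)) (𝓝[>] K.rp) (𝓝 (h t y)) ∧
      Tendsto (fun r : ℝ => r ^ (3 / 2 - √(9 / 4 - α)) * u (r, y)) atTop (𝓝 0)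

end KerrAdS

end

/-! Set `ν = √(-g^{t*t*})`. Pointwise, the flux density of `N` is a quadratic form in `dψ` minus a
multiple of `α ψ²`. Coercivity is proved separately on the two sides of `r = r₁`.

On `r ≤ r₁` decompose `T = n/ν + β` with `β` tangent to the slice. The gradient part of the flux is
`½ B (n² + H) + ν n b`, up to a positive weight, where `B = 1 + ξν`, `n` is the normal derivative,
`H` the squared spatial gradient and `b` the derivative along `β`. Cauchy–Schwarz gives `b² ≤ |β|²
H`, and `N` being uniformly timelike says that `ν|β|` stays below `B` by a definite amount, so the
form is definite (`timelike_flux_coercive`, `flux_coercive_near`). Since `r` is bounded here, every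
`ψ²` term goes into the error.

On `r > r₁` one has `N = T`; the mixed `∂_{t*}` terms cancel, and the only obstacle is `-α Σ ψ²/ℓ²`
(`flux_coercive_far`). A Hardy inequality with the sharp constant `9/4` absorbs it into a fraction
`1 - κ` of the radial term, with `κ > 0` chosen so that `α < 9/4 (1 - κ)`; the remainder gives
coercivity. The inequality comes from completing a square after adding the derivative of `3/2 (r³ -
r₁³) ψ²`. This primitive vanishes at `r₁`, so nothing is lost there, and it tends to `0` at infinity
because `r² ψ²` is integrable along almost every ray. The rotation terms, of size `a²`, are paid for
by part of the `r²` term of `Δ₋`, which is possible once `r₁ ≥ farRadius`. Weak derivatives are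
turned into absolute continuity along radial lines by `HasWeakPartial.ae_lines`.

This leaves an error `∫ ψ²` over `r < r₁ + δ` at time `τ`. The fundamental theorem of calculus for
the curve `ψ/r` in `L²`, with `-2ψ ∂_{t*}ψ ≤ ψ² + (∂_{t*}ψ)²`, moves it to time `τ'` at the cost of
the space-time integral. -/

noncomputable section

/-! ### Signs of the metric functions and the inverse metric. -/

namespace KerrAdS

variable (K : KerrAdS)

lemma a_sq_lt : K.a ^ 2 < K.ℓ ^ 2 := by
  have := K.a_lt
  exact sq_lt_sq.mpr (by rwa [abs_of_pos K.ℓ_pos])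

lemma xi_pos : 0 < K.xi := by
  have h := K.ℓ_pos
  have := K.a_sq_lt
  unfold xi
  rw [sub_pos, div_lt_one (by positivity)]
  exact this

lemma xi_le_one : K.xi ≤ 1 := by
  unfold xi
  have : 0 ≤ K.a ^ 2 / K.ℓ ^ 2 := by positivity
  linarith

lemma deltaTheta_eq (θ : ℝ) :
    K.deltaTheta θ = K.xi + K.a ^ 2 / K.ℓ ^ 2 * Real.sin θ ^ 2 := by
  unfold deltaTheta xi
  rw [Real.cos_sq']
  ring

lemma xi_le_deltaTheta (θ : ℝ) : K.xi ≤ K.deltaTheta θ := by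
  rw [deltaTheta_eq]
  have : 0 ≤ K.a ^ 2 / K.ℓ ^ 2 * Real.sin θ ^ 2 := by positivity
  linarith

lemma deltaTheta_pos (θ : ℝ) : 0 < K.deltaTheta θ := K.xi_pos.trans_le (K.xi_le_deltaTheta θ)

lemma deltaTheta_le_one (θ : ℝ) : K.deltaTheta θ ≤ 1 := by
  unfold deltaTheta
  have : 0 ≤ K.a ^ 2 / K.ℓ ^ 2 * Real.cos θ ^ 2 := by positivity
  linarith

lemma one_le_warp (r : ℝ) : 1 ≤ K.warp r := by
  unfold warp
  have : 0 ≤ r ^ 2 / K.ℓ ^ 2 := by positivity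
  linarith

lemma warp_pos (r : ℝ) : 0 < K.warp r := one_pos.trans_le (K.one_le_warp r)

lemma sq_le_sig (r θ : ℝ) : r ^ 2 ≤ K.sig r θ := by
  unfold sig
  have : 0 ≤ K.a ^ 2 * Real.cos θ ^ 2 := by positivity
  linarith

lemma sig_le (r θ : ℝ) : K.sig r θ ≤ r ^ 2 + K.a ^ 2 := by
  unfold sig
  nlinarith [Real.cos_sq_le_one θ, sq_nonneg K.a]

lemma sig_pos {r : ℝ} (hr : 0 < r) (θ : ℝ) : 0 < K.sig r θ :=
  (by positivity : 0 < r ^ 2).trans_le (K.sq_le_sig r θ)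

/-- If `a ≠ 0`, the quartic term is positive everywhere, so a root needs `2Mr > 0`. If `a = 0`, a
factor `r` splits off; the remaining cubic is `-2M` at `0` and nonnegative at `2M`, so it has a
positive root below the largest one. -/
lemma rp_pos : 0 < K.rp := by
  have hM := K.M_pos
  have hl := K.ℓ_pos
  obtain ⟨hroot, hub⟩ := K.horizon
  simp only [mem_ofPred_eq] at hroot
  by_cases ha : K.a = 0
  · have hcont : ContinuousOn (fun r : ℝ => r * (1 + r ^ 2 / K.ℓ ^ 2) - 2 * K.M)
        (Icc 0 (2 * K.M)) := by fun_prop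
    have h0 : (0 : ℝ) ∈ Icc ((0 : ℝ) * (1 + 0 ^ 2 / K.ℓ ^ 2) - 2 * K.M)
        (2 * K.M * (1 + (2 * K.M) ^ 2 / K.ℓ ^ 2) - 2 * K.M) := by
      constructor
      · linarith
      · have : 0 ≤ 2 * K.M * ((2 * K.M) ^ 2 / K.ℓ ^ 2) := by positivity
        linarith
    obtain ⟨r, hr, hr0⟩ := intermediate_value_Icc (by positivity) hcont h0
    simp only at hr0
    have hrpos : 0 < r := by
      rcases hr.1.eq_or_lt with h | h
      · rw [← h] at hr0
        linarith
      · exact h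
    refine hrpos.trans_le (hub ?_)
    simp only [mem_ofPred_eq, ha]
    linear_combination r * hr0
  · by_contra hneg
    push Not at hneg
    have h1 : 0 < (K.rp ^ 2 + K.a ^ 2) * (1 + K.rp ^ 2 / K.ℓ ^ 2) := by positivity
    nlinarith

lemma a_sq_div_lt : K.a ^ 2 / K.ℓ ^ 2 < 1 := by
  have := K.xi_pos
  unfold xi at this
  linarith

lemma sig_eq_sin (r θ : ℝ) : K.sig r θ = r ^ 2 + K.a ^ 2 * (1 - Real.sin θ ^ 2) := by
  rw [sig, Real.cos_sq']

lemma deltaTheta_eq_sin (θ : ℝ) :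
    K.deltaTheta θ = 1 - (K.ℓ ^ 2)⁻¹ * K.a ^ 2 * (1 - Real.sin θ ^ 2) := by
  rw [deltaTheta, Real.cos_sq']
  ring

lemma xi_eq_inv : K.xi = 1 - (K.ℓ ^ 2)⁻¹ * K.a ^ 2 := by
  rw [xi]
  ring

lemma warp_eq_inv (r : ℝ) : K.warp r = 1 + (K.ℓ ^ 2)⁻¹ * r ^ 2 := by
  rw [warp]
  ring

/-- The inverse metric multiplied by `Σ`. -/
def coInv (x : Slice) : Matrix (Fin 4) (Fin 4) ℝ :=
  !![K.a ^ 2 * Real.sin x.2.1 ^ 2 / K.deltaTheta x.2.1 - K.deltaPlus x.1 / K.warp x.1 ^ 2,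
      2 * K.M * x.1 / K.warp x.1, 0,
      K.a * K.xi * (1 / K.deltaTheta x.2.1 - 1 / K.warp x.1);
    2 * K.M * x.1 / K.warp x.1, K.deltaMinus x.1, 0, K.a * K.xi;
    0, 0, K.deltaTheta x.2.1, 0;
    K.a * K.xi * (1 / K.deltaTheta x.2.1 - 1 / K.warp x.1), K.a * K.xi, 0,
      K.xi ^ 2 / (K.deltaTheta x.2.1 * Real.sin x.2.1 ^ 2)]

theorem metric_mul_coInv {x : Slice} (hr : 0 < x.1) (hs : Real.sin x.2.1 ≠ 0) :
    K.metric x * ((K.sig x.1 x.2.1)⁻¹ • K.coInv x) = 1 := by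
  obtain ⟨r, θ, φ⟩ := x
  simp only at hr hs
  have hσ := (K.sig_pos hr θ).ne'
  have hw := (K.warp_pos r).ne'
  have hD := (K.deltaTheta_pos θ).ne'
  have hX := K.xi_pos.ne'
  have eσ := K.sig_eq_sin r θ
  have eD := K.deltaTheta_eq_sin θ
  have eX := K.xi_eq_inv
  have ew := K.warp_eq_inv r
  simp only [metric, coInv, gtt, grr, gθθ, gφφ, gtφ, gtr, grφ, deltaPlus, deltaMinus,
    div_eq_mul_inv _ (K.ℓ ^ 2)]
  -- With the coefficients made independent letters, denominators clear first; only then are their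
  -- expressions in `r`, `sin θ`, `a` and `ℓ⁻²` substituted, leaving polynomial identities.
  generalize K.sig r θ = σ at *
  generalize K.warp r = w at *
  generalize K.deltaTheta θ = D at *
  generalize K.xi = X at *
  generalize Real.sin θ = s at *
  generalize (K.ℓ ^ 2)⁻¹ = l at *
  generalize K.a = a at *
  generalize K.M = M at *
  ext i j
  fin_cases i <;> fin_cases j <;>
    simp [Matrix.mul_apply, Fin.sum_univ_four] <;> field_simp <;>
      simp only [eσ, eD, eX, ew] <;> ring

theorem invMetric_eq {x : Slice} (hr : 0 < x.1) (hs : Real.sin x.2.1 ≠ 0) :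
    K.invMetric x = (K.sig x.1 x.2.1)⁻¹ • K.coInv x :=
  Matrix.inv_eq_right_inv (K.metric_mul_coInv hr hs)

end KerrAdS

/-! ### Lapse, unit normal and the flux density in coordinates. -/

namespace KerrAdS

variable (K : KerrAdS)

/-- `-Σ g^{t*t*}` -/
def lapseCoeff (x : Slice) : ℝ := -K.coInv x 0 0

/-- The defining expression is a difference; this form has only positive terms and no `Δ₋`, so the
slices are visibly spacelike up to and including the horizon. -/
lemma lapseCoeff_eq (x : Slice) (hr : 0 < x.1) :
    K.lapseCoeff x = K.xi * K.sig x.1 x.2.1 / (K.warp x.1 * K.deltaTheta x.2.1)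
      + 2 * K.M * x.1 / K.warp x.1 ^ 2 := by
  obtain ⟨r, θ, φ⟩ := x
  simp only at hr
  have hw := (K.warp_pos r).ne'
  have hD := (K.deltaTheta_pos θ).ne'
  simp only [lapseCoeff, coInv, deltaPlus, Matrix.of_apply, Matrix.cons_val_zero,
    Matrix.cons_val', Matrix.cons_val_fin_one]
  field_simp
  simp only [K.sig_eq_sin, K.xi_eq_inv, K.warp_eq_inv, K.deltaTheta_eq_sin]
  ring

lemma lapseCoeff_pos {x : Slice} (hr : 0 < x.1) : 0 < K.lapseCoeff x := by
  rw [K.lapseCoeff_eq x hr]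
  have := K.sig_pos hr x.2.1
  have := K.warp_pos x.1
  have := K.deltaTheta_pos x.2.1
  have := K.xi_pos
  have := K.M_pos
  positivity

lemma metric_symm (x : Slice) (μ ν : Fin 4) : K.metric x μ ν = K.metric x ν μ := by
  fin_cases μ <;> fin_cases ν <;> simp [metric]

/-- `Σ g^{t*μ} ω_μ` -/
def coNormal (x : Slice) (dv : Fin 4 → ℝ) : ℝ := ∑ μ, K.coInv x 0 μ * dv μ

/-- `Σ g^{μν} ω_μ ω_ν` -/
def coQuad (x : Slice) (dv : Fin 4 → ℝ) : ℝ := ∑ μ, ∑ ν, K.coInv x μ ν * dv μ * dv ν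

/-- `√(-g^{t*t*})` -/
def invLapse (x : Slice) : ℝ := √(K.lapseCoeff x / K.sig x.1 x.2.1)

lemma invLapse_pos {x : Slice} (hr : 0 < x.1) : 0 < K.invLapse x :=
  Real.sqrt_pos.2 (div_pos (K.lapseCoeff_pos hr) (K.sig_pos hr _))

lemma invLapse_sq {x : Slice} (hr : 0 < x.1) :
    K.invLapse x ^ 2 = K.lapseCoeff x / K.sig x.1 x.2.1 :=
  Real.sq_sqrt (div_pos (K.lapseCoeff_pos hr) (K.sig_pos hr _)).le

lemma sqrt_neg_invMetric {x : Slice} (hr : 0 < x.1) (hs : Real.sin x.2.1 ≠ 0) :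
    √(-K.invMetric x 0 0) = K.invLapse x := by
  rw [K.invMetric_eq hr hs, invLapse, lapseCoeff, Matrix.smul_apply, smul_eq_mul]
  congr 1
  ring

lemma normal_eq {x : Slice} (hr : 0 < x.1) (hs : Real.sin x.2.1 ≠ 0) (μ : Fin 4) :
    K.normal x μ = -K.coInv x 0 μ / (K.sig x.1 x.2.1 * K.invLapse x) := by
  rw [normal, K.sqrt_neg_invMetric hr hs, K.invMetric_eq hr hs, Matrix.smul_apply, smul_eq_mul]
  have := (K.sig_pos hr x.2.1).ne'
  have := (K.invLapse_pos hr).ne'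
  field_simp

lemma normal_zero {x : Slice} (hr : 0 < x.1) (hs : Real.sin x.2.1 ≠ 0) :
    K.normal x 0 = K.invLapse x := by
  rw [K.normal_eq hr hs]
  have h1 := (K.sig_pos hr x.2.1).ne'
  have h2 := (K.invLapse_pos hr).ne'
  have h3 := K.invLapse_sq hr
  rw [eq_div_iff h1, lapseCoeff] at h3
  field_simp
  linarith

/-- Lowering the index of `n` gives `-dt*/√(-g^{t*t*})`, since the `t*` row of the inverse
contracted with the metric is a Kronecker delta. -/
lemma pairing_normal {x : Slice} (hr : 0 < x.1) (hs : Real.sin x.2.1 ≠ 0) (Y : Fin 4 → ℝ) :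
    K.pairing x (K.normal x) Y = -Y 0 / K.invLapse x := by
  have h1 := (K.sig_pos hr x.2.1).ne'
  have h2 := (K.invLapse_pos hr).ne'
  have hinv : ((K.sig x.1 x.2.1)⁻¹ • K.coInv x) * K.metric x = 1 :=
    mul_eq_one_comm.1 (K.metric_mul_coInv hr hs)
  have key : ∀ ν, ∑ μ, K.coInv x 0 μ * K.metric x μ ν
      = K.sig x.1 x.2.1 * (1 : Matrix (Fin 4) (Fin 4) ℝ) 0 ν := by
    intro ν
    rw [← hinv, Matrix.mul_apply, Finset.mul_sum]
    refine Finset.sum_congr rfl fun μ _ => ?_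
    rw [Matrix.smul_apply, smul_eq_mul]
    field_simp
  have : K.pairing x (K.normal x) Y
      = ∑ ν, (∑ μ, K.coInv x 0 μ * K.metric x μ ν) * Y ν *
          (-1 / (K.sig x.1 x.2.1 * K.invLapse x)) := by
    rw [pairing, Finset.sum_comm]
    refine Finset.sum_congr rfl fun ν _ => ?_
    rw [Finset.sum_mul, Finset.sum_mul]
    refine Finset.sum_congr rfl fun μ _ => ?_
    rw [K.normal_eq hr hs]
    ring
  rw [this]
  simp only [key]
  simp only [Fin.sum_univ_four, Matrix.one_apply]
  simp
  field_simp

lemma pairing_add_smul (x : Slice) (X Y Z : Fin 4 → ℝ) (c : ℝ) :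
    K.pairing x X (Y + c • Z) = K.pairing x X Y + c * K.pairing x X Z := by
  simp only [pairing, Finset.mul_sum, ← Finset.sum_add_distrib]
  refine Finset.sum_congr rfl fun μ _ => Finset.sum_congr rfl fun ν _ => ?_
  simp only [Pi.add_apply, Pi.smul_apply, smul_eq_mul]
  ring

lemma pairing_comm (x : Slice) (X Y : Fin 4 → ℝ) : K.pairing x X Y = K.pairing x Y X := by
  rw [pairing, Finset.sum_comm]
  refine Finset.sum_congr rfl fun μ _ => Finset.sum_congr rfl fun ν _ => ?_
  rw [K.metric_symm]
  ring

lemma pairing_vecT (x : Slice) : K.pairing x (vecT x) (vecT x) = K.gtt x.1 x.2.1 := by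
  simp [pairing, vecT, Fin.sum_univ_four, metric]

lemma pairing_vecN {x : Slice} (hr : 0 < x.1) (hs : Real.sin x.2.1 ≠ 0) (ξ : ℝ → ℝ) :
    K.pairing x (K.vecN ξ x) (K.vecN ξ x)
      = K.gtt x.1 x.2.1 - 2 * ξ x.1 / K.invLapse x - ξ x.1 ^ 2 := by
  have h2 := (K.invLapse_pos hr).ne'
  have hT : K.pairing x (vecT x) (K.normal x) = -1 / K.invLapse x := by
    rw [K.pairing_comm, K.pairing_normal hr hs]
    simp [vecT]
  rw [vecN, pairing_add_smul, K.pairing_comm x _ (vecT x), K.pairing_comm x _ (K.normal x),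
    pairing_add_smul, pairing_add_smul, pairing_vecT, hT, K.pairing_normal hr hs,
    K.pairing_normal hr hs, K.normal_zero hr hs]
  simp only [vecT, Pi.single_eq_same]
  field_simp
  ring

lemma sum_current_mul (α : ℝ) (X Y : Fin 4 → ℝ) (x : Slice) (v : ℝ) (dv : Fin 4 → ℝ) :
    ∑ μ, K.current α X x v dv μ * Y μ
      = (∑ μ, dv μ * Y μ) * (∑ ν, dv ν * X ν) - 1 / 2 * K.pairing x Y X *
        ((∑ ρ, ∑ σ, K.invMetric x ρ σ * dv ρ * dv σ) - α / K.ℓ ^ 2 * v ^ 2) := by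
  simp only [current, energyMomentum, pairing]
  generalize ((∑ ρ, ∑ σ, K.invMetric x ρ σ * dv ρ * dv σ) - α / K.ℓ ^ 2 * v ^ 2) = E
  rw [Finset.sum_mul_sum]
  simp only [Finset.sum_mul, Finset.mul_sum, ← Finset.sum_sub_distrib]
  refine Finset.sum_congr rfl fun μ _ => Finset.sum_congr rfl fun ν _ => ?_
  ring

lemma sum_invMetric {x : Slice} (hr : 0 < x.1) (hs : Real.sin x.2.1 ≠ 0) (dv : Fin 4 → ℝ) :
    ∑ ρ, ∑ σ, K.invMetric x ρ σ * dv ρ * dv σ = K.coQuad x dv / K.sig x.1 x.2.1 := by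
  rw [K.invMetric_eq hr hs, coQuad, Finset.sum_div]
  refine Finset.sum_congr rfl fun μ _ => ?_
  rw [Finset.sum_div]
  refine Finset.sum_congr rfl fun ν _ => ?_
  rw [Matrix.smul_apply, smul_eq_mul]
  ring

lemma sum_mul_normal {x : Slice} (hr : 0 < x.1) (hs : Real.sin x.2.1 ≠ 0) (dv : Fin 4 → ℝ) :
    ∑ μ, dv μ * K.normal x μ = -K.coNormal x dv / (K.sig x.1 x.2.1 * K.invLapse x) := by
  rw [coNormal, neg_div, Finset.sum_div, ← Finset.sum_neg_distrib]
  refine Finset.sum_congr rfl fun μ _ => ?_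
  rw [K.normal_eq hr hs]
  ring

/-- Explicit formula for the flux density of `N = T + ξ n`. -/
theorem fluxDensity_eq (α : ℝ) (ξ : ℝ → ℝ) {x : Slice} (hr : 0 < x.1) (hs : Real.sin x.2.1 ≠ 0)
    (v : ℝ) (dv : Fin 4 → ℝ) :
    K.fluxDensity α ξ x v dv = Real.sin x.2.1 / K.xi *
      (-K.coNormal x dv * dv 0
        + 1 / 2 * (K.coQuad x dv - α / K.ℓ ^ 2 * K.sig x.1 x.2.1 * v ^ 2)
        + ξ x.1 * K.invLapse x * (K.coNormal x dv ^ 2 / K.lapseCoeff x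
          + 1 / 2 * (K.coQuad x dv - α / K.ℓ ^ 2 * K.sig x.1 x.2.1 * v ^ 2))) := by
  have h1 := (K.sig_pos hr x.2.1).ne'
  have h2 := (K.invLapse_pos hr).ne'
  have h3 := (K.lapseCoeff_pos hr).ne'
  have h4 := K.xi_pos.ne'
  have h5 := K.ℓ_pos.ne'
  have hν := K.invLapse_sq hr
  have hN : ∑ ν, dv ν * K.vecN ξ x ν
      = dv 0 - ξ x.1 * (K.coNormal x dv / (K.sig x.1 x.2.1 * K.invLapse x)) := by
    have : ∑ ν, dv ν * K.vecN ξ x ν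
        = (∑ ν, dv ν * vecT x ν) + ξ x.1 * ∑ ν, dv ν * K.normal x ν := by
      rw [Finset.mul_sum, ← Finset.sum_add_distrib]
      refine Finset.sum_congr rfl fun ν _ => ?_
      simp only [vecN, Pi.add_apply, Pi.smul_apply, smul_eq_mul]
      ring
    rw [this, K.sum_mul_normal hr hs]
    simp [vecT, Fin.sum_univ_four]
    ring
  have hP : K.pairing x (K.normal x) (K.vecN ξ x) = -1 / K.invLapse x - ξ x.1 := by
    rw [vecN, pairing_add_smul, K.pairing_normal hr hs, K.pairing_normal hr hs,
      K.normal_zero hr hs]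
    simp only [vecT, Pi.single_eq_same]
    field_simp
    ring
  rw [fluxDensity, sum_current_mul, hN, hP, K.sum_mul_normal hr hs, K.sum_invMetric hr hs,
    volSlice, K.sqrt_neg_invMetric hr hs, sigWeight]
  have hA : K.lapseCoeff x = K.invLapse x ^ 2 * K.sig x.1 x.2.1 := by
    rw [hν]; field_simp
  rw [hA]
  field_simp
  ring

end KerrAdS

/-! ### Induced metric of the slices: identities of the 3+1 decomposition. -/

namespace KerrAdS

variable (K : KerrAdS)

/-- `Σ g^{t*r}` -/
def coTr (r : ℝ) : ℝ := 2 * K.M * r / K.warp r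

/-- `Σ g^{t*φ}` -/
def coTφ (r θ : ℝ) : ℝ := K.a * K.xi * (1 / K.deltaTheta θ - 1 / K.warp r)

lemma coNormal_eq (x : Slice) (dv : Fin 4 → ℝ) :
    K.coNormal x dv
      = -K.lapseCoeff x * dv 0 + K.coTr x.1 * dv 1 + K.coTφ x.1 x.2.1 * dv 3 := by
  simp [coNormal, lapseCoeff, coInv, coTr, coTφ, Fin.sum_univ_four]

lemma coQuad_eq (x : Slice) (dv : Fin 4 → ℝ) :
    K.coQuad x dv = -K.lapseCoeff x * dv 0 ^ 2 + 2 * K.coTr x.1 * dv 0 * dv 1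
      + 2 * K.coTφ x.1 x.2.1 * dv 0 * dv 3 + K.deltaMinus x.1 * dv 1 ^ 2
      + 2 * (K.a * K.xi) * dv 1 * dv 3 + K.deltaTheta x.2.1 * dv 2 ^ 2
      + K.xi ^ 2 / (K.deltaTheta x.2.1 * Real.sin x.2.1 ^ 2) * dv 3 ^ 2 := by
  simp [coQuad, lapseCoeff, coInv, coTr, coTφ, Fin.sum_univ_four]
  ring

/-- The numerator is a difference involving `Δ₋`; rewriting it cancels the large terms and exhibits
both the sign and the factor `sin² θ`. -/
lemma gφφ_eq {r : ℝ} (hr : 0 < r) (θ : ℝ) :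
    K.gφφ r θ = Real.sin θ ^ 2 * ((r ^ 2 + K.a ^ 2) / K.xi
      + 2 * K.M * r * K.a ^ 2 * Real.sin θ ^ 2 / (K.xi ^ 2 * K.sig r θ)) := by
  have hσ := (K.sig_pos hr θ).ne'
  have hX := K.xi_pos.ne'
  have hl := K.ℓ_pos.ne'
  have key : K.deltaTheta θ * (r ^ 2 + K.a ^ 2) ^ 2 - K.deltaMinus r * K.a ^ 2 * Real.sin θ ^ 2
      = (r ^ 2 + K.a ^ 2) * K.xi * K.sig r θ + 2 * K.M * r * K.a ^ 2 * Real.sin θ ^ 2 := by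
    simp only [deltaTheta, deltaMinus, xi, sig, warp, Real.cos_sq']
    field_simp
    ring
  rw [gφφ, key]
  field_simp

lemma gφφ_pos {r θ : ℝ} (hr : 0 < r) (hs : Real.sin θ ≠ 0) : 0 < K.gφφ r θ := by
  rw [K.gφφ_eq hr]
  have := K.sig_pos hr θ
  have := K.xi_pos
  have := K.M_pos
  positivity

lemma gθθ_pos {r : ℝ} (hr : 0 < r) (θ : ℝ) : 0 < K.gθθ r θ :=
  div_pos (K.sig_pos hr θ) (K.deltaTheta_pos θ)

lemma grr_eq {r : ℝ} (hr : 0 < r) (θ : ℝ) :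
    K.grr r θ = (K.warp r - K.a ^ 2 / K.ℓ ^ 2 * Real.sin θ ^ 2) / K.warp r ^ 2
      + 2 * K.M * r / (K.sig r θ * K.warp r ^ 2) := by
  have hσ := (K.sig_pos hr θ).ne'
  have hw := (K.warp_pos r).ne'
  have hl := K.ℓ_pos.ne'
  have key : K.deltaPlus r - K.a ^ 2 * Real.sin θ ^ 2 * (K.warp r + K.sig r θ / K.ℓ ^ 2)
      = K.sig r θ * (K.warp r - K.a ^ 2 / K.ℓ ^ 2 * Real.sin θ ^ 2) + 2 * K.M * r := by
    simp only [deltaPlus, sig, Real.cos_sq']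
    field_simp
    ring
  rw [grr, key]
  field_simp

lemma grr_pos {r : ℝ} (hr : 0 < r) (θ : ℝ) : 0 < K.grr r θ := by
  rw [K.grr_eq hr]
  have := K.sig_pos hr θ
  have := K.M_pos
  have hw := K.one_le_warp r
  have h1 : K.a ^ 2 / K.ℓ ^ 2 * Real.sin θ ^ 2 ≤ 1 :=
    mul_le_one₀ K.a_sq_div_lt.le (sq_nonneg _) (Real.sin_sq_le_one θ)
  have h2 : 0 < 2 * K.M * r / (K.sig r θ * K.warp r ^ 2) := by positivity
  have h3 : 0 ≤ (K.warp r - K.a ^ 2 / K.ℓ ^ 2 * Real.sin θ ^ 2) / K.warp r ^ 2 :=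
    div_nonneg (by linarith) (by positivity)
  linarith

lemma grr_le {r : ℝ} (hr : K.rp ≤ r) (θ : ℝ) : K.grr r θ ≤ 1 + 2 * K.M / K.rp := by
  have hp := K.rp_pos
  have hr0 := hp.trans_le hr
  rw [K.grr_eq hr0]
  have hM := K.M_pos
  have hσ := K.sq_le_sig r θ
  have hw := K.one_le_warp r
  have h1 : (K.warp r - K.a ^ 2 / K.ℓ ^ 2 * Real.sin θ ^ 2) / K.warp r ^ 2 ≤ 1 := by
    rw [div_le_one (by positivity)]
    have : 0 ≤ K.a ^ 2 / K.ℓ ^ 2 * Real.sin θ ^ 2 := by positivity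
    nlinarith
  have h2 : 2 * K.M * r / (K.sig r θ * K.warp r ^ 2) ≤ 2 * K.M * r / (r ^ 2 * 1) := by
    have : r ^ 2 * 1 ≤ K.sig r θ * K.warp r ^ 2 :=
      mul_le_mul hσ (one_le_pow₀ hw) zero_le_one ((sq_nonneg r).trans hσ)
    gcongr
  have h3 : 2 * K.M * r / (r ^ 2 * 1) ≤ 2 * K.M / K.rp := by
    have : 2 * K.M * r / (r ^ 2 * 1) = 2 * K.M / r := by field_simp
    rw [this]
    gcongr
  linarith

section Identities

variable {r θ : ℝ} (φ : ℝ)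

/-- The determinant of the `(r, φ)` block of the induced metric. Its positivity is what makes that
block Riemannian. -/
lemma spatial_det (hr : 0 < r) (hs : Real.sin θ ≠ 0) :
    K.grr r θ * K.gφφ r θ - K.grφ r θ ^ 2
      = K.lapseCoeff (r, θ, φ) * Real.sin θ ^ 2 * K.deltaTheta θ / K.xi ^ 2 := by
  have hσ := (K.sig_pos hr θ).ne'
  have hw := (K.warp_pos r).ne'
  have hD := (K.deltaTheta_pos θ).ne'
  have hX := K.xi_pos.ne'
  rw [K.lapseCoeff_eq _ hr]
  simp only [grr, gφφ, grφ, deltaPlus, deltaMinus, div_eq_mul_inv _ (K.ℓ ^ 2)]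
  field_simp
  simp only [K.sig_eq_sin, K.xi_eq_inv, K.warp_eq_inv, K.deltaTheta_eq_sin]
  ring

/-- This and the next two identities express the inverse of the induced metric, `h^{ij} = g^{ij} -
g^{t*i} g^{t*j} / g^{t*t*}`, multiplied by `Σ` and `lapseCoeff`; the right-hand sides are the
cofactors over the determinant. -/
lemma spatial_inv_rr (hr : 0 < r) (hs : Real.sin θ ≠ 0) :
    K.lapseCoeff (r, θ, φ) * K.deltaMinus r + K.coTr r ^ 2
      = K.sig r θ * K.gφφ r θ * (K.xi ^ 2 / (K.deltaTheta θ * Real.sin θ ^ 2)) := by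
  have hσ := (K.sig_pos hr θ).ne'
  have hw := (K.warp_pos r).ne'
  have hD := (K.deltaTheta_pos θ).ne'
  have hX := K.xi_pos.ne'
  rw [K.lapseCoeff_eq _ hr]
  simp only [gφφ, coTr, deltaMinus]
  field_simp
  simp only [K.sig_eq_sin, K.xi_eq_inv, K.warp_eq_inv, K.deltaTheta_eq_sin]
  ring

lemma spatial_inv_rφ (hr : 0 < r) (hs : Real.sin θ ≠ 0) :
    K.lapseCoeff (r, θ, φ) * (K.a * K.xi) + K.coTr r * K.coTφ r θ
      = -(K.sig r θ * K.grφ r θ * (K.xi ^ 2 / (K.deltaTheta θ * Real.sin θ ^ 2))) := by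
  have hσ := (K.sig_pos hr θ).ne'
  have hw := (K.warp_pos r).ne'
  have hD := (K.deltaTheta_pos θ).ne'
  have hX := K.xi_pos.ne'
  rw [K.lapseCoeff_eq _ hr]
  simp only [grφ, coTr, coTφ]
  field_simp
  simp only [K.sig_eq_sin, K.xi_eq_inv, K.warp_eq_inv, K.deltaTheta_eq_sin]
  ring

lemma spatial_inv_φφ (hr : 0 < r) (hs : Real.sin θ ≠ 0) :
    K.lapseCoeff (r, θ, φ) * (K.xi ^ 2 / (K.deltaTheta θ * Real.sin θ ^ 2)) + K.coTφ r θ ^ 2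
      = K.sig r θ * K.grr r θ * (K.xi ^ 2 / (K.deltaTheta θ * Real.sin θ ^ 2)) := by
  have hσ := (K.sig_pos hr θ).ne'
  have hw := (K.warp_pos r).ne'
  have hD := (K.deltaTheta_pos θ).ne'
  have hX := K.xi_pos.ne'
  rw [K.lapseCoeff_eq _ hr]
  simp only [grr, deltaPlus, coTφ, div_eq_mul_inv _ (K.ℓ ^ 2)]
  field_simp
  simp only [K.sig_eq_sin, K.xi_eq_inv, K.warp_eq_inv, K.deltaTheta_eq_sin]
  ring

/-- The shift is `β^i = Σ g^{t*i} / lapseCoeff`, and `g(T,T) = |β|² - 1/ν²`, where `1/ν² = Σ /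
lapseCoeff`. -/
lemma shift_sq (hr : 0 < r) :
    K.grr r θ * K.coTr r ^ 2 + 2 * K.grφ r θ * K.coTr r * K.coTφ r θ
        + K.gφφ r θ * K.coTφ r θ ^ 2
      = K.lapseCoeff (r, θ, φ) ^ 2 * (K.gtt r θ + K.sig r θ / K.lapseCoeff (r, θ, φ)) := by
  have hA := (K.lapseCoeff_pos (x := (r, θ, φ)) hr).ne'
  have hσ := (K.sig_pos hr θ).ne'
  have hw := (K.warp_pos r).ne'
  have hD := (K.deltaTheta_pos θ).ne'
  have hX := K.xi_pos.ne'
  have : K.lapseCoeff (r, θ, φ) ^ 2 * (K.gtt r θ + K.sig r θ / K.lapseCoeff (r, θ, φ))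
      = K.lapseCoeff (r, θ, φ) ^ 2 * K.gtt r θ + K.lapseCoeff (r, θ, φ) * K.sig r θ := by
    field_simp
  rw [this, K.lapseCoeff_eq _ hr]
  simp only [grr, gtt, gφφ, grφ, coTr, deltaPlus, deltaMinus, coTφ, div_eq_mul_inv _ (K.ℓ ^ 2)]
  field_simp
  simp only [K.sig_eq_sin, K.xi_eq_inv, K.warp_eq_inv, K.deltaTheta_eq_sin]
  ring

end Identities

end KerrAdS

/-- Cauchy–Schwarz between a binary form and its inverse; after clearing the determinant the defect
is the square given to `nlinarith`. -/
lemma quadForm_inv_cauchySchwarz {p q t : ℝ} (hd : 0 < p * t - q ^ 2) (x y u w : ℝ) :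
    (x * u + y * w) ^ 2 ≤ (p * x ^ 2 + 2 * q * x * y + t * y ^ 2)
      * ((t * u ^ 2 - 2 * q * u * w + p * w ^ 2) / (p * t - q ^ 2)) := by
  rw [← mul_div_assoc, le_div_iff₀ hd]
  nlinarith [sq_nonneg ((p * x + q * y) * w - (q * x + t * y) * u)]

/-- The inverse form dominates `w²/t`, and `p` times it dominates `u²`; each defect is a square over
a positive number. -/
lemma le_quadForm_inv {p q t : ℝ} (ht : 0 < t) (hd : 0 < p * t - q ^ 2) (u w : ℝ) :
    u ^ 2 + w ^ 2 / t ≤ (1 + p) * ((t * u ^ 2 - 2 * q * u * w + p * w ^ 2) / (p * t - q ^ 2)) := by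
  have key : ((1 + p) * ((t * u ^ 2 - 2 * q * u * w + p * w ^ 2) / (p * t - q ^ 2))
      - (u ^ 2 + w ^ 2 / t)) * (t * (p * t - q ^ 2))
      = (t * u - q * w) ^ 2 + (q * u - p * w) ^ 2 * t := by
    field_simp
    ring
  have h : 0 ≤ (t * u - q * w) ^ 2 + (q * u - p * w) ^ 2 * t := by positivity
  rw [← key] at h
  have := nonneg_of_mul_nonneg_left h (by positivity)
  linarith

/-! ### The flux in terms of normal, shift and gradient; bounds on the lapse. -/

namespace KerrAdS

variable (K : KerrAdS)

/-- The integrand of `normH1Sq`. -/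
def h1Density (x : Slice) (v : ℝ) (dv : Fin 4 → ℝ) : ℝ :=
  ((1 / x.1 ^ 2) * dv 0 ^ 2 + x.1 ^ 2 * dv 1 ^ 2 + K.angGradSq x (dv 2) (dv 3) + v ^ 2)
    * (x.1 ^ 2 * Real.sin x.2.1)

lemma h1Density_eq {x : Slice} (hr : 0 < x.1) (v : ℝ) (dv : Fin 4 → ℝ) :
    K.h1Density x v dv = Real.sin x.2.1 * (dv 0 ^ 2 + x.1 ^ 4 * dv 1 ^ 2
      + x.1 ^ 2 * (dv 2 ^ 2 / K.gθθ x.1 x.2.1) + x.1 ^ 2 * (dv 3 ^ 2 / K.gφφ x.1 x.2.1)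
      + x.1 ^ 2 * v ^ 2) := by
  rw [h1Density, angGradSq]
  field_simp
  ring

/-- The squared norm of the spatial gradient for the induced metric on the slices. -/
def gradSq (x : Slice) (dv : Fin 4 → ℝ) : ℝ :=
  (K.gφφ x.1 x.2.1 * dv 1 ^ 2 - 2 * K.grφ x.1 x.2.1 * dv 1 * dv 3 + K.grr x.1 x.2.1 * dv 3 ^ 2)
    / (K.grr x.1 x.2.1 * K.gφφ x.1 x.2.1 - K.grφ x.1 x.2.1 ^ 2)
    + dv 2 ^ 2 / K.gθθ x.1 x.2.1

lemma spatial_det_pos {x : Slice} (hr : 0 < x.1) (hs : Real.sin x.2.1 ≠ 0) :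
    0 < K.grr x.1 x.2.1 * K.gφφ x.1 x.2.1 - K.grφ x.1 x.2.1 ^ 2 := by
  rw [K.spatial_det x.2.2 hr hs]
  have := K.lapseCoeff_pos (x := (x.1, x.2.1, x.2.2)) hr
  have := K.deltaTheta_pos x.2.1
  have := K.xi_pos
  positivity

/-- The splitting `g⁻¹ = -n ⊗ n + h⁻¹` multiplied by `Σ`, because `coNormal² / lapseCoeff` is `Σ`
times the squared normal derivative. -/
lemma coQuad_add {x : Slice} (hr : 0 < x.1) (hs : Real.sin x.2.1 ≠ 0) (dv : Fin 4 → ℝ) :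
    K.coQuad x dv + K.coNormal x dv ^ 2 / K.lapseCoeff x = K.sig x.1 x.2.1 * K.gradSq x dv := by
  have hA := (K.lapseCoeff_pos hr).ne'
  have hd := (K.spatial_det_pos hr hs).ne'
  have hσ := (K.sig_pos hr x.2.1).ne'
  have hD := (K.deltaTheta_pos x.2.1).ne'
  have hX := K.xi_pos.ne'
  have e1 := K.spatial_inv_rr x.2.2 hr hs
  have e2 := K.spatial_inv_rφ x.2.2 hr hs
  have e3 := K.spatial_inv_φφ x.2.2 hr hs
  have e4 := K.spatial_det x.2.2 hr hs
  simp only [Prod.mk.eta] at e1 e2 e3 e4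
  have hY : K.xi ^ 2 / (K.deltaTheta x.2.1 * Real.sin x.2.1 ^ 2) ≠ 0 := by positivity
  have e5 : K.grr x.1 x.2.1 * K.gφφ x.1 x.2.1 - K.grφ x.1 x.2.1 ^ 2
      = K.lapseCoeff x / (K.xi ^ 2 / (K.deltaTheta x.2.1 * Real.sin x.2.1 ^ 2)) := by
    rw [e4]
    field_simp
  rw [coQuad_eq, coNormal_eq, gradSq, gθθ, e5]
  generalize K.xi ^ 2 / (K.deltaTheta x.2.1 * Real.sin x.2.1 ^ 2) = Y at *
  field_simp
  linear_combination dv 1 ^ 2 * e1 + 2 * dv 1 * dv 3 * e2 + dv 3 ^ 2 * e3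

/-- Cauchy–Schwarz for the induced metric, with `|β|² = g(T,T) + 1/ν²` from `shift_sq`. -/
lemma shift_mul_sq_le {x : Slice} (hr : 0 < x.1) (hs : Real.sin x.2.1 ≠ 0) (dv : Fin 4 → ℝ) :
    (dv 0 + K.coNormal x dv / K.lapseCoeff x) ^ 2
      ≤ (K.gtt x.1 x.2.1 + 1 / K.invLapse x ^ 2) * K.gradSq x dv := by
  have hA := K.lapseCoeff_pos hr
  have hd := K.spatial_det_pos hr hs
  have hθ := K.gθθ_pos hr x.2.1
  have e := K.shift_sq (θ := x.2.1) x.2.2 hr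
  simp only [Prod.mk.eta] at e
  have h1 : dv 0 + K.coNormal x dv / K.lapseCoeff x
      = (K.coTr x.1 * dv 1 + K.coTφ x.1 x.2.1 * dv 3) / K.lapseCoeff x := by
    rw [coNormal_eq]
    field_simp
    ring
  have h2 : K.gtt x.1 x.2.1 + 1 / K.invLapse x ^ 2
      = (K.grr x.1 x.2.1 * K.coTr x.1 ^ 2 + 2 * K.grφ x.1 x.2.1 * K.coTr x.1 * K.coTφ x.1 x.2.1
        + K.gφφ x.1 x.2.1 * K.coTφ x.1 x.2.1 ^ 2) / K.lapseCoeff x ^ 2 := by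
    rw [e, K.invLapse_sq hr]
    field_simp
  have hnn : 0 ≤ K.grr x.1 x.2.1 * K.coTr x.1 ^ 2
      + 2 * K.grφ x.1 x.2.1 * K.coTr x.1 * K.coTφ x.1 x.2.1
      + K.gφφ x.1 x.2.1 * K.coTφ x.1 x.2.1 ^ 2 := by
    have hp := K.grr_pos hr x.2.1
    refine nonneg_of_mul_nonneg_right (a := K.grr x.1 x.2.1) ?_ hp
    nlinarith [sq_nonneg (K.grr x.1 x.2.1 * K.coTr x.1 + K.grφ x.1 x.2.1 * K.coTφ x.1 x.2.1),
      mul_nonneg hd.le (sq_nonneg (K.coTφ x.1 x.2.1))]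
  rw [h1, h2, div_pow, div_mul_eq_mul_div]
  refine div_le_div_of_nonneg_right ?_ (by positivity)
  refine (quadForm_inv_cauchySchwarz hd _ _ _ _).trans ?_
  refine mul_le_mul_of_nonneg_left ?_ hnn
  rw [gradSq]
  have : 0 ≤ dv 2 ^ 2 / K.gθθ x.1 x.2.1 := by positivity
  linarith

lemma le_gradSq {x : Slice} (hr : 0 < x.1) (hs : Real.sin x.2.1 ≠ 0) (dv : Fin 4 → ℝ) :
    dv 1 ^ 2 + dv 3 ^ 2 / K.gφφ x.1 x.2.1 + dv 2 ^ 2 / K.gθθ x.1 x.2.1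
      ≤ (1 + K.grr x.1 x.2.1) * K.gradSq x dv := by
  have hp := K.grr_pos hr x.2.1
  have h := le_quadForm_inv (K.gφφ_pos hr hs) (K.spatial_det_pos hr hs) (dv 1) (dv 3)
  have : 0 ≤ dv 2 ^ 2 / K.gθθ x.1 x.2.1 := div_nonneg (sq_nonneg _) (K.gθθ_pos hr _).le
  rw [gradSq, mul_add]
  nlinarith

/-- The derivative along the unit normal. -/
def normalDeriv (x : Slice) (dv : Fin 4 → ℝ) : ℝ :=
  -K.coNormal x dv / (K.sig x.1 x.2.1 * K.invLapse x)

/-- The derivative along the shift. -/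
def shiftDeriv (x : Slice) (dv : Fin 4 → ℝ) : ℝ := dv 0 + K.coNormal x dv / K.lapseCoeff x

/-- Since `N = (1/ν + ξ) n + β` and the volume density carries a factor `ν`, the diagonal energy
acquires the factor `1 + ξν` and the shift contributes the single mixed term. -/
lemma fluxDensity_eq_normal (α : ℝ) (ξ : ℝ → ℝ) {x : Slice} (hr : 0 < x.1)
    (hs : Real.sin x.2.1 ≠ 0) (v : ℝ) (dv : Fin 4 → ℝ) :
    K.fluxDensity α ξ x v dv = Real.sin x.2.1 / K.xi * (K.sig x.1 x.2.1 *
      (1 / 2 * (1 + ξ x.1 * K.invLapse x) * (K.normalDeriv x dv ^ 2 + K.gradSq x dv)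
        + K.invLapse x * K.normalDeriv x dv * K.shiftDeriv x dv
        - 1 / 2 * (1 + ξ x.1 * K.invLapse x) * (α / K.ℓ ^ 2) * v ^ 2)) := by
  have hσ := (K.sig_pos hr x.2.1).ne'
  have hν := (K.invLapse_pos hr).ne'
  have hX := K.xi_pos.ne'
  have hl := K.ℓ_pos.ne'
  have hA : K.lapseCoeff x = K.invLapse x ^ 2 * K.sig x.1 x.2.1 := by
    rw [K.invLapse_sq hr]; field_simp
  have h := K.coQuad_add hr hs dv
  rw [K.fluxDensity_eq α ξ hr hs, normalDeriv, shiftDeriv]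
  rw [hA] at h ⊢
  rw [eq_sub_of_add_eq h]
  field_simp
  ring

lemma dv_zero_eq {x : Slice} (hr : 0 < x.1) (dv : Fin 4 → ℝ) :
    dv 0 = K.normalDeriv x dv / K.invLapse x + K.shiftDeriv x dv := by
  have hσ := (K.sig_pos hr x.2.1).ne'
  have hν := (K.invLapse_pos hr).ne'
  have hA : K.lapseCoeff x = K.invLapse x ^ 2 * K.sig x.1 x.2.1 := by
    rw [K.invLapse_sq hr]; field_simp
  rw [normalDeriv, shiftDeriv, hA]
  field_simp
  ring

lemma inv_invLapse_sq_le {x : Slice} (hr : 0 < x.1) :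
    1 / K.invLapse x ^ 2 ≤ K.warp x.1 / K.xi := by
  have hσ := K.sig_pos hr x.2.1
  have hX := K.xi_pos
  have hw := K.warp_pos x.1
  have hD := K.deltaTheta_pos x.2.1
  have hM := K.M_pos
  have hA := K.lapseCoeff_pos hr
  rw [K.invLapse_sq hr, one_div_div, div_le_div_iff₀ hA hX]
  have h1 : K.xi * K.sig x.1 x.2.1 / K.warp x.1 ≤ K.lapseCoeff x := by
    rw [K.lapseCoeff_eq x hr]
    have h2 : 0 ≤ 2 * K.M * x.1 / K.warp x.1 ^ 2 := by positivity
    have h3 : K.xi * K.sig x.1 x.2.1 / K.warp x.1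
        ≤ K.xi * K.sig x.1 x.2.1 / (K.warp x.1 * K.deltaTheta x.2.1) := by
      gcongr
      exact mul_le_of_le_one_right hw.le (K.deltaTheta_le_one _)
    linarith
  rw [div_le_iff₀ hw] at h1
  linarith

lemma lapseCoeff_le {x : Slice} (hr : 0 < x.1) : K.lapseCoeff x ≤ K.ℓ ^ 2 + K.M * K.ℓ := by
  have hσ := K.sig_pos hr x.2.1
  have hX := K.xi_pos
  have hw := K.warp_pos x.1
  have hD := K.deltaTheta_pos x.2.1
  have hM := K.M_pos
  have hl := K.ℓ_pos
  rw [K.lapseCoeff_eq x hr]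
  have h1 : K.xi * K.sig x.1 x.2.1 / (K.warp x.1 * K.deltaTheta x.2.1) ≤ K.ℓ ^ 2 := by
    rw [div_le_iff₀ (by positivity)]
    have h2 : K.sig x.1 x.2.1 ≤ K.ℓ ^ 2 * K.warp x.1 := by
      have : K.ℓ ^ 2 * K.warp x.1 = K.ℓ ^ 2 + x.1 ^ 2 := by
        rw [warp]; field_simp
      rw [this]
      linarith [K.sig_le x.1 x.2.1, K.a_sq_lt]
    have := mul_le_mul h2 (K.xi_le_deltaTheta x.2.1) hX.le (by positivity)
    linarith
  have h2 : 2 * K.M * x.1 / K.warp x.1 ^ 2 ≤ K.M * K.ℓ := by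
    rw [div_le_iff₀ (by positivity)]
    have h3 : 2 * x.1 ≤ K.ℓ * K.warp x.1 := by
      have : K.ℓ * K.warp x.1 - 2 * x.1 = (x.1 - K.ℓ) ^ 2 / K.ℓ := by
        rw [warp]; field_simp; ring
      have h4 : 0 ≤ (x.1 - K.ℓ) ^ 2 / K.ℓ := by positivity
      linarith
    have h5 : K.warp x.1 ≤ K.warp x.1 ^ 2 := by nlinarith [K.one_le_warp x.1]
    have h6 : K.ℓ * K.warp x.1 ≤ K.ℓ * K.warp x.1 ^ 2 := by gcongr
    nlinarith
  linarith

/-- `r² / (1 + r²/ℓ²)` is increasing, so the lower bound on the lapse coefficient is attained at the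
horizon and is uniform up to infinity. -/
lemma le_lapseCoeff {x : Slice} (hr : K.rp ≤ x.1) :
    K.xi * K.rp ^ 2 / K.warp K.rp ≤ K.lapseCoeff x := by
  have hp := K.rp_pos
  have hr0 := hp.trans_le hr
  have hσ := K.sig_pos hr0 x.2.1
  have hX := K.xi_pos
  have hw := K.warp_pos x.1
  have hw' := K.warp_pos K.rp
  have hl := K.ℓ_pos
  have h := K.inv_invLapse_sq_le hr0
  have hA := K.lapseCoeff_pos hr0
  rw [K.invLapse_sq hr0, one_div_div, div_le_div_iff₀ hA hX] at h
  have h1 : K.rp ^ 2 * K.warp x.1 ≤ x.1 ^ 2 * K.warp K.rp := by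
    have : x.1 ^ 2 * K.warp K.rp - K.rp ^ 2 * K.warp x.1 = x.1 ^ 2 - K.rp ^ 2 := by
      rw [warp, warp]; ring
    nlinarith
  rw [div_le_iff₀ hw']
  have h2 := K.sq_le_sig x.1 x.2.1
  have h3 : x.1 ^ 2 * K.xi ≤ K.sig x.1 x.2.1 * K.xi := by gcongr
  refine le_of_mul_le_mul_right ?_ hw
  calc K.xi * K.rp ^ 2 * K.warp x.1 = K.xi * (K.rp ^ 2 * K.warp x.1) := by ring
    _ ≤ K.xi * (x.1 ^ 2 * K.warp K.rp) := by gcongr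
    _ = x.1 ^ 2 * K.xi * K.warp K.rp := by ring
    _ ≤ K.warp x.1 * K.lapseCoeff x * K.warp K.rp :=
        mul_le_mul_of_nonneg_right (h3.trans h) hw'.le
    _ = _ := by ring

lemma invLapse_sq_le {x : Slice} (hr : K.rp ≤ x.1) :
    K.invLapse x ^ 2 ≤ (K.ℓ ^ 2 + K.M * K.ℓ) / K.rp ^ 2 := by
  have hp := K.rp_pos
  have hr0 := hp.trans_le hr
  have hl := K.ℓ_pos
  have hM := K.M_pos
  rw [K.invLapse_sq hr0]
  have h1 : K.rp ^ 2 ≤ K.sig x.1 x.2.1 :=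
    (pow_le_pow_left₀ hp.le hr 2).trans (K.sq_le_sig _ _)
  have := K.lapseCoeff_le hr0
  gcongr

end KerrAdS

/-- Coercivity of the energy flux of a timelike vector field through a spacelike slice. -/
lemma timelike_flux_coercive {ν B η ε m n b H : ℝ} (hH : 0 ≤ H) (hB : 1 ≤ B)
    (hη : η ≤ 1 / 2) (hε : 4 * η * B ≤ ε * ν ^ 2) (hm : ν ^ 2 * m ≤ B ^ 2 - ε * ν ^ 2)
    (hb : b ^ 2 ≤ m * H) :
    η * (n ^ 2 + H) ≤ 1 / 2 * B * (n ^ 2 + H) + ν * n * b := by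
  -- The timelike gap `εν² ≥ 4ηB` lowers the bound on `ν√m` from `B` to `B - 2η`; this `2η` is the
  -- coercivity that survives Cauchy–Schwarz.
  have hm2 : ν ^ 2 * m ≤ (B - 2 * η) ^ 2 := by nlinarith [sq_nonneg η]
  have hcross : |ν * n * b| ≤ (B - 2 * η) * ((n ^ 2 + H) / 2) := by
    refine abs_le_of_sq_le_sq ?_ (mul_nonneg (by linarith) (by positivity))
    calc (ν * n * b) ^ 2 = ν ^ 2 * n ^ 2 * b ^ 2 := by ring
      _ ≤ ν ^ 2 * n ^ 2 * (m * H) := by gcongr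
      _ = ν ^ 2 * m * (n ^ 2 * H) := by ring
      _ ≤ (B - 2 * η) ^ 2 * (n ^ 2 * H) := by gcongr
      _ ≤ (B - 2 * η) ^ 2 * ((n ^ 2 + H) / 2) ^ 2 := by
        gcongr
        nlinarith [sq_nonneg (n ^ 2 - H)]
      _ = _ := by ring
  have := neg_abs_le (ν * n * b)
  linarith

/-! ### Pointwise coercivity of the flux near the black hole and far away. -/

namespace KerrAdS

variable (K : KerrAdS)

lemma warp_mono {r r' : ℝ} (hr : 0 < r) (h : r ≤ r') : K.warp r ≤ K.warp r' := by
  have := K.ℓ_pos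
  rw [warp, warp]
  gcongr

lemma deltaTheta_mul_sq_eq {x : Slice} (hr : 0 < x.1) (y : ℝ) :
    K.deltaTheta x.2.1 * y ^ 2 = K.sig x.1 x.2.1 * (y ^ 2 / K.gθθ x.1 x.2.1) := by
  have := (K.sig_pos hr x.2.1).ne'
  have := (K.deltaTheta_pos x.2.1).ne'
  rw [gθθ]
  field_simp

set_option maxHeartbeats 1000000 in
-- All radial weights are bounded on `[r₊, r₁]`, so definiteness of the gradient form suffices and
-- every `v²` term goes to the error. The bounds on lapse and metric coefficients are uniform in
-- `θ`, so the axis causes no loss.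
theorem flux_coercive_near (α r₁ : ℝ) {ξ : ℝ → ℝ} (hξ0 : ∀ r, 0 ≤ ξ r) (hξc : Continuous ξ)
    (hN : K.UniformlyTimelike (K.vecN ξ) K.rp) :
    ∃ c > 0, ∃ C ≥ 0, ∀ x : Slice, K.rp ≤ x.1 → x.1 ≤ r₁ → x.2.1 ∈ Ioo 0 Real.pi →
      ∀ (v : ℝ) (dv : Fin 4 → ℝ),
        c * K.h1Density x v dv ≤ K.fluxDensity α ξ x v dv + C * (v ^ 2 * K.sigWeight x) := by
  by_cases hr₁ : K.rp ≤ r₁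
  swap
  · exact ⟨1, one_pos, 0, le_rfl, fun x h1 h2 => absurd (h1.trans h2) hr₁⟩
  obtain ⟨ε, hε, hN⟩ := hN
  have hp := K.rp_pos
  have hX := K.xi_pos
  have hX1 := K.xi_le_one
  have hl := K.ℓ_pos
  have hM := K.M_pos
  have hr₁0 := hp.trans_le hr₁
  obtain ⟨B₀, hB₀⟩ := (isCompact_Icc (a := K.rp) (b := r₁)).exists_bound_of_continuousOn
    hξc.continuousOn
  have hB₀0 : 0 ≤ B₀ := (norm_nonneg _).trans (hB₀ K.rp ⟨le_rfl, hr₁⟩)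
  obtain ⟨ν₁, hν₁0, hν₁⟩ : ∃ ν₁ : ℝ, 0 < ν₁ ∧ (K.ℓ ^ 2 + K.M * K.ℓ) / K.rp ^ 2 = ν₁ ^ 2 :=
    ⟨√((K.ℓ ^ 2 + K.M * K.ℓ) / K.rp ^ 2), Real.sqrt_pos.2 (by positivity),
      (Real.sq_sqrt (by positivity)).symm⟩
  obtain ⟨L₁, hL₁⟩ : ∃ L, L = K.warp r₁ / K.xi := ⟨_, rfl⟩
  have hL₁0 : 0 < L₁ := by rw [hL₁]; exact div_pos (K.warp_pos _) hX
  obtain ⟨Bm, hBm⟩ : ∃ B, B = 1 + B₀ * ν₁ := ⟨_, rfl⟩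
  have hBm1 : 1 ≤ Bm := by
    have : 0 ≤ B₀ * ν₁ := by positivity
    linarith
  -- `L₁` bounds `1/ν²` and `Bm` bounds `B`, so this `η` satisfies `4ηB ≤ εν²` throughout the
  -- region, as `timelike_flux_coercive` requires.
  obtain ⟨η, hη⟩ : ∃ η, η = min (1 / 2) (ε / (4 * Bm * L₁)) := ⟨_, rfl⟩
  have hη0 : 0 < η := by rw [hη]; positivity
  have hη2 : η ≤ 1 / 2 := hη ▸ min_le_left _ _
  have hη3 : 4 * η * Bm ≤ ε / L₁ := by
    have : η ≤ ε / (4 * Bm * L₁) := hη ▸ min_le_right _ _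
    rw [le_div_iff₀ (by positivity)] at this ⊢
    linarith
  obtain ⟨p₁, hp₁⟩ : ∃ p, p = 1 + (1 + 2 * K.M / K.rp) := ⟨_, rfl⟩
  have hp₁0 : 0 < p₁ := by rw [hp₁]; positivity
  -- The first summand bounds `(∂_{t*}ψ)²`, through `dv 0 = n/ν + b`, and the second the spatial
  -- terms with their radial weights, both by `n² + H`.
  obtain ⟨C₂, hC₂⟩ : ∃ C, C = 2 * L₁ * Bm ^ 2 + (r₁ ^ 4 + r₁ ^ 2) * p₁ := ⟨_, rfl⟩
  have hC₂0 : 0 < C₂ := by rw [hC₂]; positivity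
  refine ⟨K.rp ^ 2 * η / C₂, by positivity,
    K.rp ^ 2 * η / C₂ + 1 / 2 * Bm * |α / K.ℓ ^ 2|, by positivity, ?_⟩
  intro x hx hx₁ hθ v dv
  have hr : 0 < x.1 := hp.trans_le hx
  have hs : 0 < Real.sin x.2.1 := Real.sin_pos_of_mem_Ioo hθ
  have hσ := K.sig_pos hr x.2.1
  have hσr := K.sq_le_sig x.1 x.2.1
  have hν := K.invLapse_pos hr
  have hξB : ξ x.1 ≤ B₀ := (le_abs_self _).trans (hB₀ x.1 ⟨hx, hx₁⟩)
  have hξ := hξ0 x.1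
  have hνν : K.invLapse x ≤ ν₁ :=
    le_of_sq_le_sq (by rw [← hν₁]; exact K.invLapse_sq_le hx) hν₁0.le
  have hL : 1 / K.invLapse x ^ 2 ≤ L₁ := by
    refine (K.inv_invLapse_sq_le hr).trans ?_
    rw [hL₁]
    have := K.warp_mono hr hx₁
    gcongr
  have hT := hN x.1 x.2.1 x.2.2 hx hθ
  simp only [Prod.mk.eta] at hT
  rw [K.pairing_vecN hr hs.ne'] at hT
  have hshift := K.shift_mul_sq_le hr hs.ne' dv
  have hgrad := K.le_gradSq hr hs.ne' dv
  have hgrr := K.grr_le hx x.2.1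
  have hgrr0 := K.grr_pos hr x.2.1
  have hφ0 : 0 ≤ dv 3 ^ 2 / K.gφφ x.1 x.2.1 := div_nonneg (sq_nonneg _) (K.gφφ_pos hr hs.ne').le
  have hθ0 : 0 ≤ dv 2 ^ 2 / K.gθθ x.1 x.2.1 := div_nonneg (sq_nonneg _) (K.gθθ_pos hr _).le
  have hdv0 := K.dv_zero_eq hr dv
  rw [K.fluxDensity_eq_normal α ξ hr hs.ne', K.h1Density_eq hr, sigWeight]
  change K.shiftDeriv x dv ^ 2 ≤ _ at hshift
  generalize K.gφφ x.1 x.2.1 = gφ at *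
  generalize K.gθθ x.1 x.2.1 = gt at *
  have hH : 0 ≤ K.gradSq x dv := by
    refine nonneg_of_mul_nonneg_right (a := 1 + K.grr x.1 x.2.1) ?_ (by linarith)
    exact le_trans (by positivity) hgrad
  generalize K.gradSq x dv = H at *
  generalize K.shiftDeriv x dv = b at *
  generalize K.normalDeriv x dv = n at *
  generalize K.invLapse x = ν at *
  generalize K.sig x.1 x.2.1 = σ at *
  generalize ξ x.1 = ζ at *
  generalize K.gtt x.1 x.2.1 = gt0 at *
  generalize K.grr x.1 x.2.1 = gr at *
  obtain ⟨B, hB⟩ : ∃ B, B = 1 + ζ * ν := ⟨_, rfl⟩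
  rw [← hB]
  have hB1 : 1 ≤ B := by
    have : 0 ≤ ζ * ν := by positivity
    linarith
  have hBBm : B ≤ Bm := by
    rw [hB, hBm]
    gcongr
  have hνL : 1 / L₁ ≤ ν ^ 2 := by
    rw [div_le_iff₀ (by positivity)] at hL ⊢
    linarith
  have hε4 : 4 * η * B ≤ ε * ν ^ 2 := by
    calc 4 * η * B ≤ 4 * η * Bm := by gcongr
      _ ≤ ε / L₁ := hη3
      _ = ε * (1 / L₁) := by ring
      _ ≤ ε * ν ^ 2 := by gcongr
  -- This is `g(N,N) = |β|² - B²/ν² ≤ -ε` multiplied by `ν²`.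
  have hm : ν ^ 2 * (gt0 + 1 / ν ^ 2) ≤ B ^ 2 - ε * ν ^ 2 := by
    have h1 : ν ^ 2 * (gt0 + 1 / ν ^ 2)
        = ν ^ 2 * (gt0 - 2 * ζ / ν - ζ ^ 2) + B ^ 2 := by
      rw [hB]
      field_simp
      ring
    rw [h1]
    have := mul_le_mul_of_nonneg_left hT (sq_nonneg ν)
    linarith
  have hcore : η * (n ^ 2 + H) ≤ 1 / 2 * B * (n ^ 2 + H) + ν * n * b :=
    timelike_flux_coercive hH hB1 hη2 hε4 hm hshift
  have hb : b ^ 2 ≤ L₁ * Bm ^ 2 * H := by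
    refine hshift.trans (mul_le_mul_of_nonneg_right ?_ hH)
    have h1 : gt0 + 1 / ν ^ 2 ≤ 1 / ν ^ 2 * B ^ 2 := by
      have h2 : ν ^ 2 * (gt0 + 1 / ν ^ 2) ≤ B ^ 2 := hm.trans (sub_le_self _ (by positivity))
      rw [one_div_mul_eq_div, le_div_iff₀ (by positivity)]
      linarith
    refine h1.trans ?_
    gcongr
  have hd0 : dv 0 ^ 2 ≤ 2 * L₁ * Bm ^ 2 * (n ^ 2 + H) := by
    have h1 : dv 0 ^ 2 ≤ 2 * (1 / ν ^ 2 * n ^ 2) + 2 * b ^ 2 := by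
      rw [hdv0]
      have : 1 / ν ^ 2 * n ^ 2 = (n / ν) ^ 2 := by ring
      rw [this]
      linarith [sq_nonneg (n / ν - b)]
    have h2 : 1 / ν ^ 2 * n ^ 2 ≤ L₁ * Bm ^ 2 * n ^ 2 := by
      refine mul_le_mul_of_nonneg_right ?_ (sq_nonneg n)
      exact hL.trans (le_mul_of_one_le_right hL₁0.le (one_le_pow₀ hBm1))
    linarith
  have hsp : dv 1 ^ 2 + dv 3 ^ 2 / gφ + dv 2 ^ 2 / gt ≤ p₁ * (n ^ 2 + H) := by
    refine hgrad.trans (mul_le_mul (by linarith) (le_add_of_nonneg_left (sq_nonneg n)) hH hp₁0.le)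
  have hx2 : x.1 ^ 2 ≤ r₁ ^ 2 := pow_le_pow_left₀ hr.le hx₁ 2
  have hx4 : x.1 ^ 4 ≤ r₁ ^ 4 := pow_le_pow_left₀ hr.le hx₁ 4
  have hsum : dv 0 ^ 2 + x.1 ^ 4 * dv 1 ^ 2 + x.1 ^ 2 * (dv 2 ^ 2 / gt)
      + x.1 ^ 2 * (dv 3 ^ 2 / gφ) ≤ C₂ * (n ^ 2 + H) := by
    have h1 : x.1 ^ 4 * dv 1 ^ 2 ≤ (r₁ ^ 4 + r₁ ^ 2) * dv 1 ^ 2 := by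
      gcongr
      exact hx4.trans (le_add_of_nonneg_right (sq_nonneg r₁))
    have h2 : x.1 ^ 2 * (dv 2 ^ 2 / gt) ≤ (r₁ ^ 4 + r₁ ^ 2) * (dv 2 ^ 2 / gt) := by
      gcongr
      exact hx2.trans (le_add_of_nonneg_left (by positivity))
    have h3 : x.1 ^ 2 * (dv 3 ^ 2 / gφ) ≤ (r₁ ^ 4 + r₁ ^ 2) * (dv 3 ^ 2 / gφ) := by
      gcongr
      exact hx2.trans (le_add_of_nonneg_left (by positivity))
    have h4 := mul_le_mul_of_nonneg_left hsp (by positivity : 0 ≤ r₁ ^ 4 + r₁ ^ 2)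
    rw [hC₂]
    linarith
  obtain ⟨c, hc⟩ : ∃ c, c = K.rp ^ 2 * η / C₂ := ⟨_, rfl⟩
  have hc0 : 0 < c := by rw [hc]; positivity
  have hcC : c * C₂ = K.rp ^ 2 * η := by rw [hc]; field_simp
  rw [← hc]
  have hσX : x.1 ^ 2 ≤ σ / K.xi := by
    rw [le_div_iff₀ hX]
    exact (mul_le_of_le_one_right (sq_nonneg _) hX1).trans hσr
  have hE : 0 ≤ n ^ 2 + H := by positivity
  have hrp2 : K.rp ^ 2 ≤ x.1 ^ 2 := pow_le_pow_left₀ hp.le hx 2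
  have hα := le_abs_self (α / K.ℓ ^ 2)
  generalize α / K.ℓ ^ 2 = α' at *
  have hlow : η * (n ^ 2 + H) - 1 / 2 * Bm * |α'| * v ^ 2
      ≤ 1 / 2 * B * (n ^ 2 + H) + ν * n * b - 1 / 2 * B * α' * v ^ 2 := by
    have : B * α' ≤ Bm * |α'| := by
      calc B * α' ≤ B * |α'| := by gcongr
        _ ≤ Bm * |α'| := by gcongr
    have := mul_le_mul_of_nonneg_right this (sq_nonneg v)
    linarith
  calc c * (Real.sin x.2.1 * (dv 0 ^ 2 + x.1 ^ 4 * dv 1 ^ 2 + x.1 ^ 2 * (dv 2 ^ 2 / gt)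
        + x.1 ^ 2 * (dv 3 ^ 2 / gφ) + x.1 ^ 2 * v ^ 2))
      ≤ c * (Real.sin x.2.1 * (C₂ * (n ^ 2 + H) + x.1 ^ 2 * v ^ 2)) := by gcongr
    _ = Real.sin x.2.1 * (K.rp ^ 2 * (η * (n ^ 2 + H)) + x.1 ^ 2 * (c * v ^ 2)) := by
      rw [mul_add, mul_add, mul_add]
      linear_combination Real.sin x.2.1 * (n ^ 2 + H) * hcC
    _ ≤ Real.sin x.2.1 * (σ / K.xi * (η * (n ^ 2 + H)) + σ / K.xi * (c * v ^ 2)) := by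
      gcongr
      exact hrp2.trans hσX
    _ = Real.sin x.2.1 / K.xi * (σ * (η * (n ^ 2 + H) - 1 / 2 * Bm * |α'| * v ^ 2))
        + (c + 1 / 2 * Bm * |α'|) * (v ^ 2 * (σ / K.xi * Real.sin x.2.1)) := by ring
    _ ≤ _ := by gcongr

/-- Beyond this radius the radial coefficient of the energy dominates the weight of the Hardy
inequality. -/
def farRadius : ℝ := 4 * K.M + 2 * |K.a| + 2 * K.ℓ

lemma sin_sq_mul_le_gφφ {r : ℝ} (hr : 0 < r) (θ : ℝ) :
    Real.sin θ ^ 2 * (r ^ 2 / K.xi) ≤ K.gφφ r θ := by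
  rw [K.gφφ_eq hr]
  have := K.sig_pos hr θ
  have := K.xi_pos
  have := K.M_pos
  have h1 : 0 ≤ 2 * K.M * r * K.a ^ 2 * Real.sin θ ^ 2 / (K.xi ^ 2 * K.sig r θ) := by positivity
  have h2 : r ^ 2 / K.xi ≤ (r ^ 2 + K.a ^ 2) / K.xi := by
    gcongr
    nlinarith [sq_nonneg K.a]
  gcongr
  linarith

/-- Half of the `r²` in `Δ₋` is spent on the mass term and on a reserve `2a²` for the `∂_rψ ∂_φψ`
term; the other half appears as `ℓ²/2`, the surplus over `a²` that the Hardy inequality needs. -/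
lemma deltaMinus_ge {r : ℝ} (hr : K.farRadius ≤ r) :
    r ^ 2 * (r ^ 2 + (K.a ^ 2 + K.ℓ ^ 2 / 2)) / K.ℓ ^ 2 + 2 * K.a ^ 2 ≤ K.deltaMinus r := by
  have hM := K.M_pos
  have hl := K.ℓ_pos
  have ha := abs_nonneg K.a
  have h : K.deltaMinus r - (r ^ 2 * (r ^ 2 + (K.a ^ 2 + K.ℓ ^ 2 / 2)) / K.ℓ ^ 2 + 2 * K.a ^ 2)
      = r * (r - 4 * K.M) / 2 - |K.a| ^ 2 := by
    rw [deltaMinus, warp, sq_abs]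
    field_simp
    ring
  -- The part `4M + 2|a|` of the radius gives `r ≥ 2|a|` and `r - 4M ≥ 2|a|`.
  unfold farRadius at hr
  have : 2 * |K.a| * (2 * |K.a|) ≤ r * (r - 4 * K.M) := by
    apply mul_le_mul <;> linarith
  nlinarith

/-- For `N = T` the terms with one `∂_{t*}` cancel between `-g^{t*μ} ∂_μψ ∂_{t*}ψ` and the
Lagrangian. The expression multiplied by `κ` in the conclusion has no pointwise sign; it is arranged
to be exactly the Hardy integrand, nonnegative after integration. -/
theorem flux_coercive_far {α : ℝ} (hα : α < 9 / 4) :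
    ∃ c > 0, ∃ κ ≥ 0, ∀ (ξ : ℝ → ℝ) (x : Slice), K.rp ≤ x.1 → K.farRadius ≤ x.1 →
      x.2.1 ∈ Ioo 0 Real.pi → ξ x.1 = 0 → ∀ (v : ℝ) (dv : Fin 4 → ℝ),
        c * K.h1Density x v dv + κ * (Real.sin x.2.1 *
          (x.1 ^ 2 * (x.1 ^ 2 + (K.a ^ 2 + K.ℓ ^ 2 / 2)) * dv 1 ^ 2
            - 9 / 4 * (x.1 ^ 2 + K.a ^ 2) * v ^ 2))
          ≤ K.fluxDensity α ξ x v dv := by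
  have hp := K.rp_pos
  have hX := K.xi_pos
  have hX1 := K.xi_le_one
  have hl := K.ℓ_pos
  have hw := K.warp_pos K.rp
  have hA₀ : 0 < K.xi * K.rp ^ 2 / K.warp K.rp := by positivity
  -- A fraction `κ` of the radial energy is withheld from Hardy. Strictness of `α < 9/4` leaves room
  -- for it and for the positive zeroth-order coefficient `k`.
  obtain ⟨κ, hκ0, hκ1, hκ⟩ : ∃ κ : ℝ, 0 < κ ∧ κ < 1 ∧ α < 9 / 4 * (1 - κ) := by
    have h := sub_pos.2 hα
    refine ⟨min (1 / 2) ((9 / 4 - α) / 4), by positivity, ?_, ?_⟩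
    · exact (min_le_left _ _).trans_lt (by norm_num)
    · have := min_le_right (1 / 2) ((9 / 4 - α) / 4)
      linarith
  obtain ⟨k, hk⟩ : ∃ k, k = (9 / 4 * (1 - κ) - α) / K.ℓ ^ 2 := ⟨_, rfl⟩
  have hk0 : 0 < k := by rw [hk]; exact div_pos (by linarith) (by positivity)
  obtain ⟨m, hm⟩ : ∃ m, m = min (K.xi * K.rp ^ 2 / K.warp K.rp)
    (min (κ / K.ℓ ^ 2) (min (K.xi / 2) (min 1 k))) := ⟨_, rfl⟩
  have hm0 : 0 < m := by rw [hm]; positivity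
  have hm1 : m ≤ K.xi * K.rp ^ 2 / K.warp K.rp := by rw [hm]; exact min_le_left _ _
  have hm2 : m ≤ κ / K.ℓ ^ 2 := by rw [hm]; simp
  have hm3 : m ≤ K.xi / 2 := by rw [hm]; simp
  have hm4 : m ≤ 1 := by rw [hm]; simp
  have hm5 : m ≤ k := by rw [hm]; simp
  refine ⟨m / (2 * K.xi), by positivity, (1 - κ) / (2 * K.xi * K.ℓ ^ 2),
    div_nonneg (by linarith) (by positivity), ?_⟩
  intro ξ x hx hfar hθ hξ v dv
  have hr : 0 < x.1 := hp.trans_le hx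
  have hs : 0 < Real.sin x.2.1 := Real.sin_pos_of_mem_Ioo hθ
  have hσ := K.sig_pos hr x.2.1
  have hσr := K.sq_le_sig x.1 x.2.1
  have hσr' := K.sig_le x.1 x.2.1
  have hD := K.deltaTheta_pos x.2.1
  have hD1 := K.deltaTheta_le_one x.2.1
  have hA := (K.le_lapseCoeff hx).trans' hm1
  have hΔ := K.deltaMinus_ge hfar
  have hφ := K.gφφ_pos hr hs.ne'
  have hθpos := K.gθθ_pos hr x.2.1
  have hφ' := K.sin_sq_mul_le_gφφ hr x.2.1
  have hs1 := Real.sin_sq_le_one x.2.1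
  rw [K.fluxDensity_eq α ξ hr hs.ne', hξ, K.h1Density_eq hr, coQuad_eq, coNormal_eq,
    K.deltaTheta_mul_sq_eq hr]
  generalize K.lapseCoeff x = A at *
  generalize K.sig x.1 x.2.1 = σ at *
  generalize K.deltaMinus x.1 = Δ at *
  generalize K.deltaTheta x.2.1 = D at *
  generalize K.gφφ x.1 x.2.1 = gφ at *
  generalize K.gθθ x.1 x.2.1 = gt at *
  generalize Real.sin x.2.1 = s at *
  generalize x.1 = r at *
  generalize K.xi = X at *
  generalize K.a = a at *
  obtain ⟨W, hW⟩ : ∃ W, W = r ^ 2 * (r ^ 2 + (a ^ 2 + K.ℓ ^ 2 / 2)) := ⟨_, rfl⟩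
  rw [← hW] at hΔ ⊢
  have hWr : r ^ 4 ≤ W := by
    have : 0 ≤ r ^ 2 * (a ^ 2 + K.ℓ ^ 2 / 2) := by positivity
    rw [hW]
    linarith
  have e0 : m * dv 0 ^ 2 ≤ A * dv 0 ^ 2 := by gcongr
  have e1 : m * (r ^ 4 * dv 1 ^ 2) ≤ κ * (W / K.ℓ ^ 2 * dv 1 ^ 2) := by
    calc m * (r ^ 4 * dv 1 ^ 2) ≤ κ / K.ℓ ^ 2 * (W * dv 1 ^ 2) := by gcongr
      _ = _ := by ring
  have e2 : m * (r ^ 2 * (dv 2 ^ 2 / gt)) ≤ σ * (dv 2 ^ 2 / gt) := by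
    calc m * (r ^ 2 * (dv 2 ^ 2 / gt)) ≤ 1 * (σ * (dv 2 ^ 2 / gt)) := by gcongr
      _ = _ := by ring
  have hY : r ^ 2 / gφ ≤ X / (D * s ^ 2) := by
    rw [div_le_div_iff₀ hφ (by positivity)]
    calc r ^ 2 * (D * s ^ 2) ≤ r ^ 2 * (1 * s ^ 2) := by gcongr
      _ = X * (s ^ 2 * (r ^ 2 / X)) := by field_simp
      _ ≤ X * gφ := by gcongr
  have e3 : m * (r ^ 2 * (dv 3 ^ 2 / gφ)) ≤ 1 / 2 * (X ^ 2 / (D * s ^ 2) * dv 3 ^ 2) := by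
    calc m * (r ^ 2 * (dv 3 ^ 2 / gφ)) = m * (r ^ 2 / gφ * dv 3 ^ 2) := by ring
      _ ≤ X / 2 * (X / (D * s ^ 2) * dv 3 ^ 2) := by gcongr
      _ = _ := by ring
  have e4 : m * (r ^ 2 * v ^ 2) ≤ k * (r ^ 2 * v ^ 2) := by gcongr
  -- The mixed term is absorbed by half of the `φφ` term and the reserve `2a²` in `Δ₋`, using `Δ_θ
  -- sin² θ ≤ 1`.
  have e5 : 0 ≤ 1 / 2 * (X ^ 2 / (D * s ^ 2) * dv 3 ^ 2) + 2 * (a * X) * dv 1 * dv 3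
      + 2 * a ^ 2 * dv 1 ^ 2 := by
    have h1 : 1 / 2 * (X ^ 2 / (D * s ^ 2) * dv 3 ^ 2) + 2 * (a * X) * dv 1 * dv 3
        + 2 * a ^ 2 * (D * s ^ 2) * dv 1 ^ 2
        = 1 / 2 / (D * s ^ 2) * (X * dv 3 + 2 * a * (D * s ^ 2) * dv 1) ^ 2 := by
      field_simp
      ring
    have h2 : 0 ≤ 1 / 2 / (D * s ^ 2) * (X * dv 3 + 2 * a * (D * s ^ 2) * dv 1) ^ 2 := by
      positivity
    have h3 : 2 * a ^ 2 * (D * s ^ 2) * dv 1 ^ 2 ≤ 2 * a ^ 2 * 1 * dv 1 ^ 2 := by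
      gcongr
      exact mul_le_one₀ hD1 (sq_nonneg s) hs1
    linarith
  have e6 : (W / K.ℓ ^ 2 + 2 * a ^ 2) * dv 1 ^ 2 ≤ Δ * dv 1 ^ 2 := by gcongr
  have e7 : α / K.ℓ ^ 2 * σ * v ^ 2
      ≤ 9 / 4 * (1 - κ) / K.ℓ ^ 2 * ((r ^ 2 + a ^ 2) * v ^ 2) - k * (r ^ 2 * v ^ 2) := by
    have h1 : 9 / 4 * (1 - κ) / K.ℓ ^ 2 * σ ≤ 9 / 4 * (1 - κ) / K.ℓ ^ 2 * (r ^ 2 + a ^ 2) :=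
      mul_le_mul_of_nonneg_left hσr' (div_nonneg (by linarith) (by positivity))
    have h2 : k * r ^ 2 ≤ k * σ := by gcongr
    have h3 : α / K.ℓ ^ 2 * σ = 9 / 4 * (1 - κ) / K.ℓ ^ 2 * σ - k * σ := by
      rw [hk]
      ring
    have h4 : α / K.ℓ ^ 2 * σ
        ≤ 9 / 4 * (1 - κ) / K.ℓ ^ 2 * (r ^ 2 + a ^ 2) - k * r ^ 2 := by linarith
    have := mul_le_mul_of_nonneg_right h4 (sq_nonneg v)
    linarith
  have key : m * (dv 0 ^ 2 + r ^ 4 * dv 1 ^ 2 + r ^ 2 * (dv 2 ^ 2 / gt)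
      + r ^ 2 * (dv 3 ^ 2 / gφ) + r ^ 2 * v ^ 2)
      + (1 - κ) / K.ℓ ^ 2 * (W * dv 1 ^ 2 - 9 / 4 * (r ^ 2 + a ^ 2) * v ^ 2)
      ≤ A * dv 0 ^ 2 + Δ * dv 1 ^ 2 + 2 * (a * X) * dv 1 * dv 3 + σ * (dv 2 ^ 2 / gt)
        + X ^ 2 / (D * s ^ 2) * dv 3 ^ 2 - α / K.ℓ ^ 2 * σ * v ^ 2 := by
    have h1 : (1 - κ) / K.ℓ ^ 2 * (W * dv 1 ^ 2 - 9 / 4 * (r ^ 2 + a ^ 2) * v ^ 2)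
        = W / K.ℓ ^ 2 * dv 1 ^ 2 - κ * (W / K.ℓ ^ 2 * dv 1 ^ 2)
          - 9 / 4 * (1 - κ) / K.ℓ ^ 2 * ((r ^ 2 + a ^ 2) * v ^ 2) := by ring
    rw [h1]
    linarith
  have hsX : 0 ≤ s / (2 * X) := by positivity
  calc _ = s / (2 * X) * (m * (dv 0 ^ 2 + r ^ 4 * dv 1 ^ 2 + r ^ 2 * (dv 2 ^ 2 / gt)
      + r ^ 2 * (dv 3 ^ 2 / gφ) + r ^ 2 * v ^ 2)
      + (1 - κ) / K.ℓ ^ 2 * (W * dv 1 ^ 2 - 9 / 4 * (r ^ 2 + a ^ 2) * v ^ 2)) := by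
        field_simp
    _ ≤ _ := mul_le_mul_of_nonneg_left key hsX
    _ = _ := by
      field_simp
      ring

end KerrAdS

/-! ### Domination of the flux density by the integrand of the norm. -/

lemma abs_two_mul_mul_le (x y : ℝ) : |2 * x * y| ≤ x ^ 2 + y ^ 2 := by
  rw [abs_le]
  constructor <;> nlinarith [sq_nonneg (x + y), sq_nonneg (x - y)]

namespace KerrAdS

variable (K : KerrAdS)

/-- The factor `sin² θ` must be kept: it compensates the singular coefficient `1/sin² θ` of
`(∂_φψ)²` at the axis. -/
lemma exists_gφφ_le : ∃ k ≥ 0, ∀ r θ : ℝ, K.rp ≤ r → K.gφφ r θ ≤ k * (Real.sin θ ^ 2 * r ^ 2) := by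
  have hp := K.rp_pos
  have hX := K.xi_pos
  have hM := K.M_pos
  refine ⟨(1 + K.a ^ 2 / K.rp ^ 2) / K.xi + 2 * K.M * K.a ^ 2 / (K.xi ^ 2 * K.rp ^ 3),
    by positivity, fun r θ hrp => ?_⟩
  have hr := hp.trans_le hrp
  have hσ := K.sq_le_sig r θ
  have hs := Real.sin_sq_le_one θ
  rw [K.gφφ_eq hr]
  have h1 : (r ^ 2 + K.a ^ 2) / K.xi ≤ (1 + K.a ^ 2 / K.rp ^ 2) / K.xi * r ^ 2 := by
    rw [div_mul_eq_mul_div]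
    gcongr
    have : K.a ^ 2 / K.rp ^ 2 * K.rp ^ 2 ≤ K.a ^ 2 / K.rp ^ 2 * r ^ 2 := by gcongr
    have h : K.a ^ 2 / K.rp ^ 2 * K.rp ^ 2 = K.a ^ 2 := by field_simp
    linarith
  have h2 : 2 * K.M * r * K.a ^ 2 * Real.sin θ ^ 2 / (K.xi ^ 2 * K.sig r θ)
      ≤ 2 * K.M * K.a ^ 2 / (K.xi ^ 2 * K.rp ^ 3) * r ^ 2 := by
    calc 2 * K.M * r * K.a ^ 2 * Real.sin θ ^ 2 / (K.xi ^ 2 * K.sig r θ)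
        ≤ 2 * K.M * r * K.a ^ 2 * 1 / (K.xi ^ 2 * r ^ 2) := by gcongr
      _ = 2 * K.M * K.a ^ 2 / (K.xi ^ 2 * r ^ 3) * r ^ 2 := by field_simp
      _ ≤ _ := by gcongr
  calc _ ≤ Real.sin θ ^ 2 * ((1 + K.a ^ 2 / K.rp ^ 2) / K.xi * r ^ 2
        + 2 * K.M * K.a ^ 2 / (K.xi ^ 2 * K.rp ^ 3) * r ^ 2) := by gcongr
    _ = _ := by ring

lemma exists_sig_le : ∃ k ≥ 0, ∀ r θ : ℝ, K.rp ≤ r → K.sig r θ ≤ k * r ^ 2 := by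
  have hp := K.rp_pos
  refine ⟨1 + K.a ^ 2 / K.rp ^ 2, by positivity, fun r θ hrp => (K.sig_le r θ).trans ?_⟩
  have : K.a ^ 2 / K.rp ^ 2 * K.rp ^ 2 ≤ K.a ^ 2 / K.rp ^ 2 * r ^ 2 := by gcongr
  have h : K.a ^ 2 / K.rp ^ 2 * K.rp ^ 2 = K.a ^ 2 := by field_simp
  linarith

lemma exists_coTr_sq_le : ∃ k ≥ 0, ∀ r : ℝ, K.rp ≤ r → K.coTr r ^ 2 ≤ k * r ^ 4 := by
  have hp := K.rp_pos
  have hM := K.M_pos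
  refine ⟨(2 * K.M) ^ 2 / K.rp ^ 2, by positivity, fun r hrp => ?_⟩
  have hr := hp.trans_le hrp
  have hw := K.one_le_warp r
  calc K.coTr r ^ 2 = (2 * K.M * r / K.warp r) ^ 2 := rfl
    _ ≤ (2 * K.M * r / 1) ^ 2 := by gcongr
    _ = (2 * K.M) ^ 2 / r ^ 2 * r ^ 4 := by field_simp
    _ ≤ _ := by gcongr

lemma coTφ_sq_le (r θ : ℝ) : K.coTφ r θ ^ 2 ≤ K.a ^ 2 := by
  have hX := K.xi_pos
  have hw := K.one_le_warp r
  have hD := K.deltaTheta_pos θ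
  have h1 : K.xi * (1 / K.deltaTheta θ) ≤ 1 := by
    rw [mul_one_div, div_le_one hD]
    exact K.xi_le_deltaTheta θ
  have h2 : K.xi * (1 / K.warp r) ≤ 1 := by
    rw [mul_one_div, div_le_one (by linarith)]
    exact K.xi_le_one.trans hw
  have h3 : 0 ≤ K.xi * (1 / K.deltaTheta θ) := by positivity
  have h4 : 0 ≤ K.xi * (1 / K.warp r) := by positivity
  have h5 : (K.xi * (1 / K.deltaTheta θ) - K.xi * (1 / K.warp r)) ^ 2 ≤ 1 := by
    rw [sq_le_one_iff_abs_le_one, abs_le]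
    constructor <;> linarith
  calc K.coTφ r θ ^ 2
      = K.a ^ 2 * (K.xi * (1 / K.deltaTheta θ) - K.xi * (1 / K.warp r)) ^ 2 := by
        rw [coTφ]; ring
    _ ≤ K.a ^ 2 * 1 := by gcongr
    _ = _ := mul_one _

lemma exists_abs_deltaMinus_le : ∃ k ≥ 0, ∀ r : ℝ, K.rp ≤ r → |K.deltaMinus r| ≤ k * r ^ 4 := by
  have hp := K.rp_pos
  have hM := K.M_pos
  have hl := K.ℓ_pos
  refine ⟨(1 + K.a ^ 2 / K.rp ^ 2) * (1 / K.rp ^ 2 + 1 / K.ℓ ^ 2) + 2 * K.M / K.rp ^ 3,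
    by positivity, fun r hrp => ?_⟩
  have hr := hp.trans_le hrp
  have h1 : (r ^ 2 + K.a ^ 2) * K.warp r
      ≤ (1 + K.a ^ 2 / K.rp ^ 2) * (1 / K.rp ^ 2 + 1 / K.ℓ ^ 2) * r ^ 4 := by
    calc (r ^ 2 + K.a ^ 2) * K.warp r
        = (1 + K.a ^ 2 / r ^ 2) * (1 / r ^ 2 + 1 / K.ℓ ^ 2) * r ^ 4 := by
          rw [warp]; field_simp
      _ ≤ _ := by gcongr
  have h2 : 2 * K.M * r ≤ 2 * K.M / K.rp ^ 3 * r ^ 4 := by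
    calc 2 * K.M * r = 2 * K.M / r ^ 3 * r ^ 4 := by field_simp
      _ ≤ _ := by gcongr
  have h3 : 0 ≤ (r ^ 2 + K.a ^ 2) * K.warp r := mul_nonneg (by positivity) (K.warp_pos r).le
  have h4 : 0 ≤ 2 * K.M * r := by positivity
  rw [deltaMinus, abs_le, add_mul]
  constructor <;> linarith

theorem exists_coNormal_sq_le : ∃ k ≥ 0, ∀ x : Slice, K.rp ≤ x.1 → x.2.1 ∈ Ioo 0 Real.pi →
    ∀ (v : ℝ) (dv : Fin 4 → ℝ),
      Real.sin x.2.1 * K.coNormal x dv ^ 2 ≤ k * K.h1Density x v dv := by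
  obtain ⟨kφ, hkφ0, hkφ⟩ := K.exists_gφφ_le
  obtain ⟨kr, hkr0, hkr⟩ := K.exists_coTr_sq_le
  have hp := K.rp_pos
  have hl := K.ℓ_pos
  have hM := K.M_pos
  refine ⟨3 * ((K.ℓ ^ 2 + K.M * K.ℓ) ^ 2 + kr + K.a ^ 2 * kφ), by positivity, ?_⟩
  intro x hx hθ v dv
  have hr : 0 < x.1 := hp.trans_le hx
  have hs : 0 < Real.sin x.2.1 := Real.sin_pos_of_mem_Ioo hθ
  have hs1 := Real.sin_sq_le_one x.2.1
  have hφ := K.gφφ_pos hr hs.ne'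
  have hθpos := K.gθθ_pos hr x.2.1
  have h0 : (K.lapseCoeff x * dv 0) ^ 2 ≤ (K.ℓ ^ 2 + K.M * K.ℓ) ^ 2 * dv 0 ^ 2 := by
    rw [mul_pow]
    have := K.lapseCoeff_pos hr
    have := K.lapseCoeff_le hr
    gcongr
  have h1 : (K.coTr x.1 * dv 1) ^ 2 ≤ kr * (x.1 ^ 4 * dv 1 ^ 2) := by
    rw [mul_pow, ← mul_assoc]
    have := hkr x.1 hx
    gcongr
  have h3 : (K.coTφ x.1 x.2.1 * dv 3) ^ 2
      ≤ K.a ^ 2 * kφ * (x.1 ^ 2 * (dv 3 ^ 2 / K.gφφ x.1 x.2.1)) := by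
    have hg : K.gφφ x.1 x.2.1 ≤ kφ * x.1 ^ 2 := by
      refine (hkφ x.1 x.2.1 hx).trans ?_
      gcongr
      exact mul_le_of_le_one_left (sq_nonneg _) hs1
    calc (K.coTφ x.1 x.2.1 * dv 3) ^ 2 = K.coTφ x.1 x.2.1 ^ 2 * dv 3 ^ 2 := mul_pow _ _ _
      _ ≤ K.a ^ 2 * dv 3 ^ 2 := by
        have := K.coTφ_sq_le x.1 x.2.1
        gcongr
      _ = K.a ^ 2 * (K.gφφ x.1 x.2.1 * (dv 3 ^ 2 / K.gφφ x.1 x.2.1)) := by field_simp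
      _ ≤ K.a ^ 2 * (kφ * x.1 ^ 2 * (dv 3 ^ 2 / K.gφφ x.1 x.2.1)) := by gcongr
      _ = _ := by ring
  have hsum : K.coNormal x dv ^ 2 ≤ 3 * ((K.lapseCoeff x * dv 0) ^ 2 + (K.coTr x.1 * dv 1) ^ 2
      + (K.coTφ x.1 x.2.1 * dv 3) ^ 2) := by
    rw [coNormal_eq]
    nlinarith [sq_nonneg (K.lapseCoeff x * dv 0 + K.coTr x.1 * dv 1),
      sq_nonneg (K.lapseCoeff x * dv 0 + K.coTφ x.1 x.2.1 * dv 3),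
      sq_nonneg (K.coTr x.1 * dv 1 - K.coTφ x.1 x.2.1 * dv 3)]
  rw [K.h1Density_eq hr, mul_left_comm]
  refine mul_le_mul_of_nonneg_left ?_ hs.le
  have p0 := sq_nonneg (dv 0)
  have p1 : 0 ≤ x.1 ^ 4 * dv 1 ^ 2 := by positivity
  have p2 : 0 ≤ x.1 ^ 2 * (dv 2 ^ 2 / K.gθθ x.1 x.2.1) := by positivity
  have p3 : 0 ≤ x.1 ^ 2 * (dv 3 ^ 2 / K.gφφ x.1 x.2.1) := by positivity
  have p4 : 0 ≤ x.1 ^ 2 * v ^ 2 := by positivity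
  generalize x.1 ^ 2 * (dv 3 ^ 2 / K.gφφ x.1 x.2.1) = e3 at *
  generalize x.1 ^ 2 * (dv 2 ^ 2 / K.gθθ x.1 x.2.1) = e2 at *
  generalize x.1 ^ 4 * dv 1 ^ 2 = e1 at *
  generalize x.1 ^ 2 * v ^ 2 = e4 at *
  generalize dv 0 ^ 2 = e0 at *
  have hS0 : (K.ℓ ^ 2 + K.M * K.ℓ) ^ 2 * e0
      ≤ (K.ℓ ^ 2 + K.M * K.ℓ) ^ 2 * (e0 + e1 + e2 + e3 + e4) := by gcongr; linarith
  have hS1 : kr * e1 ≤ kr * (e0 + e1 + e2 + e3 + e4) := by gcongr; linarith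
  have hS3 : K.a ^ 2 * kφ * e3 ≤ K.a ^ 2 * kφ * (e0 + e1 + e2 + e3 + e4) := by gcongr; linarith
  linarith

set_option maxHeartbeats 800000 in
theorem exists_coQuad_le (α : ℝ) : ∃ k ≥ 0, ∀ x : Slice, K.rp ≤ x.1 → x.2.1 ∈ Ioo 0 Real.pi →
    ∀ (v : ℝ) (dv : Fin 4 → ℝ),
      Real.sin x.2.1 * |K.coQuad x dv - α / K.ℓ ^ 2 * K.sig x.1 x.2.1 * v ^ 2|
        ≤ k * K.h1Density x v dv := by
  obtain ⟨kφ, hkφ0, hkφ⟩ := K.exists_gφφ_le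
  obtain ⟨kr, hkr0, hkr⟩ := K.exists_coTr_sq_le
  obtain ⟨kΔ, hkΔ0, hkΔ⟩ := K.exists_abs_deltaMinus_le
  obtain ⟨kσ, hkσ0, hkσ⟩ := K.exists_sig_le
  have hp := K.rp_pos
  have hl := K.ℓ_pos
  have hM := K.M_pos
  have hX := K.xi_pos
  have hX1 := K.xi_le_one
  refine ⟨(K.ℓ ^ 2 + K.M * K.ℓ + 2) + (kr + kΔ + K.a ^ 2 / K.rp ^ 4) + kσ
    + (K.a ^ 2 * kφ + kφ + K.xi * kφ) + |α / K.ℓ ^ 2| * kσ, by positivity, ?_⟩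
  intro x hx hθ v dv
  have hr : 0 < x.1 := hp.trans_le hx
  have hs : 0 < Real.sin x.2.1 := Real.sin_pos_of_mem_Ioo hθ
  have hs1 := Real.sin_sq_le_one x.2.1
  have hφ := K.gφφ_pos hr hs.ne'
  have hθpos := K.gθθ_pos hr x.2.1
  have hσ := K.sig_pos hr x.2.1
  have hσk := hkσ x.1 x.2.1 hx
  have hA0 := K.lapseCoeff_pos hr
  have hA1 := K.lapseCoeff_le hr
  have hD := K.deltaTheta_pos x.2.1
  have hDX := K.xi_le_deltaTheta x.2.1
  have p0 := sq_nonneg (dv 0)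
  have p1 : 0 ≤ x.1 ^ 4 * dv 1 ^ 2 := by positivity
  have p2 : 0 ≤ x.1 ^ 2 * (dv 2 ^ 2 / K.gθθ x.1 x.2.1) := by positivity
  have p3 : 0 ≤ x.1 ^ 2 * (dv 3 ^ 2 / K.gφφ x.1 x.2.1) := by positivity
  have p4 : 0 ≤ x.1 ^ 2 * v ^ 2 := by positivity
  have hdv3 : dv 3 ^ 2 = K.gφφ x.1 x.2.1 * (dv 3 ^ 2 / K.gφφ x.1 x.2.1) := by field_simp
  have h3 : dv 3 ^ 2 ≤ kφ * (x.1 ^ 2 * (dv 3 ^ 2 / K.gφφ x.1 x.2.1)) := by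
    have hg : K.gφφ x.1 x.2.1 ≤ kφ * x.1 ^ 2 := by
      refine (hkφ x.1 x.2.1 hx).trans ?_
      gcongr
      exact mul_le_of_le_one_left (sq_nonneg _) hs1
    calc dv 3 ^ 2 = K.gφφ x.1 x.2.1 * (dv 3 ^ 2 / K.gφφ x.1 x.2.1) := hdv3
      _ ≤ kφ * x.1 ^ 2 * (dv 3 ^ 2 / K.gφφ x.1 x.2.1) := by gcongr
      _ = _ := by ring
  have hY : K.xi ^ 2 / (K.deltaTheta x.2.1 * Real.sin x.2.1 ^ 2) * dv 3 ^ 2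
      ≤ K.xi * kφ * (x.1 ^ 2 * (dv 3 ^ 2 / K.gφφ x.1 x.2.1)) := by
    calc K.xi ^ 2 / (K.deltaTheta x.2.1 * Real.sin x.2.1 ^ 2) * dv 3 ^ 2
        ≤ K.xi ^ 2 / (K.xi * Real.sin x.2.1 ^ 2) * dv 3 ^ 2 := by gcongr
      _ = K.xi / Real.sin x.2.1 ^ 2
          * (K.gφφ x.1 x.2.1 * (dv 3 ^ 2 / K.gφφ x.1 x.2.1)) := by field_simp
      _ ≤ K.xi / Real.sin x.2.1 ^ 2 * (kφ * (Real.sin x.2.1 ^ 2 * x.1 ^ 2)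
          * (dv 3 ^ 2 / K.gφφ x.1 x.2.1)) := by
        have := hkφ x.1 x.2.1 hx
        gcongr
      _ = _ := by field_simp
  have hY0 : 0 ≤ K.xi ^ 2 / (K.deltaTheta x.2.1 * Real.sin x.2.1 ^ 2) * dv 3 ^ 2 := by positivity
  have hA : K.lapseCoeff x * dv 0 ^ 2 ≤ (K.ℓ ^ 2 + K.M * K.ℓ) * dv 0 ^ 2 := by gcongr
  have hA' : 0 ≤ K.lapseCoeff x * dv 0 ^ 2 := by positivity
  have hc1 : (K.coTr x.1 * dv 1) ^ 2 ≤ kr * (x.1 ^ 4 * dv 1 ^ 2) := by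
    rw [mul_pow, ← mul_assoc]
    have := hkr x.1 hx
    gcongr
  have hc3 : (K.coTφ x.1 x.2.1 * dv 3) ^ 2
      ≤ K.a ^ 2 * kφ * (x.1 ^ 2 * (dv 3 ^ 2 / K.gφφ x.1 x.2.1)) := by
    rw [mul_pow, mul_assoc]
    exact mul_le_mul (K.coTφ_sq_le _ _) h3 (sq_nonneg _) (sq_nonneg _)
  have hΔ : |K.deltaMinus x.1 * dv 1 ^ 2| ≤ kΔ * (x.1 ^ 4 * dv 1 ^ 2) := by
    rw [abs_mul, abs_of_nonneg (sq_nonneg (dv 1)), ← mul_assoc]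
    have := hkΔ x.1 hx
    gcongr
  have ha : (K.a * K.xi * dv 1) ^ 2 ≤ K.a ^ 2 / K.rp ^ 4 * (x.1 ^ 4 * dv 1 ^ 2) := by
    calc (K.a * K.xi * dv 1) ^ 2 = K.a ^ 2 * K.xi ^ 2 * dv 1 ^ 2 := by ring
      _ ≤ K.a ^ 2 * 1 * dv 1 ^ 2 := by
        have := pow_le_one₀ (n := 2) hX.le hX1
        gcongr
      _ = K.a ^ 2 / x.1 ^ 4 * (x.1 ^ 4 * dv 1 ^ 2) := by field_simp
      _ ≤ _ := by gcongr
  have hσ2 : K.sig x.1 x.2.1 * (dv 2 ^ 2 / K.gθθ x.1 x.2.1)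
      ≤ kσ * (x.1 ^ 2 * (dv 2 ^ 2 / K.gθθ x.1 x.2.1)) := by
    rw [← mul_assoc]
    gcongr
  have hσ2' : 0 ≤ K.sig x.1 x.2.1 * (dv 2 ^ 2 / K.gθθ x.1 x.2.1) := by positivity
  have hα : |α / K.ℓ ^ 2 * K.sig x.1 x.2.1 * v ^ 2| ≤ |α / K.ℓ ^ 2| * kσ * (x.1 ^ 2 * v ^ 2) := by
    rw [abs_mul, abs_mul, abs_of_pos hσ, abs_of_nonneg (sq_nonneg v)]
    calc |α / K.ℓ ^ 2| * K.sig x.1 x.2.1 * v ^ 2 ≤ |α / K.ℓ ^ 2| * (kσ * x.1 ^ 2) * v ^ 2 := by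
          gcongr
      _ = _ := by ring
  have hx1 : |2 * K.coTr x.1 * dv 0 * dv 1| ≤ dv 0 ^ 2 + (K.coTr x.1 * dv 1) ^ 2 := by
    have := abs_two_mul_mul_le (dv 0) (K.coTr x.1 * dv 1)
    rwa [show 2 * dv 0 * (K.coTr x.1 * dv 1) = 2 * K.coTr x.1 * dv 0 * dv 1 by ring] at this
  have hx3 : |2 * K.coTφ x.1 x.2.1 * dv 0 * dv 3| ≤ dv 0 ^ 2 + (K.coTφ x.1 x.2.1 * dv 3) ^ 2 := by
    have := abs_two_mul_mul_le (dv 0) (K.coTφ x.1 x.2.1 * dv 3)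
    rwa [show 2 * dv 0 * (K.coTφ x.1 x.2.1 * dv 3) = 2 * K.coTφ x.1 x.2.1 * dv 0 * dv 3 by ring]
      at this
  have hx13 : |2 * (K.a * K.xi) * dv 1 * dv 3| ≤ (K.a * K.xi * dv 1) ^ 2 + dv 3 ^ 2 := by
    have := abs_two_mul_mul_le (K.a * K.xi * dv 1) (dv 3)
    rwa [show 2 * (K.a * K.xi * dv 1) * dv 3 = 2 * (K.a * K.xi) * dv 1 * dv 3 by ring] at this
  rw [K.h1Density_eq hr, mul_left_comm]
  refine mul_le_mul_of_nonneg_left ?_ hs.le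
  rw [coQuad_eq, K.deltaTheta_mul_sq_eq hr]
  generalize x.1 ^ 2 * (dv 3 ^ 2 / K.gφφ x.1 x.2.1) = e3 at *
  generalize x.1 ^ 2 * (dv 2 ^ 2 / K.gθθ x.1 x.2.1) = e2 at *
  generalize x.1 ^ 4 * dv 1 ^ 2 = e1 at *
  generalize x.1 ^ 2 * v ^ 2 = e4 at *
  have hb : |-K.lapseCoeff x * dv 0 ^ 2 + 2 * K.coTr x.1 * dv 0 * dv 1
      + 2 * K.coTφ x.1 x.2.1 * dv 0 * dv 3 + K.deltaMinus x.1 * dv 1 ^ 2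
      + 2 * (K.a * K.xi) * dv 1 * dv 3 + K.sig x.1 x.2.1 * (dv 2 ^ 2 / K.gθθ x.1 x.2.1)
      + K.xi ^ 2 / (K.deltaTheta x.2.1 * Real.sin x.2.1 ^ 2) * dv 3 ^ 2
      - α / K.ℓ ^ 2 * K.sig x.1 x.2.1 * v ^ 2|
      ≤ (K.ℓ ^ 2 + K.M * K.ℓ + 2) * dv 0 ^ 2 + (kr + kΔ + K.a ^ 2 / K.rp ^ 4) * e1 + kσ * e2
        + (K.a ^ 2 * kφ + kφ + K.xi * kφ) * e3 + |α / K.ℓ ^ 2| * kσ * e4 := by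
    rw [abs_le] at hx1 hx3 hx13 hΔ hα ⊢
    constructor <;> linarith
  refine hb.trans ?_
  generalize dv 0 ^ 2 = e0 at *
  have expand : ∀ {k e : ℝ}, 0 ≤ k → e ≤ e0 + e1 + e2 + e3 + e4 →
      k * e ≤ k * (e0 + e1 + e2 + e3 + e4) := fun hk he => mul_le_mul_of_nonneg_left he hk
  have q0 := expand (k := K.ℓ ^ 2 + K.M * K.ℓ + 2) (e := e0) (by positivity) (by linarith)
  have q1 := expand (k := kr + kΔ + K.a ^ 2 / K.rp ^ 4) (e := e1) (by positivity) (by linarith)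
  have q2 := expand (k := kσ) (e := e2) hkσ0 (by linarith)
  have q3 := expand (k := K.a ^ 2 * kφ + kφ + K.xi * kφ) (e := e3) (by positivity) (by linarith)
  have q4 := expand (k := |α / K.ℓ ^ 2| * kσ) (e := e4) (by positivity) (by linarith)
  linarith

lemma h1Density_nonneg {x : Slice} (hr : 0 < x.1) (hθ : x.2.1 ∈ Ioo 0 Real.pi) (v : ℝ)
    (dv : Fin 4 → ℝ) : 0 ≤ K.h1Density x v dv := by
  have hs : 0 < Real.sin x.2.1 := Real.sin_pos_of_mem_Ioo hθ
  have := K.gφφ_pos hr hs.ne'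
  have := K.gθθ_pos hr x.2.1
  rw [K.h1Density_eq hr]
  positivity

/-- Together with measurability this yields integrability of the flux. The coordinate formula
suffices, as the lapse coefficient is bounded above and below. -/
theorem exists_abs_fluxDensity_le (α : ℝ) {ξ : ℝ → ℝ} {B : ℝ} (hξ0 : ∀ r, 0 ≤ ξ r)
    (hB : ∀ r, K.rp ≤ r → ξ r ≤ B) :
    ∃ k : ℝ, ∀ x : Slice, K.rp ≤ x.1 → x.2.1 ∈ Ioo 0 Real.pi → ∀ (v : ℝ) (dv : Fin 4 → ℝ),
      |K.fluxDensity α ξ x v dv| ≤ k * K.h1Density x v dv := by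
  obtain ⟨k₁, hk₁0, hk₁⟩ := K.exists_coNormal_sq_le
  obtain ⟨k₂, hk₂0, hk₂⟩ := K.exists_coQuad_le α
  have hp := K.rp_pos
  have hX := K.xi_pos
  have hl := K.ℓ_pos
  have hM := K.M_pos
  have hw := K.warp_pos K.rp
  obtain ⟨ν₁, hν₁0, hν₁⟩ : ∃ ν₁ : ℝ, 0 < ν₁ ∧ (K.ℓ ^ 2 + K.M * K.ℓ) / K.rp ^ 2 = ν₁ ^ 2 :=
    ⟨√((K.ℓ ^ 2 + K.M * K.ℓ) / K.rp ^ 2), Real.sqrt_pos.2 (by positivity),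
      (Real.sq_sqrt (by positivity)).symm⟩
  obtain ⟨A₀, hA₀⟩ : ∃ A₀, A₀ = K.xi * K.rp ^ 2 / K.warp K.rp := ⟨_, rfl⟩
  have hA₀0 : 0 < A₀ := by rw [hA₀]; positivity
  refine ⟨1 / K.xi * (1 / 2 * k₁ + 1 / 2 + 1 / 2 * k₂ + B * ν₁ * (k₁ / A₀ + 1 / 2 * k₂)), ?_⟩
  intro x hx hθ v dv
  have hr : 0 < x.1 := hp.trans_le hx
  have hs : 0 < Real.sin x.2.1 := Real.sin_pos_of_mem_Ioo hθ
  have hν := K.invLapse_pos hr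
  have hνν : K.invLapse x ≤ ν₁ :=
    le_of_sq_le_sq (by rw [← hν₁]; exact K.invLapse_sq_le hx) hν₁0.le
  have hA := K.le_lapseCoeff hx
  rw [← hA₀] at hA
  have hξB := hB x.1 hx
  have hξ := hξ0 x.1
  have h1 := hk₁ x hx hθ v dv
  have h2 := hk₂ x hx hθ v dv
  have hd := K.h1Density_nonneg hr hθ v dv
  have h0 : Real.sin x.2.1 * dv 0 ^ 2 ≤ K.h1Density x v dv := by
    rw [K.h1Density_eq hr]
    have := K.gφφ_pos hr hs.ne'
    have := K.gθθ_pos hr x.2.1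
    have p1 : 0 ≤ x.1 ^ 4 * dv 1 ^ 2 := by positivity
    have p2 : 0 ≤ x.1 ^ 2 * (dv 2 ^ 2 / K.gθθ x.1 x.2.1) := by positivity
    have p3 : 0 ≤ x.1 ^ 2 * (dv 3 ^ 2 / K.gφφ x.1 x.2.1) := by positivity
    have p4 : 0 ≤ x.1 ^ 2 * v ^ 2 := by positivity
    gcongr
    linarith
  rw [K.fluxDensity_eq α ξ hr hs.ne']
  generalize K.coQuad x dv - α / K.ℓ ^ 2 * K.sig x.1 x.2.1 * v ^ 2 = Q at *
  generalize K.coNormal x dv = P at *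
  generalize K.h1Density x v dv = d at *
  generalize Real.sin x.2.1 = s at *
  generalize K.lapseCoeff x = A at *
  generalize K.invLapse x = ν at *
  generalize ξ x.1 = ζ at *
  generalize dv 0 = y at *
  have hA0 : 0 < A := hA₀0.trans_le hA
  have hPy : |P * y| ≤ 1 / 2 * P ^ 2 + 1 / 2 * y ^ 2 := by
    rw [abs_le]
    constructor <;> nlinarith [sq_nonneg (P + y), sq_nonneg (P - y)]
  have habs : |-P * y + 1 / 2 * Q + ζ * ν * (P ^ 2 / A + 1 / 2 * Q)|
      ≤ 1 / 2 * P ^ 2 + 1 / 2 * y ^ 2 + 1 / 2 * |Q|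
        + B * ν₁ * (P ^ 2 / A₀ + 1 / 2 * |Q|) := by
    have hin : |P ^ 2 / A + 1 / 2 * Q| ≤ P ^ 2 / A₀ + 1 / 2 * |Q| := by
      refine (abs_add_le _ _).trans ?_
      rw [abs_of_nonneg (by positivity : 0 ≤ P ^ 2 / A), abs_mul,
        abs_of_pos (by norm_num : (0 : ℝ) < 1 / 2)]
      gcongr
    have hmul : |ζ * ν * (P ^ 2 / A + 1 / 2 * Q)| ≤ B * ν₁ * (P ^ 2 / A₀ + 1 / 2 * |Q|) := by
      rw [abs_mul, abs_of_nonneg (by positivity : 0 ≤ ζ * ν)]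
      have : 0 ≤ B := hξ.trans hξB
      gcongr
    have hQ := neg_abs_le Q
    have hQ' := le_abs_self Q
    rw [abs_le] at hPy hmul ⊢
    constructor <;> linarith
  calc |s / K.xi * (-P * y + 1 / 2 * Q + ζ * ν * (P ^ 2 / A + 1 / 2 * Q))|
      = s / K.xi * |-P * y + 1 / 2 * Q + ζ * ν * (P ^ 2 / A + 1 / 2 * Q)| := by
        rw [abs_mul, abs_of_pos (by positivity)]
    _ ≤ s / K.xi * (1 / 2 * P ^ 2 + 1 / 2 * y ^ 2 + 1 / 2 * |Q|
        + B * ν₁ * (P ^ 2 / A₀ + 1 / 2 * |Q|)) := by gcongr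
    _ = 1 / K.xi * (1 / 2 * (s * P ^ 2) + 1 / 2 * (s * y ^ 2) + 1 / 2 * (s * |Q|)
        + B * ν₁ * (s * P ^ 2 / A₀ + 1 / 2 * (s * |Q|))) := by ring
    _ ≤ 1 / K.xi * (1 / 2 * (k₁ * d) + 1 / 2 * d + 1 / 2 * (k₂ * d)
        + B * ν₁ * (k₁ * d / A₀ + 1 / 2 * (k₂ * d))) := by
        have : 0 ≤ B := hξ.trans hξB
        gcongr
    _ = _ := by ring

end KerrAdS

/-! ### The one-dimensional Hardy inequality. -/

lemma integrableOn_Ioi_of_weighted_sq {v : ℝ → ℝ} {p : ℝ} (hp : 0 < p)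
    (hm : AEStronglyMeasurable v (volume.restrict (Ioi p)))
    (hv : IntegrableOn (fun r => r ^ 4 * v r ^ 2) (Ioi p)) : IntegrableOn v (Ioi p) := by
  have h4 : IntegrableOn (fun r : ℝ => r ^ (-4 : ℝ)) (Ioi p) :=
    integrableOn_Ioi_rpow_of_lt (by norm_num) hp
  refine Integrable.mono' (Integrable.add hv h4) hm ?_
  refine (ae_restrict_iff' measurableSet_Ioi).2 (Eventually.of_forall fun r hr => ?_)
  have hr0 : 0 < r := hp.trans hr
  have e : r ^ (-4 : ℝ) = (r ^ 2)⁻¹ ^ 2 := by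
    rw [show (-4 : ℝ) = -((4 : ℕ) : ℝ) by norm_num, Real.rpow_neg hr0.le, Real.rpow_natCast,
      inv_pow, ← pow_mul]
  simp only [Pi.add_apply, Real.norm_eq_abs, e]
  have h1 : r ^ 4 * v r ^ 2 = (r ^ 2 * |v r|) ^ 2 := by
    rw [mul_pow, sq_abs]; ring
  have h2 : |v r| = (r ^ 2 * |v r|) * (r ^ 2)⁻¹ := by field_simp
  rw [h1]
  have h3 := sq_nonneg (r ^ 2 * |v r| - (r ^ 2)⁻¹)
  have h4 : 0 ≤ (r ^ 2 * |v r|) * (r ^ 2)⁻¹ := by positivity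
  nlinarith

/-- Put `f = 3/2 (r³ - r₁³)`; the last bracket is `f' u² + 2 f u v`, which is `(f u²)'` when `v =
u'`. The sum is a quadratic form in `(u, v)` with discriminant condition `f² ≤ 9/4 (r² - A) r² (r² +
b)`. As `f ≤ 3/2 r³`, it reduces to `A b ≤ (b - A) r²`. -/
lemma hardy_pointwise {r r₁ A b : ℝ} (hr₁ : 0 < r₁) (hr : r₁ ≤ r) (hA : 0 ≤ A) (hAb : A ≤ b)
    (hb : A * b ≤ (b - A) * r₁ ^ 2) (u v : ℝ) :
    0 ≤ r ^ 2 * (r ^ 2 + b) * v ^ 2 - 9 / 4 * (r ^ 2 + A) * u ^ 2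
      + (9 / 2 * r ^ 2 * u ^ 2 + 3 * (r ^ 3 - r₁ ^ 3) * u * v) := by
  have hr0 : 0 < r := hr₁.trans_le hr
  have hb0 : 0 ≤ b := hA.trans hAb
  have hW : 0 < r ^ 2 * (r ^ 2 + b) := by positivity
  obtain ⟨f, hf⟩ : ∃ f, f = 3 / 2 * (r ^ 3 - r₁ ^ 3) := ⟨_, rfl⟩
  have hf0 : 0 ≤ f := by
    have := pow_le_pow_left₀ hr₁.le hr 3
    rw [hf]
    linarith
  have hf1 : f ≤ 3 / 2 * r ^ 3 := by
    have : 0 ≤ r₁ ^ 3 := by positivity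
    rw [hf]
    linarith
  have hf2 : f ^ 2 ≤ 9 / 4 * r ^ 6 := by
    calc f ^ 2 ≤ (3 / 2 * r ^ 3) ^ 2 := by gcongr
      _ = _ := by ring
  have h1 : A * b ≤ (b - A) * r ^ 2 := by
    refine hb.trans ?_
    have := sub_nonneg.2 hAb
    gcongr
  have h2 : f ^ 2 ≤ 9 / 4 * (r ^ 2 - A) * (r ^ 2 * (r ^ 2 + b)) := by
    have : r ^ 2 * (r ^ 4) ≤ r ^ 2 * ((r ^ 2 - A) * (r ^ 2 + b)) := by
      gcongr
      linarith
    linarith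
  refine nonneg_of_mul_nonneg_right (a := r ^ 2 * (r ^ 2 + b)) ?_ hW
  have h3 := mul_nonneg (sub_nonneg.2 h2) (sq_nonneg u)
  have h4 := sq_nonneg (r ^ 2 * (r ^ 2 + b) * v + f * u)
  have h5 : 3 * (r ^ 3 - r₁ ^ 3) = 2 * f := by rw [hf]; ring
  rw [h5]
  linarith

/-- The integrand is the derivative of `3/2 (r³ - r₁³) U²`, which is zero at `r₁`. Its limit at
infinity exists by integrability and must vanish, otherwise `r² U²` would be bounded below by a
multiple of `1/r`. -/
lemma integral_Ioi_deriv_cubic_mul_sq {r₁ c : ℝ} (hr₁ : 0 < r₁) {v U : ℝ → ℝ}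
    (hm : AEStronglyMeasurable v (volume.restrict (Ioi r₁)))
    (hv : IntegrableOn (fun r => r ^ 4 * v r ^ 2) (Ioi r₁))
    (hU : ∀ r, U r = c + ∫ s in r₁..r, v s)
    (hu : IntegrableOn (fun r => r ^ 2 * U r ^ 2) (Ioi r₁)) :
    IntegrableOn (fun r => 9 / 2 * r ^ 2 * U r ^ 2 + 3 * (r ^ 3 - r₁ ^ 3) * U r * v r) (Ioi r₁) ∧
    ∫ r in Ioi r₁, (9 / 2 * r ^ 2 * U r ^ 2 + 3 * (r ^ 3 - r₁ ^ 3) * U r * v r) = 0 := by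
  have hvi := integrableOn_Ioi_of_weighted_sq hr₁ hm hv
  have hII : ∀ R, r₁ ≤ R → IntervalIntegrable v volume r₁ R := fun R hR =>
    (intervalIntegrable_iff_integrableOn_Ioc_of_le hR).2 (hvi.mono_set Ioc_subset_Ioi_self)
  have hUac : ∀ R, r₁ ≤ R → AbsolutelyContinuousOnInterval U r₁ R := fun R hR => by
    have h1 := (hII R hR).absolutelyContinuousOnInterval_intervalIntegral (c := r₁) left_mem_uIcc
    have h2 : AbsolutelyContinuousOnInterval (fun _ : ℝ => c) r₁ R :=
      contDiffOn_const.absolutelyContinuousOnInterval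
    have h3 := h2.add h1
    refine (funext fun r => ?_ : U = _) ▸ h3
    exact hU r
  have hUcont : ContinuousOn U (Ici r₁) := by
    intro r hr
    have h := (hUac (r + 1) (by linarith [mem_Ici.1 hr])).continuousOn
    rw [uIcc_of_le (by linarith [mem_Ici.1 hr])] at h
    refine (h r ⟨hr, by linarith⟩).mono_of_mem_nhdsWithin ?_
    filter_upwards [self_mem_nhdsWithin, nhdsWithin_le_nhds (Iic_mem_nhds (lt_add_one r))]
      with s h1 h2 using ⟨h1, h2⟩
  have hfac : ∀ R, AbsolutelyContinuousOnInterval (fun r => 3 / 2 * (r ^ 3 - r₁ ^ 3)) r₁ R :=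
    fun R => ContDiffOn.absolutelyContinuousOnInterval (by fun_prop)
  have hint : IntegrableOn
      (fun r => 9 / 2 * r ^ 2 * U r ^ 2 + 3 * (r ^ 3 - r₁ ^ 3) * U r * v r) (Ioi r₁) := by
    have hUm : AEStronglyMeasurable U (volume.restrict (Ioi r₁)) :=
      (hUcont.mono Ioi_subset_Ici_self).aestronglyMeasurable measurableSet_Ioi
    refine Integrable.mono' ((Integrable.const_mul hu 6).add (Integrable.const_mul hv (3 / 2)))
      ?_ ?_
    · have c1 : AEStronglyMeasurable (fun r : ℝ => 9 / 2 * r ^ 2) (volume.restrict (Ioi r₁)) :=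
        Continuous.aestronglyMeasurable (by fun_prop)
      have c2 : AEStronglyMeasurable (fun r : ℝ => 3 * (r ^ 3 - r₁ ^ 3))
          (volume.restrict (Ioi r₁)) := Continuous.aestronglyMeasurable (by fun_prop)
      exact (c1.mul (hUm.pow 2)).add ((c2.mul hUm).mul hm)
    · refine (ae_restrict_iff' measurableSet_Ioi).2 (Eventually.of_forall fun r hr => ?_)
      have hr0 : 0 < r := hr₁.trans hr
      have h3 : r₁ ^ 3 ≤ r ^ 3 := pow_le_pow_left₀ hr₁.le (le_of_lt hr) 3
      have h3' : 0 < r₁ ^ 3 := by positivity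
      have hx : |3 * (r ^ 3 - r₁ ^ 3) * U r * v r|
          ≤ 3 / 2 * (r ^ 2 * U r ^ 2) + 3 / 2 * (r ^ 4 * v r ^ 2) := by
        rw [abs_mul, abs_mul, abs_of_nonneg (by linarith : 0 ≤ 3 * (r ^ 3 - r₁ ^ 3))]
        calc 3 * (r ^ 3 - r₁ ^ 3) * |U r| * |v r| ≤ 3 * r ^ 3 * |U r| * |v r| := by
              gcongr; linarith
          _ ≤ 3 / 2 * (r * |U r|) ^ 2 + 3 / 2 * (r ^ 2 * |v r|) ^ 2 := by
              linarith [sq_nonneg (r * |U r| - r ^ 2 * |v r|)]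
          _ = _ := by rw [mul_pow, mul_pow, sq_abs, sq_abs]; ring
      have h1 : 0 ≤ r ^ 2 * U r ^ 2 := by positivity
      rw [Real.norm_eq_abs]
      simp only [Pi.add_apply]
      rw [abs_le] at hx ⊢
      constructor <;> linarith [hx.1, hx.2]
  refine ⟨hint, ?_⟩
  have hFTC : ∀ R, r₁ ≤ R →
      ∫ r in r₁..R, (9 / 2 * r ^ 2 * U r ^ 2 + 3 * (r ^ 3 - r₁ ^ 3) * U r * v r)
        = 3 / 2 * (R ^ 3 - r₁ ^ 3) * U R ^ 2 := by
    intro R hR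
    have hac := hUac R hR
    have h := AbsolutelyContinuousOnInterval.integral_deriv_mul_eq_sub (hfac R) (hac.fun_mul hac)
    have e : 3 / 2 * (R ^ 3 - r₁ ^ 3) * (U R * U R) - 3 / 2 * (r₁ ^ 3 - r₁ ^ 3) * (U r₁ * U r₁)
        = 3 / 2 * (R ^ 3 - r₁ ^ 3) * U R ^ 2 := by ring
    rw [← e, ← h]
    refine intervalIntegral.integral_congr_ae ?_
    filter_upwards [(hII R hR).ae_hasDerivAt_integral] with r hr hmem
    have hd := hr (uIoc_subset_uIcc hmem) r₁ left_mem_uIcc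
    have hdU : HasDerivAt U (v r) r := by
      refine (funext fun r => ?_ : U = _) ▸ hd.const_add c
      exact hU r
    have hdf : HasDerivAt (fun r : ℝ => 3 / 2 * (r ^ 3 - r₁ ^ 3)) (3 / 2 * (3 * r ^ 2)) r := by
      have := ((hasDerivAt_pow 3 r).sub_const (r₁ ^ 3)).const_mul (3 / 2 : ℝ)
      simpa using this
    rw [hdf.deriv, (hdU.fun_mul hdU).deriv]
    ring
  have hlim := intervalIntegral_tendsto_integral_Ioi r₁ hint tendsto_id
  obtain ⟨L, hL⟩ : ∃ L, L = ∫ r in Ioi r₁,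
    (9 / 2 * r ^ 2 * U r ^ 2 + 3 * (r ^ 3 - r₁ ^ 3) * U r * v r) := ⟨_, rfl⟩
  rw [← hL] at hlim ⊢
  have hlim' : Tendsto (fun R => 3 / 2 * (R ^ 3 - r₁ ^ 3) * U R ^ 2) atTop (𝓝 L) := by
    refine hlim.congr' ?_
    filter_upwards [eventually_ge_atTop r₁] with R hR using hFTC R hR
  have hL0 : 0 ≤ L := by
    refine ge_of_tendsto hlim' ?_
    filter_upwards [eventually_ge_atTop r₁] with R hR
    have := pow_le_pow_left₀ hr₁.le hR 3
    exact mul_nonneg (by linarith) (sq_nonneg _)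
  by_contra hne
  have hLpos : 0 < L := lt_of_le_of_ne hL0 (Ne.symm hne)
  obtain ⟨R₀, hR₀⟩ := eventually_atTop.1
    ((hlim'.eventually (lt_mem_nhds (half_lt_self hLpos))).and (eventually_ge_atTop r₁))
  refine not_integrableOn_Ioi_inv (a := max R₀ r₁) ?_
  refine Integrable.mono' (Integrable.const_mul
    (hu.mono_set (Ioi_subset_Ioi (le_max_right R₀ r₁))) (3 / L))
    measurable_inv.aestronglyMeasurable ?_
  refine (ae_restrict_iff' measurableSet_Ioi).2 (Eventually.of_forall fun r hr => ?_)
  have hrR : R₀ ≤ r := (le_max_left _ _).trans (le_of_lt hr)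
  obtain ⟨h1, h2⟩ := hR₀ r hrR
  have hr0 : 0 < r := hr₁.trans_le h2
  rw [Real.norm_of_nonneg (by positivity), div_mul_eq_mul_div, le_div_iff₀ hLpos,
    inv_mul_le_iff₀ hr0]
  have h3 : 0 ≤ r₁ ^ 3 * U r ^ 2 := by positivity
  linarith

theorem hardy_inequality_Ioi {r₁ A b c : ℝ} (hr₁ : 0 < r₁) (hA : 0 ≤ A) (hAb : A ≤ b)
    (hb : A * b ≤ (b - A) * r₁ ^ 2) {u v : ℝ → ℝ}
    (hm : AEStronglyMeasurable v (volume.restrict (Ioi r₁)))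
    (hv : IntegrableOn (fun r => r ^ 4 * v r ^ 2) (Ioi r₁))
    (hu : IntegrableOn (fun r => r ^ 2 * u r ^ 2) (Ioi r₁))
    (huv : ∀ᵐ r ∂volume.restrict (Ioi r₁), u r = c + ∫ s in r₁..r, v s) :
    0 ≤ ∫ r in Ioi r₁, (r ^ 2 * (r ^ 2 + b) * v r ^ 2 - 9 / 4 * (r ^ 2 + A) * u r ^ 2) := by
  have hU : IntegrableOn (fun r => r ^ 2 * (c + ∫ s in r₁..r, v s) ^ 2) (Ioi r₁) :=
    hu.congr (huv.mono fun r hr => by simp only [hr])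
  obtain ⟨h1, h2⟩ := integral_Ioi_deriv_cubic_mul_sq hr₁ hm hv (fun _ => rfl) hU
  have hb0 : 0 ≤ b := hA.trans hAb
  have e : ∫ r in Ioi r₁, (r ^ 2 * (r ^ 2 + b) * v r ^ 2 - 9 / 4 * (r ^ 2 + A) * u r ^ 2)
      = ∫ r in Ioi r₁, (r ^ 2 * (r ^ 2 + b) * v r ^ 2
        - 9 / 4 * (r ^ 2 + A) * (c + ∫ s in r₁..r, v s) ^ 2) :=
    integral_congr_ae (huv.mono fun r hr => by simp only [hr])
  have hbd : ∀ k ≥ 0, ∀ r > r₁, r ^ 2 + k ≤ (1 + k / r₁ ^ 2) * r ^ 2 := fun k hk r hr => by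
    have h3 : k / r₁ ^ 2 * r₁ ^ 2 ≤ k / r₁ ^ 2 * r ^ 2 := by gcongr
    have h4 : k / r₁ ^ 2 * r₁ ^ 2 = k := by field_simp
    linarith
  have i1 : IntegrableOn (fun r => r ^ 2 * (r ^ 2 + b) * v r ^ 2) (Ioi r₁) := by
    refine Integrable.mono' (Integrable.const_mul hv (1 + b / r₁ ^ 2)) ?_ ?_
    · have c1 : AEStronglyMeasurable (fun r : ℝ => r ^ 2 * (r ^ 2 + b))
          (volume.restrict (Ioi r₁)) := Continuous.aestronglyMeasurable (by fun_prop)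
      exact c1.mul (hm.pow 2)
    · refine (ae_restrict_iff' measurableSet_Ioi).2 (Eventually.of_forall fun r hr => ?_)
      rw [Real.norm_of_nonneg (by positivity)]
      have := hbd b hb0 r hr
      calc r ^ 2 * (r ^ 2 + b) * v r ^ 2 ≤ r ^ 2 * ((1 + b / r₁ ^ 2) * r ^ 2) * v r ^ 2 := by
            gcongr
        _ = _ := by ring
  have i2 : IntegrableOn (fun r => 9 / 4 * (r ^ 2 + A) * (c + ∫ s in r₁..r, v s) ^ 2)
      (Ioi r₁) := by
    have hc1 : AEStronglyMeasurable (fun r : ℝ => 9 / 4 * (r ^ 2 + A) * (r ^ 2)⁻¹)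
        (volume.restrict (Ioi r₁)) := Measurable.aestronglyMeasurable (by fun_prop)
    have hm2 := hc1.mul hU.aestronglyMeasurable
    refine Integrable.mono' (Integrable.const_mul hU (9 / 4 * (1 + A / r₁ ^ 2)))
      (hm2.congr ?_) ?_
    · refine (ae_restrict_iff' measurableSet_Ioi).2 (Eventually.of_forall fun r hr => ?_)
      have : 0 < r := hr₁.trans hr
      simp only [Pi.mul_apply]
      field_simp
    · refine (ae_restrict_iff' measurableSet_Ioi).2 (Eventually.of_forall fun r hr => ?_)
      rw [Real.norm_of_nonneg (by positivity)]
      have := hbd A hA r hr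
      calc 9 / 4 * (r ^ 2 + A) * (c + ∫ s in r₁..r, v s) ^ 2
          ≤ 9 / 4 * ((1 + A / r₁ ^ 2) * r ^ 2) * (c + ∫ s in r₁..r, v s) ^ 2 := by gcongr
        _ = _ := by ring
  have h3 := integral_add (i1.sub i2) h1
  rw [h2, add_zero] at h3
  refine (?_ : (0 : ℝ) ≤ _).trans_eq (h3.trans e.symm)
  refine setIntegral_nonneg measurableSet_Ioi fun r hr => ?_
  exact hardy_pointwise hr₁ (le_of_lt hr) hA hAb hb _ _

/-! ### From weak derivatives to absolute continuity along radial lines. -/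

instance : (volume : Measure (ℝ × ℝ)).IsAddHaarMeasure :=
  Measure.prod.instIsAddHaarMeasure (volume : Measure ℝ) (volume : Measure ℝ)

instance : (volume : Measure Slice).IsAddHaarMeasure :=
  Measure.prod.instIsAddHaarMeasure (volume : Measure ℝ) (volume : Measure (ℝ × ℝ))

section Translation

variable {Ω K : Set Slice} {e : Slice}

/-- The region swept by a compact set under shifts by `s • e`, `0 ≤ s ≤ h`, is compact and stays in
`Ω`; local integrability on it justifies the uses of Fubini. -/
lemma isCompact_sweep (hK : IsCompact K) (h : ℝ) :
    IsCompact ((fun p : ℝ × Slice => p.2 + p.1 • e) '' (Icc 0 h ×ˢ K)) :=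
  (isCompact_Icc.prod hK).image (by fun_prop)

lemma sweep_subset (hΩ : ∀ x ∈ Ω, ∀ s : ℝ, 0 ≤ s → x + s • e ∈ Ω) (hK : K ⊆ Ω) (h : ℝ) :
    (fun p : ℝ × Slice => p.2 + p.1 • e) '' (Icc 0 h ×ˢ K) ⊆ Ω := by
  rintro _ ⟨⟨s, x⟩, ⟨hs, hx⟩, rfl⟩
  exact hΩ x (hK hx) s hs.1

lemma mem_sweep {x : Slice} {s h : ℝ} (hs : s ∈ Icc 0 h) (hx : x - s • e ∈ K) :
    x ∈ (fun p : ℝ × Slice => p.2 + p.1 • e) '' (Icc 0 h ×ˢ K) :=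
  ⟨(s, x - s • e), ⟨hs, hx⟩, by simp⟩

lemma measurePreserving_shear (ν : Measure ℝ) [SFinite ν] :
    MeasurePreserving (fun p : ℝ × Slice => (p.1, p.2 + p.1 • e))
      (ν.prod volume) (ν.prod volume) := by
  refine MeasurePreserving.skew_product (g := fun s x => x + s • e) (MeasurePreserving.id ν) ?_ ?_
  · exact Measurable.add measurable_snd (measurable_fst.smul_const e)
  · exact Eventually.of_forall fun s => (measurePreserving_add_right volume (s • e)).map_eq

lemma integrable_translate_mul {w ζ : Slice → ℝ} {C : ℝ} (hw : LocallyIntegrableOn w Ω)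
    (hK : IsCompact K) (hKΩ : K ⊆ Ω) (hΩ : ∀ x ∈ Ω, ∀ s : ℝ, 0 ≤ s → x + s • e ∈ Ω)
    (hζ : Measurable ζ) (hC : ∀ x, ‖ζ x‖ ≤ C) (h0 : ∀ x ∉ K, ζ x = 0) (h : ℝ) :
    Integrable (fun p : ℝ × Slice => ζ (p.2 - p.1 • e) * w p.2)
      ((volume.restrict (Ioc 0 h)).prod volume) := by
  have hc := isCompact_sweep (e := e) hK h
  have h1 := (hw.integrableOn_compact_subset (sweep_subset hΩ hKΩ h) hc).integrable_indicator
    hc.measurableSet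
  have h2 := Integrable.mul_prod (μ := volume.restrict (Ioc 0 h)) (f := fun _ : ℝ => (1 : ℝ))
    (integrable_const 1) h1
  have hm : Measurable fun p : ℝ × Slice => ζ (p.2 - p.1 • e) :=
    hζ.comp (measurable_snd.sub (measurable_fst.smul_const e))
  refine (h2.bdd_mul hm.aestronglyMeasurable (Eventually.of_forall fun p => hC _)).congr ?_
  have hmem : ∀ᵐ p : ℝ × Slice ∂((volume.restrict (Ioc 0 h)).prod volume), p.1 ∈ Ioc 0 h :=
    Measure.quasiMeasurePreserving_fst.ae (ae_restrict_mem measurableSet_Ioc)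
  filter_upwards [hmem] with p hp
  by_cases hx : p.2 ∈ (fun p : ℝ × Slice => p.2 + p.1 • e) '' (Icc 0 h ×ˢ K)
  · simp [indicator_of_mem hx]
  · rw [h0 (p.2 - p.1 • e) fun hmem => hx (mem_sweep (Ioc_subset_Icc_self hp) hmem)]
    simp

lemma integrable_mul_translate {w ζ : Slice → ℝ} {C : ℝ} (hw : LocallyIntegrableOn w Ω)
    (hK : IsCompact K) (hKΩ : K ⊆ Ω) (hΩ : ∀ x ∈ Ω, ∀ s : ℝ, 0 ≤ s → x + s • e ∈ Ω)
    (hζ : Measurable ζ) (hC : ∀ x, ‖ζ x‖ ≤ C) (h0 : ∀ x ∉ K, ζ x = 0) (h : ℝ) :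
    Integrable (fun p : ℝ × Slice => ζ p.2 * w (p.2 + p.1 • e))
      ((volume.restrict (Ioc 0 h)).prod volume) := by
  have h1 := (measurePreserving_shear (e := e)
    (volume.restrict (Ioc 0 h))).integrable_comp_of_integrable
    (integrable_translate_mul hw hK hKΩ hΩ hζ hC h0 h)
  refine h1.congr (Eventually.of_forall fun p => ?_)
  simp

lemma integrableOn_integral_translate {w : Slice → ℝ} (hw : LocallyIntegrableOn w Ω)
    (hK : IsCompact K) (hKΩ : K ⊆ Ω) (hΩ : ∀ x ∈ Ω, ∀ s : ℝ, 0 ≤ s → x + s • e ∈ Ω) (h : ℝ) :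
    IntegrableOn (fun x => ∫ s in Ioc 0 h, w (x + s • e)) K := by
  have h1 := (integrable_mul_translate (ζ := K.indicator fun _ => (1 : ℝ)) (C := 1) hw hK hKΩ hΩ
    (measurable_const.indicator hK.measurableSet)
    (fun x => by by_cases hx : x ∈ K <;> simp [hx])
    (fun x hx => by simp [hx]) h).integral_prod_right
  refine IntegrableOn.congr_fun h1.integrableOn (fun x hx => ?_) hK.measurableSet
  simp [hx]

lemma integrableOn_translate {w : Slice → ℝ} (hw : LocallyIntegrableOn w Ω)
    (hK : IsCompact K) (hKΩ : K ⊆ Ω) (hΩ : ∀ x ∈ Ω, ∀ s : ℝ, 0 ≤ s → x + s • e ∈ Ω) {h : ℝ}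
    (hh : 0 ≤ h) : IntegrableOn (fun x => w (x + h • e)) K := by
  have hc : IsCompact ((fun x => x + h • e) '' K) := hK.image (by fun_prop)
  have h1 : IntegrableOn w ((fun x => x + h • e) '' K) :=
    hw.integrableOn_compact_subset (by rintro _ ⟨x, hx, rfl⟩; exact hΩ x (hKΩ hx) h hh) hc
  have h2 := ((measurePreserving_add_right volume (h • e)).integrableOn_comp_preimage
    (measurableEmbedding_addRight (h • e))).2 h1
  refine h2.mono_set (subset_preimage_image _ _)

end Translation

/-- Tested against `η`, the difference quotient falls on `η`: `η(x - he) - η(x)` is an integral of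
`-∂η(x - se)` over `s`, and the weak identity for each shifted `η` turns it into the integral of
`v`. Forward shifts preserve `Ω`, so the shifted functions remain admissible; the fundamental lemma
concludes. -/
lemma HasWeakPartial.ae_translate_sub {Ω : Set Slice} {i : Fin 3} {u v : Slice → ℝ}
    (hΩo : IsOpen Ω) (hΩ : ∀ x ∈ Ω, ∀ s : ℝ, 0 ≤ s → x + s • sliceVec i ∈ Ω)
    (huv : HasWeakPartial Ω i u v) {h : ℝ} (hh : 0 ≤ h) :
    ∀ᵐ x, x ∈ Ω → u (x + h • sliceVec i) - u x - ∫ s in Ioc 0 h, v (x + s • sliceVec i) = 0 := by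
  obtain ⟨hu, hv, hweak⟩ := huv
  set e := sliceVec i
  refine hΩo.ae_eq_zero_of_integral_contDiff_smul_eq_zero ?_ ?_
  · rw [locallyIntegrableOn_iff hΩo.isLocallyClosed]
    intro K hK hKc
    exact ((integrableOn_translate hu hKc hK hΩ hh).sub (hu.integrableOn_compact_subset hK hKc)).sub
      (integrableOn_integral_translate hv hKc hK hΩ h)
  intro η hη hηc hηΩ
  have hη0 : ∀ x ∉ tsupport η, η x = 0 := fun x hx => image_eq_zero_of_notMem_tsupport hx
  have hηcont := hη.continuous
  obtain ⟨C, hC⟩ := hηc.exists_bound_of_continuous hηcont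
  have hdη : ContDiff ℝ ∞ fun x => fderiv ℝ η x e := by fun_prop
  have hdη0 : ∀ x ∉ tsupport η, fderiv ℝ η x e = 0 := fun x hx => by
    rw [image_eq_zero_of_notMem_tsupport (fun h => hx (tsupport_fderiv_subset ℝ h))]
    rfl
  have hdηc : HasCompactSupport fun x => fderiv ℝ η x e :=
    HasCompactSupport.intro hηc fun x hx => hdη0 x hx
  obtain ⟨C', hC'⟩ := hdηc.exists_bound_of_continuous hdη.continuous
  have hweak' : ∀ s ∈ Icc 0 h,
      ∫ x, fderiv ℝ η (x - s • e) e * u x = -∫ x, η (x - s • e) * v x := by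
    intro s hs
    have hsub : tsupport (fun x => η (x - s • e)) ⊆ Ω := by
      have hcl : IsClosed ((fun x => x + s • e) '' tsupport η) :=
        (hηc.isCompact.image (by fun_prop)).isClosed
      refine (closure_minimal ?_ hcl).trans ?_
      · intro x hx
        exact ⟨x - s • e, subset_tsupport η hx, by simp⟩
      · rintro _ ⟨x, hx, rfl⟩
        exact hΩ x (hηΩ hx) s hs.1
    have hcs : HasCompactSupport fun x => η (x - s • e) := by
      refine HasCompactSupport.intro (hηc.isCompact.image
        (by fun_prop : Continuous fun x => x + s • e)) fun x hx => ?_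
      exact hη0 _ fun hmem => hx ⟨x - s • e, hmem, by simp⟩
    have hw := hweak (fun x => η (x - s • e)) (hη.comp (by fun_prop)) hcs hsub
    have hfd : ∀ x, fderiv ℝ (fun x => η (x - s • e)) x = fderiv ℝ η (x - s • e) := fun x =>
      fderiv_comp_sub ..
    simp only [hfd] at hw
    have houtside : ∀ x ∉ Ω, η (x - s • e) = 0 := fun x hx =>
      image_eq_zero_of_notMem_tsupport (f := fun x => η (x - s • e)) fun h => hx (hsub h)
    have houtside' : ∀ x ∉ Ω, fderiv ℝ η (x - s • e) e = 0 := fun x hx => by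
      refine hdη0 _ fun hmem => hx ?_
      have := hΩ _ (hηΩ hmem) s hs.1
      simpa using this
    rw [setIntegral_eq_integral_of_forall_compl_eq_zero (fun x hx => by simp [houtside' x hx]),
      setIntegral_eq_integral_of_forall_compl_eq_zero (fun x hx => by simp [houtside x hx])] at hw
    simpa only [mul_comm] using hw
  have hint : ∀ {w : Slice → ℝ} {K : Set Slice}, IsCompact K → K ⊆ Ω → IntegrableOn w K →
      ∀ {g : Slice → ℝ} {c : ℝ}, Continuous g → (∀ x, ‖g x‖ ≤ c) → (∀ x ∉ K, g x = 0) →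
      Integrable fun x => g x * w x := by
    intro w K hK hKΩ hw g c hg hgc hg0
    refine ((hw.integrable_indicator hK.measurableSet).bdd_mul hg.aestronglyMeasurable
      (Eventually.of_forall hgc)).congr (Eventually.of_forall fun x => ?_)
    by_cases hx : x ∈ K
    · simp [indicator_of_mem hx]
    · simp [hg0 x hx]
  have hηK := hηc.isCompact
  have i1 : Integrable fun x => η x * u (x + h • e) :=
    hint hηK hηΩ (integrableOn_translate hu hηK hηΩ hΩ hh) hηcont hC hη0
  have i2 : Integrable fun x => η x * u x :=
    hint hηK hηΩ (hu.integrableOn_compact_subset hηΩ hηK) hηcont hC hη0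
  have i3 : Integrable fun x => η x * ∫ s in Ioc 0 h, v (x + s • e) :=
    hint hηK hηΩ (integrableOn_integral_translate hv hηK hηΩ hΩ h) hηcont hC hη0
  have i1' : Integrable fun x => η (x - h • e) * u x := by
    have := i1.comp_sub_right (h • e)
    simpa using this
  have e1 : ∫ x, η x * u (x + h • e) = ∫ x, η (x - h • e) * u x := by
    rw [← integral_sub_right_eq_self _ (h • e)]
    simp
  have e3 : ∫ x, η x * ∫ s in Ioc 0 h, v (x + s • e)
      = ∫ s in Ioc 0 h, ∫ x, η (x - s • e) * v x := by
    have hF := integrable_mul_translate hv hηK hηΩ hΩ hηcont.measurable hC hη0 h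
    have hsw := integral_integral_swap (f := fun s x => η x * v (x + s • e)) hF
    simp only [integral_const_mul] at hsw
    rw [← hsw]
    refine integral_congr_ae (Eventually.of_forall fun s => ?_)
    simp only
    rw [← integral_sub_right_eq_self _ (s • e)]
    simp
  have e2 : ∫ x, η (x - h • e) * u x - η x * u x
      = -∫ s in Ioc 0 h, ∫ x, fderiv ℝ η (x - s • e) e * u x := by
    have hF := integrable_translate_mul hu hηK hηΩ hΩ hdη.continuous.measurable hC' hdη0 h
    have hsw := integral_integral_swap (f := fun s x => fderiv ℝ η (x - s • e) e * u x) hF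
    rw [hsw, ← integral_neg]
    refine integral_congr_ae (Eventually.of_forall fun x => ?_)
    simp only
    rw [integral_mul_const, ← sub_mul, ← neg_mul]
    congr 1
    rw [← intervalIntegral.integral_of_le hh]
    have hd : ∀ s : ℝ, HasDerivAt (fun s : ℝ => -η (x - s • e)) (fderiv ℝ η (x - s • e) e) s := by
      intro s
      have h1 : HasDerivAt (fun s : ℝ => x - s • e) (-e) s := by
        simpa using ((hasDerivAt_id s).smul_const e).const_sub x
      have h2 := ((hη.differentiable (by simp)).differentiableAt.hasFDerivAt
        (x := x - s • e)).comp_hasDerivAt s h1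
      simpa [Function.comp_def] using h2.fun_neg
    rw [intervalIntegral.integral_eq_sub_of_hasDerivAt (fun s _ => hd s)
      (Continuous.intervalIntegrable (by fun_prop) _ _)]
    simp
    ring
  simp only [smul_eq_mul, mul_sub]
  have hs := integral_sub (i1.sub i2) i3
  have hs' := integral_sub i1 i2
  have hs'' := integral_sub i1' i2
  simp only [Pi.sub_apply] at hs
  rw [hs, hs', e1, ← hs'', e2, e3, setIntegral_congr_fun measurableSet_Ioc
    fun s hs => hweak' s (Ioc_subset_Icc_self hs), integral_neg]
  ring

lemma ae_lines_of_ae {q : Slice → Prop} (h : ∀ᵐ x, q x) :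
    ∀ᵐ y : ℝ × ℝ, ∀ᵐ r : ℝ, q (r, y) := by
  have h1 : ∀ᵐ z ∂((volume : Measure (ℝ × ℝ)).prod (volume : Measure ℝ)), q z.swap :=
    (Measure.measurePreserving_swap (μ := (volume : Measure (ℝ × ℝ)))
      (ν := (volume : Measure ℝ))).quasiMeasurePreserving.ae h
  exact Measure.ae_ae_of_ae_prod h1

lemma HasWeakPartial.congr {Ω : Set Slice} {i : Fin 3}
    {u v u' v' : Slice → ℝ} (h : HasWeakPartial Ω i u v) (hu : u =ᵐ[volume.restrict Ω] u')
    (hv : v =ᵐ[volume.restrict Ω] v') : HasWeakPartial Ω i u' v' := by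
  obtain ⟨h1, h2, h3⟩ := h
  have key : ∀ {w w' : Slice → ℝ}, LocallyIntegrableOn w Ω → w =ᵐ[volume.restrict Ω] w' →
      LocallyIntegrableOn w' Ω := by
    intro w w' hw hww x hx
    obtain ⟨t, ht, hi⟩ := hw x hx
    refine ⟨t ∩ Ω, inter_mem ht self_mem_nhdsWithin, ?_⟩
    exact Integrable.congr (hi.mono_set inter_subset_left)
      (ae_mono (Measure.restrict_mono inter_subset_right le_rfl) hww)
  refine ⟨key h1 hu, key h2 hv, fun η a b c => ?_⟩
  have e1 : ∫ x in Ω, u' x * fderiv ℝ η x (sliceVec i)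
      = ∫ x in Ω, u x * fderiv ℝ η x (sliceVec i) :=
    integral_congr_ae (by filter_upwards [hu] with x hx; rw [hx])
  have e2 : ∫ x in Ω, v' x * η x = ∫ x in Ω, v x * η x :=
    integral_congr_ae (by filter_upwards [hv] with x hx; rw [hx])
  rw [e1, e2]
  exact h3 η a b c

/-- Fubini exchanges "every `h`, almost every `x`" for "almost every `x`, almost every `h`".
Strongly measurable representatives, and the inner integral written with an indicator, supply the
joint measurability. -/
lemma HasWeakPartial.ae_ae_translate {Ω : Set Slice} {i : Fin 3} {u v : Slice → ℝ}
    (hΩo : IsOpen Ω) (hΩ : ∀ x ∈ Ω, ∀ s : ℝ, 0 ≤ s → x + s • sliceVec i ∈ Ω)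
    (hu : StronglyMeasurable u) (hv : StronglyMeasurable v) (huv : HasWeakPartial Ω i u v) :
    ∀ᵐ x, ∀ᵐ h : ℝ, 0 < h → x ∈ Ω →
      u (x + h • sliceVec i) - u x - ∫ s in Ioc 0 h, v (x + s • sliceVec i) = 0 := by
  have hall : ∀ᵐ h : ℝ, ∀ᵐ x, 0 < h → x ∈ Ω →
      u (x + h • sliceVec i) - u x
        - ∫ s, (Ioc 0 h).indicator (fun s => v (x + s • sliceVec i)) s = 0 := by
    refine Eventually.of_forall fun h => ?_
    by_cases hh : 0 < h
    · filter_upwards [huv.ae_translate_sub hΩo hΩ hh.le] with x hx _ hxΩ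
      rw [integral_indicator measurableSet_Ioc]
      exact hx hxΩ
    · exact Eventually.of_forall fun x hc => absurd hc hh
  have hshift : Measurable fun z : ℝ × Slice => z.2 + z.1 • sliceVec i :=
    measurable_snd.add (measurable_fst.smul_const _)
  have hm1 : Measurable fun z : ℝ × Slice => u (z.2 + z.1 • sliceVec i) :=
    hu.measurable.comp hshift
  have hm2 : Measurable fun z : ℝ × Slice => u z.2 := hu.measurable.comp measurable_snd
  have hm3 : StronglyMeasurable fun z : ℝ × Slice =>
      ∫ s, (Ioc 0 z.1).indicator (fun s => v (z.2 + s • sliceVec i)) s := by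
    have hset : MeasurableSet {q : (ℝ × Slice) × ℝ | q.2 ∈ Ioc 0 q.1.1} :=
      (measurableSet_lt measurable_const measurable_snd).inter
        (measurableSet_le measurable_snd (measurable_fst.comp measurable_fst))
    have hmv : Measurable fun q : (ℝ × Slice) × ℝ => v (q.1.2 + q.2 • sliceVec i) :=
      hv.measurable.comp
        ((measurable_snd.comp measurable_fst).add (measurable_snd.smul_const _))
    exact (hmv.indicator hset).stronglyMeasurable.integral_prod_right' (ν := volume)
  have hS : MeasurableSet {z : ℝ × Slice | 0 < z.1 → z.2 ∈ Ω →
      u (z.2 + z.1 • sliceVec i) - u z.2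
        - ∫ s, (Ioc 0 z.1).indicator (fun s => v (z.2 + s • sliceVec i)) s = 0} := by
    have hA : MeasurableSet {z : ℝ × Slice | 0 < z.1} :=
      measurableSet_lt measurable_const measurable_fst
    have hB : MeasurableSet {z : ℝ × Slice | z.2 ∈ Ω} := measurable_snd hΩo.measurableSet
    have hC := measurableSet_eq_fun ((hm1.sub hm2).sub hm3.measurable)
      (measurable_const (a := (0 : ℝ)))
    exact hA.imp (hB.imp hC)
  have hcomm := (Measure.ae_ae_comm (μ := (volume : Measure ℝ)) (ν := (volume : Measure Slice))
    (p := fun h x => 0 < h → x ∈ Ω → u (x + h • sliceVec i) - u x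
        - ∫ s, (Ioc 0 h).indicator (fun s => v (x + s • sliceVec i)) s = 0) hS).1 hall
  filter_upwards [hcomm] with x hx
  filter_upwards [hx] with h hxh h1 h2
  rw [← integral_indicator measurableSet_Ioc]
  exact hxh h1 h2

/-- On almost every line almost every point is a valid base point, so one exists below `r₁`;
integrating forward from it represents `u` at almost every `r > r₁`. -/
theorem HasWeakPartial.ae_lines {p r₁ : ℝ} {V : Set (ℝ × ℝ)} (hV : IsOpen V) {u v : Slice → ℝ}
    (huv : HasWeakPartial (Ioi p ×ˢ V) 0 u v) (hr₁ : p < r₁) :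
    ∀ᵐ y : ℝ × ℝ, y ∈ V → IntegrableOn (fun s => v (s, y)) (Ioi p) →
      ∃ c, ∀ᵐ r ∂volume.restrict (Ioi r₁), u (r, y) = c + ∫ s in r₁..r, v (s, y) := by
  have hΩo : IsOpen (Ioi p ×ˢ V) := isOpen_Ioi.prod hV
  have hsv : ∀ (x : Slice) (s : ℝ), x + s • sliceVec 0 = (x.1 + s, x.2) := fun x s => by
    ext <;> simp [sliceVec]
  have hΩ : ∀ x ∈ Ioi p ×ˢ V, ∀ s : ℝ, 0 ≤ s → x + s • sliceVec 0 ∈ Ioi p ×ˢ V := by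
    intro x hx s hs
    rw [hsv]
    exact ⟨lt_of_lt_of_le hx.1 (le_add_of_nonneg_right hs), hx.2⟩
  have hum := huv.1.aestronglyMeasurable
  have hvm := huv.2.1.aestronglyMeasurable
  have huv' := huv.congr hum.ae_eq_mk hvm.ae_eq_mk
  have hmain := ae_lines_of_ae
    (huv'.ae_ae_translate hΩo hΩ hum.stronglyMeasurable_mk hvm.stronglyMeasurable_mk)
  have hu' := ae_lines_of_ae ((ae_restrict_iff' hΩo.measurableSet).1 hum.ae_eq_mk)
  have hv' := ae_lines_of_ae ((ae_restrict_iff' hΩo.measurableSet).1 hvm.ae_eq_mk)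
  generalize hum.mk u = u' at *
  generalize hvm.mk v = v' at *
  filter_upwards [hmain, hu', hv'] with y hy hyu hyv hyV hint
  have hvae : (fun s => v (s, y)) =ᵐ[volume.restrict (Ioi p)] fun s => v' (s, y) := by
    refine (ae_restrict_iff' measurableSet_Ioi).2 ?_
    filter_upwards [hyv] with s hs hsp using hs ⟨hsp, hyV⟩
  obtain ⟨r₀, hr₀, hr₀'⟩ : ∃ r₀ ∈ Ioo p r₁, ∀ᵐ h : ℝ, 0 < h → (r₀, y) ∈ Ioi p ×ˢ V →
      u' ((r₀, y) + h • sliceVec 0) - u' (r₀, y)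
        - ∫ s in Ioc 0 h, v' ((r₀, y) + s • sliceVec 0) = 0 := by
    have h1 : (volume (Ioo p r₁)) ≠ 0 := by simp [hr₁]
    by_contra hcon
    refine h1 (measure_mono_null (fun r hr => ?_) (mem_ae_iff.1 hy))
    exact fun hmem => hcon ⟨r, hr, hmem⟩
  have hI : ∀ a b, p < a → a ≤ b → IntervalIntegrable (fun s => v (s, y)) volume a b :=
    fun a b ha hab => (intervalIntegrable_iff_integrableOn_Ioc_of_le hab).2
      (hint.mono_set fun s hs => ha.trans hs.1)
  -- The constant is the value at `r₁` of the absolutely continuous representative based at `r₀`.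
  refine ⟨u' (r₀, y) + ∫ s in r₀..r₁, v (s, y), (ae_restrict_iff' measurableSet_Ioi).2 ?_⟩
  have hr₀'' : ∀ᵐ r : ℝ, 0 < r - r₀ → (r₀, y) ∈ Ioi p ×ˢ V →
      u' ((r₀, y) + (r - r₀) • sliceVec 0) - u' (r₀, y)
        - ∫ s in Ioc 0 (r - r₀), v' ((r₀, y) + s • sliceVec 0) = 0 :=
    (measurePreserving_sub_right volume r₀).quasiMeasurePreserving.ae hr₀'
  filter_upwards [hr₀'', hyu] with r h1 h2 hr
  have hr0r : r₀ < r := hr₀.2.trans hr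
  have h3 := h1 (sub_pos.2 hr0r) ⟨hr₀.1, hyV⟩
  simp only [hsv, add_sub_cancel] at h3
  rw [← intervalIntegral.integral_of_le (sub_pos.2 hr0r).le,
    intervalIntegral.integral_comp_add_left (fun s => v' (s, y)), add_zero, add_sub_cancel] at h3
  have h4 : ∫ s in r₀..r, v' (s, y) = ∫ s in r₀..r, v (s, y) := by
    rw [intervalIntegral.integral_of_le hr0r.le, intervalIntegral.integral_of_le hr0r.le]
    exact integral_congr_ae (ae_mono (Measure.restrict_mono
      (fun s hs => hr₀.1.trans hs.1) le_rfl) hvae.symm)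
  rw [h2 ⟨hr₀.1.trans hr0r, hyV⟩, add_assoc, intervalIntegral.integral_add_adjacent_intervals
    (hI _ _ hr₀.1 hr₀.2.le) (hI _ _ hr₁ (le_of_lt hr)), ← h4]
  linarith

/-! ### The weighted `L²` space; measurability and integrability of the energies. -/

namespace KerrAdS

variable (K : KerrAdS)

lemma measurableSet_fundDomain : MeasurableSet K.fundDomain :=
  measurableSet_Ioi.prod (measurableSet_Ioo.prod measurableSet_Ioo)

lemma fundDomain_subset : K.fundDomain ⊆ K.coordDomain :=
  prod_mono le_rfl (prod_mono le_rfl (subset_univ _))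

lemma weight_pos {x : Slice} (hx : x ∈ K.fundDomain) : 0 < x.1 ^ 2 * Real.sin x.2.1 := by
  have h1 : 0 < x.1 := K.rp_pos.trans hx.1
  have h2 : 0 < Real.sin x.2.1 := Real.sin_pos_of_mem_Ioo hx.2.1
  positivity

lemma measurable_weight :
    Measurable fun x : Slice => ENNReal.ofReal (x.1 ^ 2 * Real.sin x.2.1) := by
  fun_prop

lemma integrable_measureL2_iff {f : Slice → ℝ} :
    Integrable f K.measureL2
      ↔ IntegrableOn (fun x => f x * (x.1 ^ 2 * Real.sin x.2.1)) K.fundDomain := by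
  rw [measureL2, integrable_withDensity_iff_integrable_smul' measurable_weight
    (Eventually.of_forall fun _ => ENNReal.ofReal_lt_top)]
  refine integrable_congr ?_
  filter_upwards [ae_restrict_mem K.measurableSet_fundDomain] with x hx
  rw [ENNReal.toReal_ofReal (K.weight_pos hx).le, smul_eq_mul, mul_comm]

lemma integral_measureL2 (f : Slice → ℝ) :
    ∫ x, f x ∂K.measureL2 = ∫ x in K.fundDomain, f x * (x.1 ^ 2 * Real.sin x.2.1) := by
  rw [measureL2, integral_withDensity_eq_integral_toReal_smul measurable_weight
    (Eventually.of_forall fun _ => ENNReal.ofReal_lt_top)]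
  refine integral_congr_ae ?_
  filter_upwards [ae_restrict_mem K.measurableSet_fundDomain] with x hx
  rw [ENNReal.toReal_ofReal (K.weight_pos hx).le, smul_eq_mul, mul_comm]

lemma restrict_absolutelyContinuous : volume.restrict K.fundDomain ≪ K.measureL2 := by
  refine withDensity_absolutelyContinuous' measurable_weight.aemeasurable ?_
  filter_upwards [ae_restrict_mem K.measurableSet_fundDomain] with x hx
  simpa using K.weight_pos hx

end KerrAdS

lemma ContinuousInL2.memLp {μ : Measure Slice} {w : ℝ → Slice → ℝ} (h : ContinuousInL2 μ w)
    (t : ℝ) : MemLp (w t) 2 μ := by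
  obtain ⟨u, -, hu⟩ := h
  exact (memLp_congr_ae (hu t)).1 (Lp.memLp (u t))

lemma ContDiffInL2.memLp_deriv {μ : Measure Slice} {w w' : ℝ → Slice → ℝ}
    (h : ContDiffInL2 μ w w') (t : ℝ) : MemLp (w' t) 2 μ := by
  obtain ⟨u, -, -, hu⟩ := h
  exact (memLp_congr_ae (hu t)).1 (Lp.memLp (deriv u t))

namespace KerrAdS

variable {K : KerrAdS}

lemma integrableOn_sq_of_memLp {w : Slice → ℝ} (h : MemLp w 2 K.measureL2) :
    IntegrableOn (fun x => w x ^ 2 * (x.1 ^ 2 * Real.sin x.2.1)) K.fundDomain :=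
  K.integrable_measureL2_iff.1 h.integrable_sq

namespace MemCH1

variable {ψ : ℝ → Slice → ℝ} {dψ : Fin 4 → ℝ → Slice → ℝ}

lemma aemeasurable (h : K.MemCH1 ψ dψ) (t : ℝ) :
    AEMeasurable (ψ t) (volume.restrict K.fundDomain) :=
  ((h.weak t 0).1.aestronglyMeasurable.mono_set K.fundDomain_subset).aemeasurable

lemma aemeasurable_deriv (h : K.MemCH1 ψ dψ) (t : ℝ) (μ : Fin 4) :
    AEMeasurable (dψ μ t) (volume.restrict K.fundDomain) := by
  refine Fin.cases ?_ (fun i => ?_) μ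
  -- The time derivative is only known through `r⁻¹ ∂_{t*}ψ` as an `L²` class, so measurability is
  -- transferred to Lebesgue measure and multiplied by `r`.
  · have h1 := ((h.cont_t.memLp_deriv t).1.mono_ac K.restrict_absolutelyContinuous).aemeasurable
    have h2 : AEMeasurable (fun x : Slice => x.1) (volume.restrict K.fundDomain) :=
      measurable_fst.aemeasurable
    refine (h2.mul h1).congr ?_
    filter_upwards [ae_restrict_mem K.measurableSet_fundDomain] with x hx
    have : x.1 ≠ 0 := (K.rp_pos.trans hx.1).ne'
    simp only [Pi.mul_apply]
    field_simp
  · exact ((h.weak t i).2.1.aestronglyMeasurable.mono_set K.fundDomain_subset).aemeasurable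

lemma integrableOn_h1Density (h : K.MemCH1 ψ dψ) (t : ℝ) :
    IntegrableOn (fun x => K.h1Density x (ψ t x) fun μ => dψ μ t x) K.fundDomain := by
  have i0 := integrableOn_sq_of_memLp (h.cont_t.memLp_deriv t)
  have i1 := integrableOn_sq_of_memLp (h.cont_r.memLp t)
  have i2 := integrableOn_sq_of_memLp (h.cont_θ.memLp t)
  have i3 := integrableOn_sq_of_memLp (h.cont_φ.memLp t)
  have i4 := integrableOn_sq_of_memLp (h.cont.memLp t)
  refine IntegrableOn.congr_fun ((((i0.add i1).add i2).add i3).add i4) (fun x hx => ?_)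
    K.measurableSet_fundDomain
  have hr : 0 < x.1 := K.rp_pos.trans hx.1
  have hs : 0 < Real.sin x.2.1 := Real.sin_pos_of_mem_Ioo hx.2.1
  simp only [Pi.add_apply, h1Density, angGradSq, mul_pow]
  rw [Real.sq_sqrt (inv_nonneg.2 (K.gθθ_pos hr _).le),
    Real.sq_sqrt (inv_nonneg.2 (K.gφφ_pos hr hs.ne').le)]
  ring

lemma aemeasurable_fluxDensity (h : K.MemCH1 ψ dψ) (t : ℝ) (α : ℝ) {ξ : ℝ → ℝ}
    (hξ : Continuous ξ) :
    AEMeasurable (fun x => K.fluxDensity α ξ x (ψ t x) fun μ => dψ μ t x)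
      (volume.restrict K.fundDomain) := by
  have hψ := h.aemeasurable t
  have hdψ := h.aemeasurable_deriv t
  have hσ : Measurable fun x : Slice => K.sig x.1 x.2.1 := by unfold sig; fun_prop
  have hG : ∀ μ ν, Measurable fun x : Slice => K.coInv x μ ν := by
    intro μ ν
    fin_cases μ <;> fin_cases ν <;>
      simp [coInv, deltaTheta, deltaPlus, deltaMinus, warp] <;> fun_prop
  have hA : Measurable K.lapseCoeff := (hG 0 0).neg
  have hν : Measurable K.invLapse := (hA.div hσ).sqrt
  have hN : AEMeasurable (fun x => K.coNormal x fun μ => dψ μ t x)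
      (volume.restrict K.fundDomain) :=
    Finset.aemeasurable_fun_sum _ fun μ _ => (hG 0 μ).aemeasurable.mul (hdψ μ)
  have hQ : AEMeasurable (fun x => K.coQuad x fun μ => dψ μ t x)
      (volume.restrict K.fundDomain) :=
    Finset.aemeasurable_fun_sum _ fun μ _ => Finset.aemeasurable_fun_sum _ fun ν _ =>
      ((hG μ ν).aemeasurable.mul (hdψ μ)).mul (hdψ ν)
  have hd0 := hdψ 0
  have hξm : Measurable fun x : Slice => ξ x.1 := hξ.measurable.comp measurable_fst
  have hs : Measurable fun x : Slice => Real.sin x.2.1 / K.xi := by fun_prop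
  have hE := hQ.sub ((hσ.const_mul (α / K.ℓ ^ 2)).aemeasurable.mul (hψ.pow_const 2))
  refine (hs.aemeasurable.mul (((hN.neg.mul hd0).add (hE.const_mul (1 / 2))).add
    ((hξm.mul hν).aemeasurable.mul (((hN.pow_const 2).div hA.aemeasurable).add
      (hE.const_mul (1 / 2)))))).congr ?_
  filter_upwards [ae_restrict_mem K.measurableSet_fundDomain] with x hx
  have hr : 0 < x.1 := K.rp_pos.trans hx.1
  have hs : 0 < Real.sin x.2.1 := Real.sin_pos_of_mem_Ioo hx.2.1
  exact (K.fluxDensity_eq α ξ hr hs.ne' _ _).symm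

theorem integrableOn_fluxDensity (h : K.MemCH1 ψ dψ) (t : ℝ) (α : ℝ) {ξ : ℝ → ℝ} {B : ℝ}
    (hξc : Continuous ξ) (hξ0 : ∀ r, 0 ≤ ξ r) (hB : ∀ r, K.rp ≤ r → ξ r ≤ B) :
    IntegrableOn (fun x => K.fluxDensity α ξ x (ψ t x) fun μ => dψ μ t x) K.fundDomain := by
  obtain ⟨k, hk⟩ := K.exists_abs_fluxDensity_le α hξ0 hB
  refine Integrable.mono' (Integrable.const_mul (h.integrableOn_h1Density t) k)
    (h.aemeasurable_fluxDensity t α hξc).aestronglyMeasurable ?_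
  filter_upwards [ae_restrict_mem K.measurableSet_fundDomain] with x hx
  exact hk x (le_of_lt hx.1) hx.2.1 _ _

end MemCH1

end KerrAdS

/-! ### The Hardy inequality on a slice. -/

namespace KerrAdS

variable {K : KerrAdS}

/-- The angular part of `fundDomain`. -/
abbrev angles : Set (ℝ × ℝ) := Ioo 0 Real.pi ×ˢ Ioo 0 (2 * Real.pi)

lemma restrict_Ioi_prod_angles (r : ℝ) :
    (volume : Measure Slice).restrict (Ioi r ×ˢ angles)
      = (volume.restrict (Ioi r)).prod (volume.restrict angles) :=
  (Measure.prod_restrict _ _).symm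

namespace MemCH1

variable {ψ : ℝ → Slice → ℝ} {dψ : Fin 4 → ℝ → Slice → ℝ}

lemma integrableOn_radial (h : K.MemCH1 ψ dψ) (t : ℝ) :
    IntegrableOn (fun x : Slice => Real.sin x.2.1 * (x.1 ^ 4 * dψ 1 t x ^ 2)) K.fundDomain := by
  refine (integrableOn_sq_of_memLp (h.cont_r.memLp t)).congr_fun (fun x _ => ?_)
    K.measurableSet_fundDomain
  ring

lemma integrableOn_value (h : K.MemCH1 ψ dψ) (t : ℝ) :
    IntegrableOn (fun x : Slice => Real.sin x.2.1 * (x.1 ^ 2 * ψ t x ^ 2)) K.fundDomain := by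
  refine (integrableOn_sq_of_memLp (h.cont.memLp t)).congr_fun (fun x _ => ?_)
    K.measurableSet_fundDomain
  ring

lemma ae_line_integrable (h : K.MemCH1 ψ dψ) (t : ℝ) : ∀ᵐ y : ℝ × ℝ ∂volume.restrict angles,
    AEStronglyMeasurable (fun r => dψ 1 t (r, y)) (volume.restrict (Ioi K.rp)) ∧
    IntegrableOn (fun r => r ^ 4 * dψ 1 t (r, y) ^ 2) (Ioi K.rp) ∧
    IntegrableOn (fun r => r ^ 2 * ψ t (r, y) ^ 2) (Ioi K.rp) := by
  have h1 := h.integrableOn_radial t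
  have h2 := h.integrableOn_value t
  have h3 := (h.aemeasurable_deriv t 1).aestronglyMeasurable
  unfold IntegrableOn at h1 h2
  rw [fundDomain, restrict_Ioi_prod_angles] at h1 h2 h3
  filter_upwards [h1.prod_left_ae, h2.prod_left_ae, h3.prod_swap.prodMk_left,
    ae_restrict_mem (measurableSet_Ioo.prod measurableSet_Ioo)] with y y1 y2 y3 hy
  have hs : Real.sin y.1 ≠ 0 := (Real.sin_pos_of_mem_Ioo hy.1).ne'
  refine ⟨y3, (y1.const_mul (Real.sin y.1)⁻¹).congr (Eventually.of_forall fun r => ?_),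
    (y2.const_mul (Real.sin y.1)⁻¹).congr (Eventually.of_forall fun r => ?_)⟩
  · simp only
    rw [inv_mul_cancel_left₀ hs]
  · simp only
    rw [inv_mul_cancel_left₀ hs]

/-- By Fubini the radial integral is taken first, and for almost every direction it is the
one-dimensional inequality, the factor `sin θ` being constant along the line. -/
theorem hardy_inequality (h : K.MemCH1 ψ dψ) (t : ℝ) {r₁ A b : ℝ} (hr₁ : K.rp < r₁)
    (hA : 0 ≤ A) (hAb : A ≤ b) (hb : A * b ≤ (b - A) * r₁ ^ 2) :
    IntegrableOn (fun x : Slice => Real.sin x.2.1 * (x.1 ^ 2 * (x.1 ^ 2 + b) * dψ 1 t x ^ 2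
      - 9 / 4 * (x.1 ^ 2 + A) * ψ t x ^ 2)) (Ioi r₁ ×ˢ angles) ∧
    0 ≤ ∫ x in Ioi r₁ ×ˢ angles, Real.sin x.2.1 * (x.1 ^ 2 * (x.1 ^ 2 + b) * dψ 1 t x ^ 2
      - 9 / 4 * (x.1 ^ 2 + A) * ψ t x ^ 2) := by
  have hr₁0 : 0 < r₁ := K.rp_pos.trans hr₁
  have hb0 : 0 ≤ b := hA.trans hAb
  have hsub : Ioi r₁ ×ˢ angles ⊆ K.fundDomain := prod_mono (Ioi_subset_Ioi hr₁.le) le_rfl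
  have hms : MeasurableSet (Ioi r₁ ×ˢ angles) :=
    measurableSet_Ioi.prod (measurableSet_Ioo.prod measurableSet_Ioo)
  have hbd : ∀ k ≥ 0, ∀ r > r₁, r ^ 2 + k ≤ (1 + k / r₁ ^ 2) * r ^ 2 := fun k hk r hr => by
    have h3 : k / r₁ ^ 2 * r₁ ^ 2 ≤ k / r₁ ^ 2 * r ^ 2 := by gcongr
    have h4 : k / r₁ ^ 2 * r₁ ^ 2 = k := by field_simp
    linarith
  have hmono : volume.restrict (Ioi r₁ ×ˢ angles) ≤ volume.restrict K.fundDomain :=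
    Measure.restrict_mono hsub le_rfl
  have hψm := (h.aemeasurable t).mono_measure hmono
  have hdm := (h.aemeasurable_deriv t 1).mono_measure hmono
  have hint : IntegrableOn (fun x : Slice => Real.sin x.2.1 *
      (x.1 ^ 2 * (x.1 ^ 2 + b) * dψ 1 t x ^ 2 - 9 / 4 * (x.1 ^ 2 + A) * ψ t x ^ 2))
      (Ioi r₁ ×ˢ angles) := by
    refine Integrable.mono' ((((h.integrableOn_radial t).mono_set hsub).const_mul
      (1 + b / r₁ ^ 2)).add (((h.integrableOn_value t).mono_set hsub).const_mul
      (9 / 4 * (1 + A / r₁ ^ 2)))) ?_ ?_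
    · have c0 : Measurable fun x : Slice => Real.sin x.2.1 := by fun_prop
      have c1 : Measurable fun x : Slice => x.1 ^ 2 * (x.1 ^ 2 + b) := by fun_prop
      have c2 : Measurable fun x : Slice => 9 / 4 * (x.1 ^ 2 + A) := by fun_prop
      exact (c0.aemeasurable.mul ((c1.aemeasurable.mul (hdm.pow_const 2)).sub
        (c2.aemeasurable.mul (hψm.pow_const 2)))).aestronglyMeasurable
    · filter_upwards [ae_restrict_mem hms] with x hx
      have hs : 0 < Real.sin x.2.1 := Real.sin_pos_of_mem_Ioo hx.2.1
      have hx1 := hbd b hb0 x.1 hx.1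
      have hx2 := hbd A hA x.1 hx.1
      have e1 : x.1 ^ 2 * (x.1 ^ 2 + b) * dψ 1 t x ^ 2
          ≤ (1 + b / r₁ ^ 2) * (x.1 ^ 4 * dψ 1 t x ^ 2) := by
        calc x.1 ^ 2 * (x.1 ^ 2 + b) * dψ 1 t x ^ 2
            ≤ x.1 ^ 2 * ((1 + b / r₁ ^ 2) * x.1 ^ 2) * dψ 1 t x ^ 2 := by gcongr
          _ = _ := by ring
      have e2 : 9 / 4 * (x.1 ^ 2 + A) * ψ t x ^ 2
          ≤ 9 / 4 * (1 + A / r₁ ^ 2) * (x.1 ^ 2 * ψ t x ^ 2) := by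
        calc 9 / 4 * (x.1 ^ 2 + A) * ψ t x ^ 2
            ≤ 9 / 4 * ((1 + A / r₁ ^ 2) * x.1 ^ 2) * ψ t x ^ 2 := by gcongr
          _ = _ := by ring
      have p1 : 0 ≤ x.1 ^ 2 * (x.1 ^ 2 + b) * dψ 1 t x ^ 2 := by positivity
      have p2 : 0 ≤ 9 / 4 * (x.1 ^ 2 + A) * ψ t x ^ 2 := by positivity
      rw [Real.norm_eq_abs, abs_mul, abs_of_pos hs]
      have : |x.1 ^ 2 * (x.1 ^ 2 + b) * dψ 1 t x ^ 2 - 9 / 4 * (x.1 ^ 2 + A) * ψ t x ^ 2|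
          ≤ (1 + b / r₁ ^ 2) * (x.1 ^ 4 * dψ 1 t x ^ 2)
            + 9 / 4 * (1 + A / r₁ ^ 2) * (x.1 ^ 2 * ψ t x ^ 2) := by
        rw [abs_le]
        constructor <;> linarith
      calc _ ≤ Real.sin x.2.1 * ((1 + b / r₁ ^ 2) * (x.1 ^ 4 * dψ 1 t x ^ 2)
            + 9 / 4 * (1 + A / r₁ ^ 2) * (x.1 ^ 2 * ψ t x ^ 2)) := by gcongr
        _ = _ := by
          simp only [Pi.add_apply]
          ring
  refine ⟨hint, ?_⟩
  unfold IntegrableOn at hint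
  rw [restrict_Ioi_prod_angles] at hint ⊢
  rw [integral_prod_symm _ hint]
  refine integral_nonneg_of_ae ?_
  have hlines := ae_restrict_of_ae (s := angles) (HasWeakPartial.ae_lines (p := K.rp) (r₁ := r₁)
    (V := Ioo 0 Real.pi ×ˢ univ) (isOpen_Ioo.prod isOpen_univ) (h.weak t 0) hr₁)
  filter_upwards [hlines, h.ae_line_integrable t,
    ae_restrict_mem (measurableSet_Ioo.prod measurableSet_Ioo)] with y hy hyi hyV
  obtain ⟨hm, hv, hu⟩ := hyi
  have hs : 0 < Real.sin y.1 := Real.sin_pos_of_mem_Ioo hyV.1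
  obtain ⟨c, hc⟩ := hy ⟨hyV.1, mem_univ _⟩ (integrableOn_Ioi_of_weighted_sq K.rp_pos hm hv)
  have hIoi : Ioi r₁ ⊆ Ioi K.rp := Ioi_subset_Ioi hr₁.le
  have key := hardy_inequality_Ioi hr₁0 hA hAb hb (hm.mono_set hIoi) (hv.mono_set hIoi)
    (hu.mono_set hIoi) hc
  simp only [Pi.zero_apply]
  rw [integral_const_mul]
  exact mul_nonneg hs.le key

end MemCH1

end KerrAdS

/-- Control of a weighted `L²` norm at one time by the same norm at a later time and
the space-time integral of the function and its time derivative. -/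
theorem integral_mul_sq_le_of_contDiff {μ : Measure Slice} {u : ℝ → Lp ℝ 2 μ}
    (hu : ContDiff ℝ 1 u) {m : Slice → ℝ} (hm : Measurable m) (hm0 : ∀ x, 0 ≤ m x) {C : ℝ}
    (hC : ∀ x, m x ≤ C) {τ τ' : ℝ} (hτ : τ ≤ τ') :
    ∫ x, m x * u τ x ^ 2 ∂μ ≤ (∫ x, m x * u τ' x ^ 2 ∂μ)
      + ∫ t in τ..τ', ∫ x, m x * (u t x ^ 2 + (deriv u t : Lp ℝ 2 μ) x ^ 2) ∂μ := by
  have hmL : MemLp m ⊤ μ := memLp_top_of_bound hm.aestronglyMeasurable C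
    (Eventually.of_forall fun x => by rw [Real.norm_of_nonneg (hm0 x)]; exact hC x)
  -- Multiplication by `m` as a bounded operator, so that `⟨T u, u⟩` is differentiated in the
  -- Hilbert space rather than under the integral.
  let T : Lp ℝ 2 μ →L[ℝ] Lp ℝ 2 μ :=
    (ContinuousLinearMap.mul ℝ ℝ).holderL μ ⊤ 2 2 (hmL.toLp m)
  have hT : ∀ f : Lp ℝ 2 μ, T f =ᵐ[μ] fun x => m x * f x := by
    intro f
    have h1 : T f = (ContinuousLinearMap.mul ℝ ℝ).holder 2 (hmL.toLp m) f := rfl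
    rw [h1]
    filter_upwards [(ContinuousLinearMap.mul ℝ ℝ).coeFn_holder (r := 2) (hmL.toLp m) f,
      hmL.coeFn_toLp] with x h2 h3
    rw [h2, h3]
    rfl
  have hinner : ∀ f : Lp ℝ 2 μ, inner ℝ (T f) f = ∫ x, m x * f x ^ 2 ∂μ := by
    intro f
    rw [L2.inner_def]
    refine integral_congr_ae ((hT f).mono fun x hx => ?_)
    simp only [hx, RCLike.inner_apply, conj_trivial]
    ring
  have hint : ∀ f : Lp ℝ 2 μ, Integrable (fun x => m x * f x ^ 2) μ := by
    intro f
    refine (L2.integrable_inner (𝕜 := ℝ) (T f) f).congr ((hT f).mono fun x hx => ?_)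
    simp only [hx, RCLike.inner_apply, conj_trivial]
    ring
  have hnn : ∀ f : Lp ℝ 2 μ, 0 ≤ inner ℝ (T f) f := fun f => by
    rw [hinner]
    exact integral_nonneg fun x => mul_nonneg (hm0 x) (sq_nonneg _)
  have hd : ∀ t, HasDerivAt u (deriv u t) t := fun t =>
    ((hu.differentiable one_ne_zero) t).hasDerivAt
  have hdc : Continuous (deriv u) := hu.continuous_deriv le_rfl
  have huc := hu.continuous
  have hE : ∀ t, HasDerivAt (fun t => inner ℝ (T (u t)) (u t))
      (inner ℝ (T (u t)) (deriv u t) + inner ℝ (T (deriv u t)) (u t)) t := fun t =>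
    (T.hasFDerivAt.comp_hasDerivAt t (hd t)).inner ℝ (hd t)
  have hcont : Continuous fun t =>
      (inner ℝ (T (u t)) (deriv u t) + inner ℝ (T (deriv u t)) (u t) : ℝ) := by fun_prop
  have hcont' : Continuous fun t =>
      (inner ℝ (T (u t)) (u t) + inner ℝ (T (deriv u t)) (deriv u t) : ℝ) := by fun_prop
  have hFTC := intervalIntegral.integral_eq_sub_of_hasDerivAt (a := τ) (b := τ')
    (fun t _ => hE t) (hcont.intervalIntegrable _ _)
  have hle : ∫ t in τ..τ', -(inner ℝ (T (u t)) (deriv u t) + inner ℝ (T (deriv u t)) (u t) : ℝ)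
      ≤ ∫ t in τ..τ', (inner ℝ (T (u t)) (u t) + inner ℝ (T (deriv u t)) (deriv u t) : ℝ) := by
    refine intervalIntegral.integral_mono_on hτ (hcont.neg.intervalIntegrable _ _)
      (hcont'.intervalIntegrable _ _) fun t _ => ?_
    -- Positivity at `u + u'` bounds `-d/dt ⟨T u, u⟩` by `⟨T u, u⟩ + ⟨T u', u'⟩`.
    have h1 := hnn (u t + deriv u t)
    rw [map_add, inner_add_left, inner_add_right, inner_add_right] at h1
    linarith
  rw [intervalIntegral.integral_neg, hFTC] at hle
  have hfin : ∀ t, (inner ℝ (T (u t)) (u t) + inner ℝ (T (deriv u t)) (deriv u t) : ℝ)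
      = ∫ x, m x * (u t x ^ 2 + (deriv u t : Lp ℝ 2 μ) x ^ 2) ∂μ := fun t => by
    rw [hinner, hinner, ← integral_add (hint _) (hint _)]
    refine integral_congr_ae (Eventually.of_forall fun x => ?_)
    simp only
    ring
  simp only [hfin] at hle
  rw [hinner, hinner] at hle
  linarith

/-! ### Moving the lower order term to the later slice. -/

namespace KerrAdS

variable {K : KerrAdS}

/-- The differentiable curve is `ψ/r`, and its factor `r⁻²` cancels the weight `r²` of the measure.
Requiring `0 < r` in the cutoff keeps the multiplier bounded on all of `Slice`, without changing the
integral over `r > r₊`. -/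
lemma integral_cutoff_measureL2 (R : ℝ) (f g : Slice → ℝ)
    (hfg : ∀ x ∈ K.fundDomain, g x = (1 / x.1) ^ 2 * f x) :
    ∫ x, {x : Slice | 0 < x.1 ∧ x.1 < R}.indicator (fun x => K.sig x.1 x.2.1 / K.xi) x * g x
        ∂K.measureL2
      = ∫ x in K.fundDomain ∩ {x | x.1 < R}, f x * K.sigWeight x := by
  have hR : MeasurableSet {x : Slice | x.1 < R} := measurableSet_lt measurable_fst measurable_const
  rw [integral_measureL2, ← setIntegral_indicator hR]
  refine setIntegral_congr_fun K.measurableSet_fundDomain fun x hx => ?_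
  have hr : 0 < x.1 := K.rp_pos.trans hx.1
  by_cases hxR : x.1 < R
  · rw [indicator_of_mem (show x ∈ {x : Slice | 0 < x.1 ∧ x.1 < R} from ⟨hr, hxR⟩),
      indicator_of_mem (show x ∈ {x : Slice | x.1 < R} from hxR), hfg x hx, sigWeight]
    field_simp
  · rw [indicator_of_notMem (show x ∉ {x : Slice | 0 < x.1 ∧ x.1 < R} from fun h => hxR h.2),
      indicator_of_notMem (show x ∉ {x : Slice | x.1 < R} from hxR)]
    ring

theorem MemCH1.integral_sq_le {ψ : ℝ → Slice → ℝ} {dψ : Fin 4 → ℝ → Slice → ℝ}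
    (h : K.MemCH1 ψ dψ) (R : ℝ) {τ τ' : ℝ} (hτ : τ ≤ τ') :
    ∫ x in K.fundDomain ∩ {x | x.1 < R}, ψ τ x ^ 2 * K.sigWeight x
      ≤ (∫ x in K.fundDomain ∩ {x | x.1 < R}, ψ τ' x ^ 2 * K.sigWeight x)
        + ∫ t in τ..τ', ∫ x in K.fundDomain ∩ {x | x.1 < R},
            (ψ t x ^ 2 + dψ 0 t x ^ 2) * K.sigWeight x := by
  obtain ⟨u, hu, huψ, hudψ⟩ := h.cont_t
  have hX := K.xi_pos
  have hset : MeasurableSet {x : Slice | 0 < x.1 ∧ x.1 < R} :=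
    (measurableSet_lt measurable_const measurable_fst).inter
      (measurableSet_lt measurable_fst measurable_const)
  have hm : Measurable ({x : Slice | 0 < x.1 ∧ x.1 < R}.indicator
      fun x => K.sig x.1 x.2.1 / K.xi) := by
    refine Measurable.indicator ?_ hset
    unfold sig
    fun_prop
  have hm0 : ∀ x, 0 ≤ {x : Slice | 0 < x.1 ∧ x.1 < R}.indicator
      (fun x => K.sig x.1 x.2.1 / K.xi) x := fun x =>
    indicator_nonneg (fun y hy => div_nonneg (K.sig_pos hy.1 _).le hX.le) x
  have hC : ∀ x, {x : Slice | 0 < x.1 ∧ x.1 < R}.indicator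
      (fun x => K.sig x.1 x.2.1 / K.xi) x ≤ (R ^ 2 + K.a ^ 2) / K.xi := fun x => by
    by_cases hx : x ∈ {x : Slice | 0 < x.1 ∧ x.1 < R}
    · rw [indicator_of_mem hx]
      have h1 := K.sig_le x.1 x.2.1
      have h2 : x.1 ^ 2 ≤ R ^ 2 := pow_le_pow_left₀ hx.1.le hx.2.le 2
      gcongr
      linarith
    · rw [indicator_of_notMem hx]
      positivity
  have key := integral_mul_sq_le_of_contDiff hu hm hm0 hC hτ
  have e1 : ∀ t, ∫ x, {x : Slice | 0 < x.1 ∧ x.1 < R}.indicator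
      (fun x => K.sig x.1 x.2.1 / K.xi) x * u t x ^ 2 ∂K.measureL2
      = ∫ x in K.fundDomain ∩ {x | x.1 < R}, ψ t x ^ 2 * K.sigWeight x := fun t => by
    rw [← integral_cutoff_measureL2 R (fun x => ψ t x ^ 2) (fun x => (1 / x.1 * ψ t x) ^ 2)
      fun x _ => by ring]
    refine integral_congr_ae ?_
    filter_upwards [huψ t] with x hx
    rw [hx]
  have e2 : ∀ t, ∫ x, {x : Slice | 0 < x.1 ∧ x.1 < R}.indicator
      (fun x => K.sig x.1 x.2.1 / K.xi) x
        * (u t x ^ 2 + (deriv u t : Lp ℝ 2 K.measureL2) x ^ 2) ∂K.measureL2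
      = ∫ x in K.fundDomain ∩ {x | x.1 < R}, (ψ t x ^ 2 + dψ 0 t x ^ 2) * K.sigWeight x :=
    fun t => by
    rw [← integral_cutoff_measureL2 R (fun x => ψ t x ^ 2 + dψ 0 t x ^ 2)
      (fun x => (1 / x.1 * ψ t x) ^ 2 + (1 / x.1 * dψ 0 t x) ^ 2) fun x _ => by ring]
    refine integral_congr_ae ?_
    filter_upwards [huψ t, hudψ t] with x hx hx'
    rw [hx, hx']
  simpa only [e1, e2] using key

end KerrAdS

/-! ### Assembly of the two regions and conclusion. -/

namespace KerrAdS

variable {K : KerrAdS}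

lemma MemCH1.integrableOn_sq_mul_sigWeight {ψ : ℝ → Slice → ℝ} {dψ : Fin 4 → ℝ → Slice → ℝ}
    (h : K.MemCH1 ψ dψ) (t : ℝ) :
    IntegrableOn (fun x => ψ t x ^ 2 * K.sigWeight x) K.fundDomain := by
  obtain ⟨k, hk0, hk⟩ := K.exists_sig_le
  have hX := K.xi_pos
  refine Integrable.mono' ((h.integrableOn_value t).const_mul (k / K.xi)) ?_ ?_
  · have hm : Measurable K.sigWeight := by
      unfold sigWeight sig
      fun_prop
    exact (((h.aemeasurable t).pow_const 2).mul hm.aemeasurable).aestronglyMeasurable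
  · filter_upwards [ae_restrict_mem K.measurableSet_fundDomain] with x hx
    have hr : 0 < x.1 := K.rp_pos.trans hx.1
    have hs : 0 < Real.sin x.2.1 := Real.sin_pos_of_mem_Ioo hx.2.1
    have hσ := K.sig_pos hr x.2.1
    have hσk := hk x.1 x.2.1 (le_of_lt hx.1)
    rw [sigWeight, Real.norm_of_nonneg (by positivity)]
    calc ψ t x ^ 2 * (K.sig x.1 x.2.1 / K.xi * Real.sin x.2.1)
        ≤ ψ t x ^ 2 * (k * x.1 ^ 2 / K.xi * Real.sin x.2.1) := by gcongr
      _ = _ := by ring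

/-- The part `2ℓ` of the radius enters here: with `a² < ℓ²` the left side is at most `3/2 ℓ⁴`, the
right side at least `2 ℓ⁴`. -/
lemma hardy_weight_le {r₁ : ℝ} (hr₁ : K.farRadius ≤ r₁) :
    K.a ^ 2 * (K.a ^ 2 + K.ℓ ^ 2 / 2) ≤ (K.a ^ 2 + K.ℓ ^ 2 / 2 - K.a ^ 2) * r₁ ^ 2 := by
  have hl := K.ℓ_pos
  have hM := K.M_pos
  have ha := abs_nonneg K.a
  have ha2 := K.a_sq_lt
  have h1 : 2 * K.ℓ ≤ r₁ := by
    unfold farRadius at hr₁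
    linarith
  have h2 : (2 * K.ℓ) ^ 2 ≤ r₁ ^ 2 := pow_le_pow_left₀ (by positivity) h1 2
  have h3 : K.a ^ 2 * (K.a ^ 2 + K.ℓ ^ 2 / 2) ≤ K.ℓ ^ 2 * (K.ℓ ^ 2 + K.ℓ ^ 2 / 2) := by gcongr
  have h4 : K.ℓ ^ 2 / 2 * (2 * K.ℓ) ^ 2 ≤ K.ℓ ^ 2 / 2 * r₁ ^ 2 := by gcongr
  nlinarith [sq_nonneg (K.ℓ ^ 2)]

/-- Control of the full norm on a slice by the energy flux and a lower order term on the same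
slice. -/
theorem exists_normH1Sq_le_flux {α r₀ r₁ δ : ℝ} {ξ : ℝ → ℝ} (hα : α < 9 / 4) (hr₀ : K.rp < r₀)
    (hr₁ : r₀ < r₁) (hfar : K.farRadius ≤ r₁) (hδ : 0 < δ) (hξ : ContDiff ℝ ∞ ξ)
    (hξ0 : ∀ r, 0 ≤ ξ r) (hξ1 : ∀ r ≥ r₁, ξ r = 0) (hN : K.UniformlyTimelike (K.vecN ξ) K.rp) :
    ∃ c > 0, ∃ C ≥ 0, ∀ (ψ : ℝ → Slice → ℝ) (dψ : Fin 4 → ℝ → Slice → ℝ) (τ : ℝ),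
      K.MemCH1 ψ dψ →
        IntegrableOn (fun x => K.fluxDensity α ξ x (ψ τ x) fun μ => dψ μ τ x) K.fundDomain ∧
        c * K.normH1Sq (ψ τ) (fun μ => dψ μ τ) ≤
          (∫ x in K.fundDomain, K.fluxDensity α ξ x (ψ τ x) fun μ => dψ μ τ x)
          + C * ∫ x in K.fundDomain ∩ {x | x.1 < r₁ + δ}, ψ τ x ^ 2 * K.sigWeight x := by
  obtain ⟨c₁, hc₁, C, hC, hnear⟩ := K.flux_coercive_near α r₁ hξ0 hξ.continuous hN
  obtain ⟨c₂, hc₂, κ, hκ, hfarb⟩ := K.flux_coercive_far hα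
  have hpr : K.rp < r₁ := hr₀.trans hr₁
  obtain ⟨B, hB⟩ : ∃ B, ∀ r, K.rp ≤ r → ξ r ≤ B := by
    obtain ⟨B, hB⟩ := (isCompact_Icc (a := K.rp) (b := r₁)).exists_bound_of_continuousOn
      hξ.continuous.continuousOn
    refine ⟨B, fun r hr => ?_⟩
    rcases le_total r r₁ with h | h
    · exact (le_abs_self _).trans (hB r ⟨hr, h⟩)
    · rw [hξ1 r h]
      exact (norm_nonneg _).trans (hB r₁ ⟨hpr.le, le_rfl⟩)
  refine ⟨min c₁ c₂, lt_min hc₁ hc₂, C, hC, fun ψ dψ τ h => ?_⟩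
  have iF := h.integrableOn_fluxDensity τ α hξ.continuous hξ0 hB
  refine ⟨iF, ?_⟩
  have iD := h.integrableOn_h1Density τ
  have iS := h.integrableOn_sq_mul_sigWeight τ
  -- Here `A = a²` comes from `Σ ≤ r² + a²` and `b = a² + ℓ²/2` from the lower bound on `Δ₋`.
  obtain ⟨iH, hH⟩ := h.hardy_inequality τ hpr (sq_nonneg K.a)
    (le_add_of_nonneg_right (by positivity : 0 ≤ K.ℓ ^ 2 / 2)) (hardy_weight_le hfar)
  have hmS : MeasurableSet {x : Slice | x.1 < r₁ + δ} :=
    measurableSet_lt measurable_fst measurable_const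
  have hmH : MeasurableSet (Ioi r₁ ×ˢ angles : Set Slice) :=
    measurableSet_Ioi.prod (measurableSet_Ioo.prod measurableSet_Ioo)
  have hsub : (Ioi r₁ ×ˢ angles : Set Slice) ⊆ K.fundDomain :=
    prod_mono (Ioi_subset_Ioi hpr.le) le_rfl
  rw [← setIntegral_indicator hmS]
  have eH := setIntegral_indicator (μ := volume) (s := K.fundDomain) hmH (f := fun x : Slice =>
    Real.sin x.2.1 * (x.1 ^ 2 * (x.1 ^ 2 + (K.a ^ 2 + K.ℓ ^ 2 / 2)) * dψ 1 τ x ^ 2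
      - 9 / 4 * (x.1 ^ 2 + K.a ^ 2) * ψ τ x ^ 2))
  rw [inter_eq_right.2 hsub] at eH
  have iS' : IntegrableOn ({x : Slice | x.1 < r₁ + δ}.indicator
      fun x => ψ τ x ^ 2 * K.sigWeight x) K.fundDomain := Integrable.indicator iS hmS
  have iH' := (integrable_indicator_iff hmH).2 iH
  -- One pointwise bound covers both regions: the Hardy term lives on `r > r₁`, and the error,
  -- supported on `r < r₁ + δ`, is needed only on `r ≤ r₁`.
  have hpt : ∀ x ∈ K.fundDomain,
      min c₁ c₂ * K.h1Density x (ψ τ x) (fun μ => dψ μ τ x)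
        + κ * (Ioi r₁ ×ˢ angles).indicator (fun x : Slice => Real.sin x.2.1 *
          (x.1 ^ 2 * (x.1 ^ 2 + (K.a ^ 2 + K.ℓ ^ 2 / 2)) * dψ 1 τ x ^ 2
            - 9 / 4 * (x.1 ^ 2 + K.a ^ 2) * ψ τ x ^ 2)) x
      ≤ K.fluxDensity α ξ x (ψ τ x) (fun μ => dψ μ τ x)
        + C * {x : Slice | x.1 < r₁ + δ}.indicator (fun x => ψ τ x ^ 2 * K.sigWeight x) x := by
    intro x hx
    have hD := K.h1Density_nonneg (K.rp_pos.trans hx.1) hx.2.1 (ψ τ x) (fun μ => dψ μ τ x)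
    have hW : 0 ≤ ψ τ x ^ 2 * K.sigWeight x := by
      have hr : 0 < x.1 := K.rp_pos.trans hx.1
      have hs : 0 < Real.sin x.2.1 := Real.sin_pos_of_mem_Ioo hx.2.1
      have := K.sig_pos hr x.2.1
      have := K.xi_pos
      rw [sigWeight]
      positivity
    rcases le_or_gt x.1 r₁ with hle | hgt
    · rw [indicator_of_notMem (fun hmem : x ∈ Ioi r₁ ×ˢ angles => not_lt.2 hle hmem.1),
        indicator_of_mem (show x ∈ {x : Slice | x.1 < r₁ + δ} from
          lt_of_le_of_lt hle (lt_add_of_pos_right _ hδ)), mul_zero, add_zero]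
      exact (mul_le_mul_of_nonneg_right (min_le_left _ _) hD).trans
        (hnear x (le_of_lt hx.1) hle hx.2.1 _ _)
    · rw [indicator_of_mem (show x ∈ Ioi r₁ ×ˢ angles from ⟨hgt, hx.2⟩)]
      have h1 := hfarb ξ x (le_of_lt hx.1) (hfar.trans hgt.le) hx.2.1 (hξ1 _ hgt.le) (ψ τ x)
        (fun μ => dψ μ τ x)
      have h2 := mul_le_mul_of_nonneg_right (min_le_right c₁ c₂) hD
      have h3 : 0 ≤ C * {x : Slice | x.1 < r₁ + δ}.indicator
          (fun x => ψ τ x ^ 2 * K.sigWeight x) x :=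
        mul_nonneg hC (indicator_apply_nonneg fun _ => hW)
      linarith
  have hmono := setIntegral_mono_on ((iD.const_mul (min c₁ c₂)).add
    (iH'.integrableOn.const_mul κ)) (iF.add (iS'.const_mul C)) K.measurableSet_fundDomain hpt
  simp only [Pi.add_apply] at hmono
  rw [integral_add (iD.const_mul _) (iH'.integrableOn.const_mul κ),
    integral_add iF (iS'.const_mul C), integral_const_mul, integral_const_mul, integral_const_mul,
    eH] at hmono
  have := mul_nonneg hκ hH
  change min c₁ c₂ * ∫ x in K.fundDomain, K.h1Density x (ψ τ x) (fun μ => dψ μ τ x) ≤ _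
  linarith

end KerrAdS

end

theorem mainTheorem8 (K : KerrAdS) :
    ∃ R₁ : ℝ, ∀ (α r₀ r₁ δ : ℝ) (ξ : ℝ → ℝ),
      α < 9 / 4 → K.rp < r₀ → r₀ < r₁ → R₁ ≤ r₁ → 0 < δ →
      K.UniformlyTimelike KerrAdS.vecT r₀ →
      ContDiff ℝ ∞ ξ → (∀ r, 0 ≤ ξ r) → (∀ r ≤ r₀, ξ r = 1) → (∀ r ≥ r₁, ξ r = 0) →
      K.UniformlyTimelike (K.vecN ξ) K.rp →
      ∃ c > 0, ∃ C > 0, ∀ (F : Spacetime → ℝ → (Fin 4 → ℝ) → ℝ) (h : ℝ → ℝ × ℝ → ℝ)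
        (ψ : ℝ → Slice → ℝ) (dψ : Fin 4 → ℝ → Slice → ℝ) (τ τ' : ℝ), τ ≤ τ' →
        K.IsSolutionCH1 α F h ψ dψ →
        IntegrableOn (fun x => K.fluxDensity α ξ x (ψ τ x) (fun μ => dψ μ τ x)) K.fundDomain ∧
        c * K.normH1Sq (ψ τ) (fun μ => dψ μ τ) ≤
          (∫ x in K.fundDomain, K.fluxDensity α ξ x (ψ τ x) (fun μ => dψ μ τ x))
          + C * ((∫ x in K.fundDomain ∩ {x | x.1 < r₁ + δ}, ψ τ' x ^ 2 * K.sigWeight x)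
            + ∫ t in τ..τ', ∫ x in K.fundDomain ∩ {x | x.1 < r₁ + δ},
                (ψ t x ^ 2 + dψ 0 t x ^ 2) * K.sigWeight x) := by
  refine ⟨K.farRadius, ?_⟩
  intro α r₀ r₁ δ ξ hα hr₀ hr₁ hfar hδ _ hξ hξ0 _ hξ1 hN
  obtain ⟨c, hc, C, hC, hmain⟩ :=
    KerrAdS.exists_normH1Sq_le_flux hα hr₀ hr₁ hfar hδ hξ hξ0 hξ1 hN
  -- `C` may be zero; enlarging it by `1` is harmless since the bracket is nonnegative, as it bounds
  -- the nonnegative integral at time `τ`.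
  refine ⟨c, hc, C + 1, by positivity, fun F h ψ dψ τ τ' hτ hsol => ?_⟩
  obtain ⟨hint, hle⟩ := hmain ψ dψ τ hsol.memCH1
  refine ⟨hint, hle.trans ?_⟩
  have hgrow := hsol.memCH1.integral_sq_le (r₁ + δ) hτ
  have hnn : 0 ≤ ∫ x in K.fundDomain ∩ {x | x.1 < r₁ + δ}, ψ τ x ^ 2 * K.sigWeight x := by
    refine setIntegral_nonneg (K.measurableSet_fundDomain.inter
      (measurableSet_lt measurable_fst measurable_const)) fun x hx => ?_
    have hr : 0 < x.1 := K.rp_pos.trans hx.1.1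
    have hs : 0 < Real.sin x.2.1 := Real.sin_pos_of_mem_Ioo hx.1.2.1
    have := K.sig_pos hr x.2.1
    have := K.xi_pos
    rw [KerrAdS.sigWeight]
    positivity
  have h1 := mul_le_mul_of_nonneg_left hgrow hC
  linarith
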